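/- Let $M$ be a smooth $3$-manifold (Hausdorff, second countable, without boundary, possibly non-compact) and let $\alpha$ be a contact form on $M$, i.e. a smooth one-form with $\alpha\wedge d\alpha$ nowhere zero; $\xi=\ker\alpha$ is the corresponding co-oriented contact structure. Let $J^1S^1=S^1_\theta\times\mathbb{R}_p\times\mathbb{R}_z$ with $S^1=\mathbb{R}/2\pi\mathbb{Z}$ and the contact structure $\xi_{st}=\ker(dz-p\,d\theta)$. (1) (Normal form.) Let $\gamma\colon S^1\to M$ be a smooth embedding, with image the knot $K$. Then there are an open neighborhood $U\supset K$ and a contact embedding $\phi\colon(U,\xi)\hookrightarrow(J^1S^1,\xi_{st})$, i.e. a smooth embedding with $\phi^*(dz-p\,d\theta)=f\alpha$ for a function $f>0$ on $U$, such that $$\phi(\gamma(\theta))=(\theta,\,-\alpha(\dot\gamma(\theta)),\,0)\qquad\text{for all }\theta\in S^1 .$$ (2) (Extension of isotopies.) Let $A$ be a compact smooth $1$-manifold, possibly with boundary (a finite disjoint union of circles and closed arcs). Let $\gamma_t\colon A\hookrightarrow M$, $t\in[0,1]$, be a smooth isotopy of embeddings, and let $\eta_t\colon A\to A$, $t\in[0,1]$,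 be a smooth path of diffeomorphisms with $\eta_0=\mathrm{Id}_A$, such that for some neighborhood $N$ of $\partial A$ one has $\gamma_t|_N=\gamma_0|_N$ and $\eta_t|_N=\mathrm{Id}_N$ for all $t$, and such that $$\gamma_t^*\alpha=\eta_t^*(\gamma_0^*\alpha)\qquad\text{for all }t\in[0,1].$$ Then there is an ambient contact isotopy $\varphi_t\colon M\to M$, $t\in[0,1]$, i.e. a smooth path of diffeomorphisms with $\varphi_0=\mathrm{Id}_M$ and $\varphi_t^*\alpha=f_t\alpha$ for functions $f_t>0$, such that $\varphi_t\circ\gamma_0=\gamma_t\circ\eta_t^{-1}$ for all $t\in[0,1]$, and such that every $\varphi_t$ is the identity on one and the same neighborhood of $\gamma_0(\partial A)$. -/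

import Mathlib

open Set Topology Manifold
open scoped ContDiff Manifold

noncomputable section

section Forms

variable {E H : Type*} [NormedAddCommGroup E] [NormedSpace ℝ E] [TopologicalSpace H]
  {E' H' : Type*} [NormedAddCommGroup E'] [NormedSpace ℝ E'] [TopologicalSpace H']

/-- A (not necessarily smooth) differential one-form on the manifold `M`: a continuous linear
functional on each tangent space. -/
abbrev OneForm (I : ModelWithCorners ℝ E H) (M : Type*) [TopologicalSpace M]
    [ChartedSpace H M] : Type _ :=
  ∀ x : M, TangentSpace I x →L[ℝ] ℝ

/-- Smoothness of a one-form: it is a smooth section of the cotangent bundle `Hom(TM, ℝ)`. -/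
def OneForm.IsSmooth {I : ModelWithCorners ℝ E H} {M : Type*} [TopologicalSpace M]
    [ChartedSpace H M] [IsManifold I ∞ M] (α : OneForm I M) : Prop :=
  ContMDiff I (I.prod 𝓘(ℝ, E →L[ℝ] ℝ)) ∞
    (fun x : M => Bundle.TotalSpace.mk' (E →L[ℝ] ℝ)
      (E := fun y : M => TangentSpace I y →L[ℝ] ℝ) x (α x))

/-- The coordinate expression of a one-form in the preferred chart `κ` at `x₀`, that is, the
pull-back of `α` under `κ⁻¹`; it is meaningful on the target of the chart. -/
def OneForm.inChart {I : ModelWithCorners ℝ E H} {M : Type*} [TopologicalSpace M]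
    [ChartedSpace H M] (α : OneForm I M) (x₀ : M) : E → (E →L[ℝ] ℝ) :=
  fun p => (α ((extChartAt I x₀).symm p)).comp (mfderiv 𝓘(ℝ, E) I (extChartAt I x₀).symm p)

/-- The exterior derivative `(dα)ₓ(v, w)` of a one-form on a manifold without boundary, computed
in the preferred chart at `x` as `(D_v a)(w) - (D_w a)(v)`; the preferred chart at `x` is also the
one that identifies `TangentSpace I x` with the model space `E`. -/
def OneForm.d {I : ModelWithCorners ℝ E H} {M : Type*} [TopologicalSpace M]
    [ChartedSpace H M] (α : OneForm I M) (x : M) (v w : TangentSpace I x) : ℝ :=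
  fderiv ℝ (α.inChart x) (extChartAt I x x) v w - fderiv ℝ (α.inChart x) (extChartAt I x x) w v

/-- A contact form on a manifold of dimension three: a smooth one-form such that the three-form
`(α ∧ dα)(u, v, w) = α(u) dα(v, w) + α(v) dα(w, u) + α(w) dα(u, v)` vanishes nowhere. The contact
structure that it defines is the co-oriented plane field `ξ = ker α`. -/
def OneForm.IsContact {M : Type*} [TopologicalSpace M] [ChartedSpace (EuclideanSpace ℝ (Fin 3)) M]
    [IsManifold (𝓡 3) ∞ M] (α : OneForm (𝓡 3) M) : Prop :=
  α.IsSmooth ∧ ∀ x : M, ∃ u v w : TangentSpace (𝓡 3) x,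
    α x u * α.d x v w + α x v * α.d x w u + α x w * α.d x u v ≠ 0

/-- At the point `x` the map `φ` respects the co-oriented hyperplane fields `ker α` and `ker β`:
the pull-back of `β` under `φ` is, at `x`, a positive multiple of `α`. -/
def IsContactAt {I : ModelWithCorners ℝ E H} {J : ModelWithCorners ℝ E' H'}
    {M : Type*} [TopologicalSpace M] [ChartedSpace H M]
    {N : Type*} [TopologicalSpace N] [ChartedSpace H' N]
    (α : OneForm I M) (β : OneForm J N) (φ : M → N) (x : M) : Prop :=
  ∃ c : ℝ, 0 < c ∧ ∀ v : TangentSpace I x, β (φ x) (mfderiv I J φ x v) = c * α x v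

/-- A smooth embedding of finite-dimensional manifolds: a smooth map with injective differentials
that is a homeomorphism onto its image. -/
structure IsSmoothEmb (I : ModelWithCorners ℝ E H) (J : ModelWithCorners ℝ E' H')
    {M : Type*} [TopologicalSpace M] [ChartedSpace H M]
    {N : Type*} [TopologicalSpace N] [ChartedSpace H' N] (f : M → N) : Prop where
  smooth : ContMDiff I J ∞ f
  immersive : ∀ x : M, Function.Injective (mfderiv I J f x)
  embedding : IsEmbedding f

/-- `φ` restricts to a contact embedding `(U, ker α) ↪ (N, ker β)` of the open subset `U`. -/
structure IsContactEmbOn {I : ModelWithCorners ℝ E H} {J : ModelWithCorners ℝ E' H'}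
    {M : Type*} [TopologicalSpace M] [ChartedSpace H M]
    {N : Type*} [TopologicalSpace N] [ChartedSpace H' N]
    (α : OneForm I M) (β : OneForm J N) (U : Set M) (φ : M → N) : Prop where
  isOpen : IsOpen U
  smooth : ContMDiffOn I J ∞ φ U
  immersive : ∀ x ∈ U, Function.Injective (mfderiv I J φ x)
  embedding : IsEmbedding (U.domRestrict φ)
  contact : ∀ x ∈ U, IsContactAt α β φ x

/-- An ambient contact isotopy `φ_t`, `t ∈ [0, 1]`: a smooth path of contactomorphisms of
`(M, ker α)` that starts at the identity. (Values at other times are irrelevant.) -/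
structure IsContactIsotopy {I : ModelWithCorners ℝ E H} {M : Type*} [TopologicalSpace M]
    [ChartedSpace H M] (α : OneForm I M) (φ : ℝ → (M ≃ₘ⟮I, I⟯ M)) : Prop where
  smooth : ContMDiffOn (𝓘(ℝ, ℝ).prod I) I ∞ (fun q : ℝ × M => φ q.1 q.2)
    (Icc (0 : ℝ) 1 ×ˢ (univ : Set M))
  start : ∀ x : M, φ 0 x = x
  contact : ∀ t ∈ Icc (0 : ℝ) 1, ∀ x : M, IsContactAt α α (φ t) x

end Forms

/-- The angular form `dθ` on the unit circle `S¹ ⊆ ℂ`: `dθ_z(v) = Im(z̄ v)`. -/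
def dTheta : OneForm (𝓡 1) Circle := fun z =>
  (Complex.imCLM.comp
    ((ContinuousLinearMap.mul ℝ ℂ) ((starRingEnd ℂ) (z : ℂ)))).comp
    (mfderiv (𝓡 1) 𝓘(ℝ, ℂ) (fun w : Circle => (w : ℂ)) z)

/-- The one-jet space `J¹S¹ = S¹ × ℝ × ℝ` with points `(θ, p, z)`. -/
abbrev JetCircle : Type := Circle × ℝ × ℝ

/-- The product smooth structure on `J¹S¹`. -/
abbrev jetModel : ModelWithCorners ℝ (EuclideanSpace ℝ (Fin 1) × ℝ × ℝ)
    (ModelProd (EuclideanSpace ℝ (Fin 1)) (ModelProd ℝ ℝ)) :=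
  (𝓡 1).prod (𝓘(ℝ, ℝ).prod 𝓘(ℝ, ℝ))

/-- The standard contact form `dz - p dθ` on `J¹S¹`. -/
def jetForm : OneForm jetModel JetCircle := fun q =>
  let dz : TangentSpace jetModel q →L[ℝ] ℝ :=
    mfderiv jetModel 𝓘(ℝ, ℝ) (fun r : JetCircle => r.2.2) q
  let dθ : TangentSpace jetModel q →L[ℝ] ℝ :=
    (dTheta q.1).comp (mfderiv jetModel (𝓡 1) (fun r : JetCircle => r.1) q)
  dz - q.2.1 • dθ

/-- The velocity at the angle `θ` of a closed curve `γ : S¹ → M`, where `S¹ = ℝ / 2πℤ`. -/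
def angularVelocity {M : Type*} [TopologicalSpace M] [ChartedSpace (EuclideanSpace ℝ (Fin 3)) M]
    (γ : Circle → M) (θ : ℝ) : TangentSpace (𝓡 3) (γ (Circle.exp θ)) :=
  mfderiv 𝓘(ℝ, ℝ) (𝓡 3) (fun s : ℝ => γ (Circle.exp s)) θ (1 : ℝ)

end

open Set Topology Manifold
open scoped ContDiff Manifold

noncomputable section

set_option linter.unusedSectionVars false

/-! Extension of isotopies. Put ψ_t = γ_t ∘ η_t⁻¹. The hypothesis says exactly that ψ_t^*α does not
depend on t. With v the velocity of ψ, Cartan's formula turns this into d(α(v)) = -ι_v dα in the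
directions tangent to the curve. Hence prescribing the value α(v) and the differential -ι_v dα at
the points of ψ_t(A) is consistent, and a function h_t with this one-jet exists nearby. The contact
field of h is characterised by α(X) = h and ι_X dα = dh(R)α - dh, R being the Reeb field; along the
curve dh(R) = -dα(v, R) = 0, so X equals v there. After a cut-off the field X integrates to an
ambient contact isotopy, and uniqueness of integral curves shows that it carries γ_0 to ψ_t. The
tangential identity is `fderiv_apply_time`, the local function is `exists_local_hamiltonian`, the
patching is `IsCharacteristicIsotopy.exists_generator`, and the integration is
`IsCharacteristicIsotopy.exists_contactIsotopy`.

Normal form. Starting at γ(θ), flow for time z along a field Z with α(Z) = 1 on the knot, then for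
time s along a field tangent to ξ that depends on θ. This gives Ψ(θ, z, s) with Ψ^*α = A dθ + B dz
and B = 1 on the axis. With p = -A/B the form is B(dz - p dθ), so (θ, z, s) ↦ (θ, p, z) composed
with Ψ⁻¹ is the wanted map, provided that both maps are local diffeomorphisms near the axis. Where B
> 0 both conditions follow from A_s B - A B_s ≠ 0. On the axis this reads dα(∂_s, η) ≠ 0, where η =
γ' - α(γ')Z lies in ξ.

So Z has to be chosen with η ≠ 0 everywhere; then a Legendrian direction with dα(∂_s, η) < 0 exists.
The Reeb field can fail, since the knot may be tangent to it. Instead Z is R plus a constant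
combination, with coefficients b, of Legendrian fields that span ξ along the knot. Where α(γ') ≠ 0,
the equation η = 0 imposes two independent conditions on b, and θ is one parameter, so the bad b
form a null set (`exists_forall_ne_antisymm_system`); where α(γ') = 0, η = γ' is nonzero anyway.
This is `OneForm.IsContact.exists_knot_parametrization`, and
`OneForm.IsContact.exists_jet_embedding` passes to the jet space.

Two analytic tools support both halves. Flows depend smoothly on everything, by the inverse function
theorem in a space of continuous curves. Families that are smooth only on the closed interval [0, 1]
extend smoothly past its ends by Seeley's weighted reflections, so that derivatives and the inverse
function theorem apply at the end times as well. -/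

theorem exists_contDiffOn_localInverse {E F : Type*} [NormedAddCommGroup E] [NormedSpace ℝ E]
    [NormedAddCommGroup F] [NormedSpace ℝ F] [CompleteSpace E] {f : E → F} {U : Set E}
    (hU : IsOpen U) (hf : ContDiffOn ℝ ∞ f U) {a : E} (ha : a ∈ U) (f' : E ≃L[ℝ] F)
    (hf' : HasFDerivAt f (f' : E →L[ℝ] F) a) :
    ∃ e : OpenPartialHomeomorph E F, a ∈ e.source ∧ e.source ⊆ U ∧ (∀ x, e x = f x) ∧
      ContDiffOn ℝ ∞ e.symm e.target := by
  have hfa : ContDiffAt ℝ ∞ f a := hf.contDiffAt (hU.mem_nhds ha)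
  let e₀ := hfa.toOpenPartialHomeomorph f hf' (by simp)
  -- The inverse has to be smooth on its whole domain and not only at the image of a. Invertibility
  -- of the derivative is an open condition, so the source is cut down to the points where it holds.
  let W : Set E := U ∩ (fderiv ℝ f) ⁻¹' range ((↑) : (E ≃L[ℝ] F) → (E →L[ℝ] F))
  have hW : IsOpen W :=
    (hf.continuousOn_fderiv_of_isOpen hU (by simp)).isOpen_inter_preimage hU
      (ContinuousLinearEquiv.isOpen)
  refine ⟨e₀.restrOpen W hW, ?_, ?_, fun x => rfl, ?_⟩
  · simp only [OpenPartialHomeomorph.restrOpen_source]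
    exact ⟨hfa.mem_toOpenPartialHomeomorph_source hf' (by simp), ha, ⟨f', hf'.fderiv.symm⟩⟩
  · simp only [OpenPartialHomeomorph.restrOpen_source]
    exact fun x hx => hx.2.1
  · intro y hy
    have hy' := (e₀.restrOpen W hW).map_target hy
    simp only [OpenPartialHomeomorph.restrOpen_source] at hy'
    obtain ⟨_, hyU, g', hg'⟩ := hy'
    refine (OpenPartialHomeomorph.contDiffAt_symm (f₀' := g') _ hy ?_ ?_).contDiffWithinAt
    · rw [hg']
      exact ((hf.contDiffAt (hU.mem_nhds hyU)).differentiableAt (by simp)).hasFDerivAt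
    · exact hf.contDiffAt (hU.mem_nhds hyU)

/-! ### Smoothness of superposition operators on spaces of continuous curves -/

section Nemytskii

universe u
variable {K : Type*} [TopologicalSpace K] [CompactSpace K]
  {E F : Type u} [NormedAddCommGroup E] [NormedSpace ℝ E] [NormedAddCommGroup F] [NormedSpace ℝ F]

/-- The superposition operator `γ ↦ f ∘ γ` on continuous curves. -/
def superposition (K : Type*) [TopologicalSpace K] (f : C(E, F)) (γ : C(K, E)) : C(K, F) :=
  f.comp γ

/-- Pointwise application of a continuous family of operators to a continuous curve. -/
def pointwiseApply (K : Type*) [TopologicalSpace K] [CompactSpace K] (E F : Type u)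
    [NormedAddCommGroup E] [NormedSpace ℝ E] [NormedAddCommGroup F] [NormedSpace ℝ F] :
    C(K, E →L[ℝ] F) →L[ℝ] C(K, E) →L[ℝ] C(K, F) :=
  LinearMap.mkContinuous₂
    (LinearMap.mk₂ ℝ (fun (A : C(K, E →L[ℝ] F)) (γ : C(K, E)) =>
        (⟨fun k => A k (γ k), by fun_prop⟩ : C(K, F)))
      (by intros; ext; simp) (by intros; ext; simp) (by intros; ext; simp) (by intros; ext; simp))
    1 (by
      intro A γ
      rw [ContinuousMap.norm_le _ (by positivity)]
      intro k
      rw [one_mul]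
      exact (ContinuousLinearMap.le_opNorm _ _).trans
        (mul_le_mul (A.norm_coe_le_norm k) (γ.norm_coe_le_norm k) (norm_nonneg _)
          (norm_nonneg (E := C(K, E →L[ℝ] F)) A)))

/-- The range of γ is compact, so a single δ controls the oscillation of f' around all points γ k.
The mean value inequality then bounds the remainder by ε ‖v‖ uniformly in k. -/
theorem hasFDerivAt_superposition (f : C(E, F)) (f' : C(E, E →L[ℝ] F))
    (h : ∀ x, HasFDerivAt f (f' x) x) (γ : C(K, E)) :
    HasFDerivAt (superposition K f) (pointwiseApply K E F (superposition K f' γ)) γ := by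
  rw [hasFDerivAt_iff_isLittleO_nhds_zero, Asymptotics.isLittleO_iff]
  intro ε hε
  have hc : IsCompact (range γ) := isCompact_range γ.continuous
  have huc := hc.uniformContinuousAt_of_continuousAt f' (fun x _ => f'.continuous.continuousAt)
    (Metric.dist_mem_uniformity hε)
  obtain ⟨δ, hδ, hδ'⟩ := Metric.mem_uniformity_dist.1 huc
  filter_upwards [Metric.ball_mem_nhds (0 : C(K, E)) hδ] with v hv
  rw [ContinuousMap.norm_le _ (by positivity)]
  intro k
  have hvk : ‖v k‖ < δ := (v.norm_coe_le_norm k).trans_lt (by simpa using hv)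
  have := (convex_ball (γ k) δ).norm_image_sub_le_of_norm_hasFDerivWithin_le'
    (f := f) (f' := fun x => f' x) (φ := f' (γ k)) (C := ε) (x := γ k) (y := γ k + v k)
    (fun x _ => (h x).hasFDerivWithinAt)
    (fun x hx => by
      have := hδ' (a := γ k) (b := x) (by rwa [dist_comm]) (mem_range_self k)
      rw [← dist_eq_norm, dist_comm]
      exact le_of_lt this)
    (Metric.mem_ball_self hδ) (by simpa using hvk)
  simp only [add_sub_cancel_left] at this
  exact this.trans (mul_le_mul_of_nonneg_left (v.norm_coe_le_norm k) hε.le)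

/-- Induction on the order: the derivative is superposition with f', followed by the bounded
bilinear pointwise application. The target changes from F to E →L[ℝ] F at each step, which is why E
and F share a universe. -/
theorem contDiff_superposition (f : C(E, F)) (hf : ContDiff ℝ ∞ f) :
    ContDiff ℝ ∞ (superposition K f) := by
  rw [contDiff_infty]
  intro n
  induction n generalizing F with
  | zero =>
    rw [Nat.cast_zero, contDiff_zero]
    exact ContinuousMap.continuous_postcomp f
  | succ n ih =>
    have hf1 : ContDiff ℝ ∞ (fderiv ℝ f) := hf.fderiv_right (by simp)
    let f' : C(E, E →L[ℝ] F) := ⟨fderiv ℝ f, hf1.continuous⟩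
    have hd : ∀ γ : C(K, E), HasFDerivAt (superposition K f)
        (pointwiseApply K E F (superposition K f' γ)) γ :=
      hasFDerivAt_superposition f f' (fun x => (hf.differentiable (by simp) x).hasFDerivAt)
    rw [Nat.cast_succ, contDiff_succ_iff_fderiv]
    refine ⟨fun γ => (hd γ).differentiableAt, by simp, ?_⟩
    have : fderiv ℝ (superposition K f) = fun γ => pointwiseApply K E F (superposition K f' γ) :=
      funext fun γ => (hd γ).fderiv
    rw [this]
    exact (pointwiseApply K E F).contDiff.comp (ih f' hf1)

end Nemytskii

/-! ### Smooth local flows on Banach spaces -/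

section LocalFlow

universe u
variable {E : Type u} [NormedAddCommGroup E] [NormedSpace ℝ E] [CompleteSpace E]

/-- The primitive, vanishing at `0`, of a continuous curve on the unit interval. -/
def curvePrimitive (E : Type u) [NormedAddCommGroup E] [NormedSpace ℝ E] [CompleteSpace E] :
    C(unitInterval, E) →L[ℝ] C(unitInterval, E) :=
  have hc : ∀ γ : C(unitInterval, E),
      Continuous fun r : ℝ => γ (projIcc (0 : ℝ) 1 zero_le_one r) :=
    fun γ => γ.continuous.comp continuous_projIcc
  LinearMap.mkContinuous
    { toFun := fun γ => ⟨fun σ : unitInterval =>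
        ∫ r in (0 : ℝ)..σ, γ (projIcc (0 : ℝ) 1 zero_le_one r),
        (intervalIntegral.continuous_primitive (fun a b => (hc γ).intervalIntegrable a b) 0).comp
          continuous_subtype_val⟩
      map_add' := fun γ δ => by
        ext σ
        exact intervalIntegral.integral_add ((hc γ).intervalIntegrable _ _)
          ((hc δ).intervalIntegrable _ _)
      map_smul' := fun c γ => by
        ext σ
        exact intervalIntegral.integral_smul c _ }
    1 (fun γ => by
      rw [ContinuousMap.norm_le _ (by positivity), one_mul]
      intro σ
      refine (intervalIntegral.norm_integral_le_of_norm_le_const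
        (C := ‖γ‖) (fun r _ => γ.norm_coe_le_norm _)).trans ?_
      rw [sub_zero, abs_of_nonneg σ.2.1]
      exact mul_le_of_le_one_right (norm_nonneg _) σ.2.2)

/-- A smooth vector field on a Banach space has a smooth local flow. -/
theorem exists_contDiffOn_localFlow (f : E → E) (hf : ContDiff ℝ ∞ f) (x₀ : E) :
    ∃ ε > 0, ∃ F : ℝ × E → E,
      ContDiffOn ℝ ∞ F (Ioo (-ε) ε ×ˢ Metric.ball x₀ ε) ∧
      ∀ x ∈ Metric.ball x₀ ε, F (0, x) = x ∧
        ∀ s ∈ Ioo (-ε) ε, HasDerivAt (fun s => F (s, x)) (f (F (s, x))) s := by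
  let C := C(unitInterval, E)
  let fc : C(E, E) := ⟨f, hf.continuous⟩
  let J := curvePrimitive E
  let cst : E →L[ℝ] C := ContinuousLinearMap.const ℝ unitInterval
  -- A solution run for time T from x is rescaled to the unit interval, where it satisfies γ(σ) = x
  -- + T ∫₀^σ f(γ). The second component of G is the defect of this equation, so inverting G near
  -- the constant curve yields the solution as a smooth function of (T, x).
  let G : (ℝ × E) × C → (ℝ × E) × C := fun q =>
    (q.1, q.2 - cst q.1.2 - q.1.1 • J (superposition unitInterval fc q.2))
  have hG : ContDiff ℝ ∞ G := by
    refine contDiff_fst.prodMk ((contDiff_snd.sub (cst.contDiff.comp (contDiff_snd.comp contDiff_fst))).sub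
      (ContDiff.smul (contDiff_fst.comp contDiff_fst) (J.contDiff.comp
        ((contDiff_superposition fc hf).comp contDiff_snd))))
  let q₀ : (ℝ × E) × C := ((0, x₀), cst x₀)
  let v₀ : C := J (superposition unitInterval fc (cst x₀))
  let B : ℝ × E →L[ℝ] C := cst.comp (ContinuousLinearMap.snd ℝ ℝ E) +
    (ContinuousLinearMap.fst ℝ ℝ E).smulRight v₀
  -- At T = 0 the factor T kills the derivative of the superposition, so the derivative of G is
  -- unipotent triangular and is inverted by changing the sign of B.
  let A : ((ℝ × E) × C) ≃L[ℝ] (ℝ × E) × C := ContinuousLinearEquiv.equivOfInverse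
    ((ContinuousLinearMap.fst ℝ _ _).prod
      (ContinuousLinearMap.snd ℝ _ _ - B.comp (ContinuousLinearMap.fst ℝ _ _)))
    ((ContinuousLinearMap.fst ℝ _ _).prod
      (ContinuousLinearMap.snd ℝ _ _ + B.comp (ContinuousLinearMap.fst ℝ _ _)))
    (fun q => by simp) (fun q => by simp)
  have hA : HasFDerivAt G (A : (ℝ × E) × C →L[ℝ] (ℝ × E) × C) q₀ := by
    have h1 : HasFDerivAt (fun q : (ℝ × E) × C => q.1) (ContinuousLinearMap.fst ℝ (ℝ × E) C) q₀ :=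
      hasFDerivAt_fst
    have h2 : HasFDerivAt (fun q : (ℝ × E) × C => q.2) (ContinuousLinearMap.snd ℝ (ℝ × E) C) q₀ :=
      hasFDerivAt_snd
    have h3 : HasFDerivAt (fun q : (ℝ × E) × C => J (superposition unitInterval fc q.2))
        (fderiv ℝ (fun q : (ℝ × E) × C => J (superposition unitInterval fc q.2)) q₀) q₀ :=
      ((J.contDiff.comp ((contDiff_superposition fc hf).comp contDiff_snd)).differentiable
        (n := ∞) (by simp) q₀).hasFDerivAt
    have h4 := (h2.sub (cst.hasFDerivAt.comp q₀ (h1.snd))).sub (h1.fst.smul h3)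
    convert! h1.prodMk h4 using 1
    ext q <;> simp [A, B, q₀, v₀, cst, sub_sub]
  obtain ⟨e, hq₀, -, heG, hes⟩ := exists_contDiffOn_localInverse isOpen_univ hG.contDiffOn
    (mem_univ q₀) A hA
  have hGq₀ : e q₀ = ((0, x₀), 0) := by rw [heG]; simp [G, q₀]
  let Θ : ℝ × E → C := fun p => (e.symm (p, 0)).2
  have hTopen : IsOpen {p : ℝ × E | (p, (0 : C)) ∈ e.target} :=
    e.open_target.preimage (by fun_prop)
  have hΘ : ContDiffOn ℝ ∞ Θ {p : ℝ × E | (p, (0 : C)) ∈ e.target} :=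
    contDiff_snd.comp_contDiffOn (hes.comp (by fun_prop) (fun p hp => hp))
  have hmem₀ : ((0, x₀) : ℝ × E) ∈ {p : ℝ × E | (p, (0 : C)) ∈ e.target} := by
    have := e.map_source hq₀
    rwa [hGq₀] at this
  have hΘ₀ : Θ (0, x₀) = cst x₀ := by
    have := e.left_inv hq₀
    rw [hGq₀] at this
    simp [Θ, this, q₀]
  obtain ⟨r, hr, hrs⟩ := Metric.isOpen_iff.1 e.open_source q₀ hq₀
  have hnear : ∀ᶠ p in 𝓝 ((0, x₀) : ℝ × E),
      (p, (0 : C)) ∈ e.target ∧ dist (Θ p) (cst x₀) < r ∧ dist p (0, x₀) < r := by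
    refine Filter.Eventually.and (hTopen.mem_nhds hmem₀)
      (Filter.Eventually.and ?_ (Metric.ball_mem_nhds _ hr))
    have := (hΘ.continuousOn.continuousAt (hTopen.mem_nhds hmem₀))
    have := this.eventually (Metric.ball_mem_nhds (Θ (0, x₀)) hr)
    rw [hΘ₀] at this
    exact this
  obtain ⟨ε, hε, hball⟩ := Metric.eventually_nhds_iff_ball.1 hnear
  have hbox : ∀ s ∈ Ioo (-ε) ε, ∀ x ∈ Metric.ball x₀ ε, ((s, x) : ℝ × E) ∈
      Metric.ball ((0, x₀) : ℝ × E) ε := by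
    intro s hs x hx
    rw [Metric.mem_ball, Prod.dist_eq, max_lt_iff]
    exact ⟨by simpa [abs_lt] using hs, hx⟩
  have hsource : ∀ p ∈ Metric.ball ((0, x₀) : ℝ × E) ε, ∀ γ : C, dist γ (cst x₀) < r →
      (p, γ) ∈ e.source := by
    intro p hp γ hγ
    apply hrs
    rw [Metric.mem_ball, Prod.dist_eq, max_lt_iff]
    exact ⟨(hball p hp).2.2, hγ⟩
  have hsol : ∀ p ∈ Metric.ball ((0, x₀) : ℝ × E) ε,
      Θ p = cst p.2 + p.1 • J (superposition unitInterval fc (Θ p)) := by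
    intro p hp
    have h1 := e.right_inv (hball p hp).1
    rw [heG] at h1
    have h2 := congrArg Prod.fst h1
    have h3 := congrArg Prod.snd h1
    simp only [G] at h2 h3
    rw [h2, sub_sub, sub_eq_zero] at h3
    exact h3
  have huniq : ∀ p ∈ Metric.ball ((0, x₀) : ℝ × E) ε, ∀ γ : C, dist γ (cst x₀) < r →
      γ = cst p.2 + p.1 • J (superposition unitInterval fc γ) → γ = Θ p := by
    intro p hp γ hγ h
    have h1 : e (p, γ) = (p, 0) := by
      rw [heG]
      simp only [G, Prod.mk.injEq, true_and]
      rw [sub_sub, sub_eq_zero]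
      exact h
    have := e.left_inv (hsource p hp γ hγ)
    rw [h1] at this
    simp [Θ, this]
  have hsolp : ∀ p ∈ Metric.ball ((0, x₀) : ℝ × E) ε, ∀ σ : unitInterval,
      Θ p σ = p.2 + p.1 • ∫ y in (0 : ℝ)..σ, f (Θ p (projIcc (0 : ℝ) 1 zero_le_one y)) :=
    fun p hp σ => congrArg (fun g : C => g σ) (hsol p hp)
  let F : ℝ × E → E := fun p => Θ p 1
  -- The curve r ↦ Θ (T, x) (σ r) solves the rescaled equation for the time T σ, so local uniqueness
  -- identifies it with Θ (T σ, x). This turns the rescaled equation into the integral equation for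
  -- F in real time.
  have hscale : ∀ T ∈ Ioo (-ε) ε, ∀ x ∈ Metric.ball x₀ ε, ∀ σ : unitInterval,
      F (T * σ, x) = Θ (T, x) σ := by
    intro T hT x hx σ
    have hTσ : T * σ ∈ Ioo (-ε) ε := by
      rw [mem_Ioo, ← abs_lt] at hT ⊢
      rw [abs_mul, abs_of_nonneg σ.2.1]
      exact (mul_le_of_le_one_right (abs_nonneg _) σ.2.2).trans_lt hT
    let m : C(unitInterval, unitInterval) := ⟨fun r => σ * r, by fun_prop⟩
    let γ : C := (Θ (T, x)).comp m
    have hγ : γ = Θ (T * σ, x) := by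
      apply huniq _ (hbox _ hTσ x hx)
      · refine lt_of_le_of_lt ?_ (hball _ (hbox T hT x hx)).2.1
        rw [ContinuousMap.dist_le dist_nonneg]
        intro k
        exact (Θ (T, x)).dist_apply_le_dist (g := cst x₀) (m k)
      · ext r
        change Θ (T, x) (σ * r) = x + (T * σ) • ∫ y in (0 : ℝ)..r,
          f (Θ (T, x) (σ * projIcc (0 : ℝ) 1 zero_le_one y))
        rw [hsolp _ (hbox T hT x hx)]
        congr 1
        rw [mul_smul]
        congr 1
        have h5 := intervalIntegral.smul_integral_comp_mul_left (a := 0) (b := (r : ℝ))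
          (f := fun y : ℝ => f (Θ (T, x) (projIcc (0 : ℝ) 1 zero_le_one y))) (σ : ℝ)
        simp only [mul_zero] at h5
        have h6 : ((σ * r : unitInterval) : ℝ) = (σ : ℝ) * r := rfl
        rw [h6]
        refine Eq.trans h5.symm ?_
        congr 1
        apply intervalIntegral.integral_congr
        intro y hy
        rw [uIcc_of_le r.2.1] at hy
        have hy1 : y ∈ Icc (0 : ℝ) 1 := ⟨hy.1, hy.2.trans r.2.2⟩
        have hy2 : (σ : ℝ) * y ∈ Icc (0 : ℝ) 1 :=
          ⟨mul_nonneg σ.2.1 hy1.1, mul_le_one₀ σ.2.2 hy1.1 hy1.2⟩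
        beta_reduce
        rw [projIcc_of_mem _ hy1, projIcc_of_mem _ hy2]
        rfl
    change Θ (T * σ, x) 1 = _
    rw [← hγ]
    change Θ (T, x) (σ * 1) = _
    rw [mul_one]
  have hF : ContDiffOn ℝ ∞ F (Ioo (-ε) ε ×ˢ Metric.ball x₀ ε) := by
    have h1 : ContDiffOn ℝ ∞ Θ (Ioo (-ε) ε ×ˢ Metric.ball x₀ ε) :=
      hΘ.mono (fun p hp => (hball p (hbox p.1 hp.1 p.2 hp.2)).1)
    exact (ContinuousMap.evalCLM ℝ (1 : unitInterval)).contDiff.comp_contDiffOn h1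
  refine ⟨ε, hε, F, hF, fun x hx => ⟨?_, fun s hs => ?_⟩⟩
  · have h0 : (0 : ℝ) ∈ Ioo (-ε) ε := ⟨by linarith, hε⟩
    have := hsolp _ (hbox 0 h0 x hx) 1
    simpa [F] using this
  · have hint : ∀ T ∈ Ioo (-ε) ε, F (T, x) = x + ∫ y in (0 : ℝ)..T, f (F (y, x)) := by
      intro T hT
      have h0 := hsolp _ (hbox T hT x hx) 1
      have h5 := intervalIntegral.smul_integral_comp_mul_left (a := 0) (b := 1)
          (f := fun y : ℝ => f (F (y, x))) T
      rw [mul_zero, mul_one] at h5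
      rw [← h5]
      refine h0.trans ?_
      congr 2
      apply intervalIntegral.integral_congr
      intro y hy
      rw [show ((1 : unitInterval) : ℝ) = 1 from rfl, uIcc_of_le zero_le_one] at hy
      change f (Θ (T, x) _) = f (F (T * y, x))
      rw [projIcc_of_mem _ hy, ← hscale T hT x hx ⟨y, hy⟩]
    have hcont : ContinuousOn (fun y => f (F (y, x))) (Ioo (-ε) ε) :=
      hf.continuous.comp_continuousOn (hF.continuousOn.comp (by fun_prop)
        (fun y hy => ⟨hy, hx⟩))
    have hsn : Ioo (-ε) ε ∈ 𝓝 s := Ioo_mem_nhds hs.1 hs.2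
    have hd := intervalIntegral.integral_hasDerivAt_right (a := 0) (b := s)
      (f := fun y => f (F (y, x)))
      ((hcont.mono (ordConnected_Ioo.uIcc_subset ⟨by linarith, hε⟩ hs)).intervalIntegrable)
      (hcont.stronglyMeasurableAtFilter isOpen_Ioo s hs) (hcont.continuousAt hsn)
    refine (hd.const_add x).congr_of_eventuallyEq ?_
    filter_upwards [hsn] with T hT using hint T hT

end LocalFlow

/-! ### Seeley's reflection weights -/

/-- Weights `w` such that reflection of a function of `t ≥ 0` by the formula
`∑ w k f (-2 ^ k t)` matches all one-sided derivatives at `0`. -/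
def IsReflectionWeight (w : ℕ → ℝ) : Prop :=
  ∀ j : ℕ, Summable (fun k => |w k| * 2 ^ (k * j)) ∧ HasSum (fun k => w k * (-(2 : ℝ) ^ k) ^ j) 1

/-- Differentiating w k • f (-2 ^ k t) in t multiplies the weight by -2 ^ k. Stability under this
operation is what makes the induction over the order of smoothness run. -/
theorem IsReflectionWeight.shift {w : ℕ → ℝ} (h : IsReflectionWeight w) :
    IsReflectionWeight (fun k => w k * (-(2 : ℝ) ^ k)) := by
  intro j
  refine ⟨(h (j + 1)).1.congr fun k => ?_, (h (j + 1)).2.congr_fun ?_⟩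
  · rw [abs_mul, abs_neg, abs_of_pos (by positivity : (0 : ℝ) < 2 ^ k), mul_add, mul_one, pow_add]
    ring
  · intro k
    ring

/-- Lagrange interpolation at the nodes -2 ^ k, k ≤ N, evaluated at 1, gives weights that satisfy
the moment conditions j ≤ N. These weights are bounded uniformly in N by a sequence that decays
faster than every geometric one, so a subsequence converges and all moment conditions survive in the
limit. -/
theorem exists_isReflectionWeight : ∃ w : ℕ → ℝ, IsReflectionWeight w := by
  let q : ℕ → ℝ := fun k => -(2 : ℝ) ^ k
  have hq : Function.Injective q := fun a b h => by
    have : (2 : ℝ) ^ a = 2 ^ b := neg_injective h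
    exact pow_right_injective₀ (by norm_num) (by norm_num) this
  let w : ℕ → ℕ → ℝ := fun N k =>
    if k ∈ Finset.range (N + 1) then (Lagrange.basis (Finset.range (N + 1)) q k).eval 1 else 0
  have hwsum : ∀ N j : ℕ, j ≤ N → ∑ k ∈ Finset.range (N + 1), w N k * q k ^ j = 1 := by
    intro N j hj
    have h1 := Lagrange.eq_interpolate_of_eval_eq (s := Finset.range (N + 1)) (v := q)
      (f := (Polynomial.X : Polynomial ℝ) ^ j) (fun k => q k ^ j) hq.injOn
      (by rw [Polynomial.degree_X_pow, Finset.card_range]; exact_mod_cast Nat.lt_succ_of_le hj)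
      (fun i _ => by simp)
    have h2 := congrArg (Polynomial.eval 1) h1
    rw [Lagrange.interpolate_apply, Polynomial.eval_finsetSum] at h2
    simp only [Polynomial.eval_pow, Polynomial.eval_X, one_pow, Polynomial.eval_mul,
      Polynomial.eval_C] at h2
    rw [h2]
    refine Finset.sum_congr rfl fun k hk => ?_
    simp only [w, if_pos hk]
    ring
  -- P k bounds the factors of the Lagrange weight from the nodes j < k: there 1 + 2 ^ j ≤ 2 · 2 ^ j
  -- and 2 ^ k - 2 ^ j ≥ 2 ^ k / 2. The factors with j = k + 1 + i are at most 1 + 2 · 2 ^ (-i), so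
  -- their product is at most exp 4.
  let P : ℕ → ℝ := fun k => ∏ j ∈ Finset.range k, (4 * 2 ^ j / 2 ^ k : ℝ)
  have hPpos : ∀ k, 0 < P k := fun k => Finset.prod_pos fun j _ => by positivity
  have hPsucc : ∀ k, P (k + 1) = 2 * (1 / 2) ^ k * P k := by
    intro k
    simp only [P]
    rw [Finset.prod_range_succ]
    have : ∀ j ∈ Finset.range k, (4 * 2 ^ j / 2 ^ (k + 1) : ℝ) = 1 / 2 * (4 * 2 ^ j / 2 ^ k) := by
      intro j _
      rw [pow_succ]
      field_simp
    rw [Finset.prod_congr rfl this, Finset.prod_mul_distrib, Finset.prod_const, Finset.card_range]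
    rw [pow_succ]
    field_simp
    ring
  let B : ℕ → ℝ := fun k => P k * Real.exp 4
  have hB : ∀ N k, |w N k| ≤ B k := by
    intro N k
    by_cases hk : k ∈ Finset.range (N + 1)
    swap
    · simp only [w, if_neg hk, abs_zero, B]
      exact (mul_pos (hPpos k) (Real.exp_pos _)).le
    have hw : w N k = ∏ j ∈ (Finset.range (N + 1)).erase k, (1 + 2 ^ j) / (2 ^ j - 2 ^ k : ℝ) := by
      simp only [w, if_pos hk, Lagrange.basis, Polynomial.eval_prod]
      refine Finset.prod_congr rfl fun j hj => ?_
      simp only [Lagrange.basisDivisor, q, Polynomial.eval_mul, Polynomial.eval_C,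
        Polynomial.eval_sub, Polynomial.eval_X]
      rw [mul_comm, div_eq_mul_inv]
      congr 2 <;> ring
    have hset : (Finset.range (N + 1)).erase k = Finset.range k ∪ Finset.Ico (k + 1) (N + 1) := by
      ext j
      simp only [Finset.mem_erase, Finset.mem_range, Finset.mem_union, Finset.mem_Ico] at hk ⊢
      omega
    have hdisj : Disjoint (Finset.range k) (Finset.Ico (k + 1) (N + 1)) := by
      rw [Finset.disjoint_left]
      intro j h1 h2
      simp only [Finset.mem_range, Finset.mem_Ico] at h1 h2
      omega
    rw [hw, hset, Finset.prod_union hdisj, abs_mul, Finset.abs_prod, Finset.abs_prod]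
    refine mul_le_mul ?_ ?_ (Finset.prod_nonneg fun _ _ => abs_nonneg _) (hPpos k).le
    · refine Finset.prod_le_prod (fun _ _ => abs_nonneg _) fun j hj => ?_
      obtain ⟨i, rfl⟩ : ∃ i, k = j + 1 + i := ⟨k - (j + 1), by have := Finset.mem_range.1 hj; omega⟩
      have h1 : (1 : ℝ) ≤ 2 ^ j := one_le_pow₀ (by norm_num)
      have h2 : (1 : ℝ) ≤ 2 ^ i := one_le_pow₀ (by norm_num)
      have h3 : (2 : ℝ) ^ (j + 1 + i) = 2 ^ j * 2 * 2 ^ i := by rw [pow_add, pow_succ]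
      rw [abs_div, abs_of_pos (by positivity : (0 : ℝ) < 1 + 2 ^ j), abs_sub_comm, abs_of_pos
        (by rw [h3]; nlinarith), div_le_div_iff₀ (by rw [h3]; nlinarith) (by positivity), h3]
      have h4 : (2 : ℝ) ^ j ≤ 2 ^ j * 2 ^ i := le_mul_of_one_le_right (by positivity) h2
      nlinarith [mul_pos (by positivity : (0 : ℝ) < 2 ^ j) (by positivity : (0 : ℝ) < 2 ^ i)]
    · rw [Finset.prod_Ico_eq_prod_range]
      calc ∏ i ∈ Finset.range (N + 1 - (k + 1)),
            |(1 + 2 ^ (k + 1 + i)) / (2 ^ (k + 1 + i) - 2 ^ k : ℝ)|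
          ≤ ∏ i ∈ Finset.range (N + 1 - (k + 1)), Real.exp (2 * (1 / 2) ^ i) := by
            refine Finset.prod_le_prod (fun _ _ => abs_nonneg _) fun i _ => ?_
            refine le_trans ?_ (Real.add_one_le_exp _)
            have h1 : (1 : ℝ) ≤ 2 ^ k := one_le_pow₀ (by norm_num)
            have h2 : (1 : ℝ) ≤ 2 ^ i := one_le_pow₀ (by norm_num)
            have h3 : (2 : ℝ) ^ (k + 1 + i) = 2 ^ k * 2 * 2 ^ i := by rw [pow_add, pow_succ]
            have h4 : (2 : ℝ) ^ k ≤ 2 ^ k * 2 ^ i := le_mul_of_one_le_right (by positivity) h2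
            rw [abs_div, abs_of_pos (by positivity), abs_of_pos (by rw [h3]; nlinarith),
              div_le_iff₀ (by rw [h3]; nlinarith), h3, one_div, inv_pow]
            have h5 : (2 * ((2 : ℝ) ^ i)⁻¹ + 1) * (2 ^ k * 2 * 2 ^ i - 2 ^ k) =
              4 * 2 ^ k - 2 * 2 ^ k * ((2 : ℝ) ^ i)⁻¹ + 2 ^ k * 2 * 2 ^ i - 2 ^ k := by
              field_simp
              ring
            have h6 : ((2 : ℝ) ^ i)⁻¹ ≤ 1 := inv_le_one_of_one_le₀ h2
            rw [h5]
            nlinarith [mul_le_of_le_one_right (by positivity : (0 : ℝ) ≤ 2 ^ k) h6]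
        _ = Real.exp (∑ i ∈ Finset.range (N + 1 - (k + 1)), 2 * (1 / 2) ^ i) :=
            (Real.exp_sum _ _).symm
        _ ≤ Real.exp 4 := by
            rw [Real.exp_le_exp, ← Finset.mul_sum]
            have := summable_geometric_two.sum_le_tsum (Finset.range (N + 1 - (k + 1)))
              (fun i _ => by positivity)
            rw [tsum_geometric_two] at this
            linarith
  have hBsum : ∀ j : ℕ, Summable fun k => B k * 2 ^ (k * j) := by
    intro j
    refine summable_of_ratio_test_tendsto_lt_one (l := 0) (by norm_num)
      (Filter.Eventually.of_forall fun k => by have := hPpos k; simp only [B]; positivity) ?_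
    have h1 : ∀ k : ℕ, ‖B (k + 1) * 2 ^ ((k + 1) * j)‖ / ‖B k * 2 ^ (k * j)‖ =
        2 * 2 ^ j * (1 / 2) ^ k := by
      intro k
      have h0 := hPpos k
      have h2 : 0 < B k * 2 ^ (k * j) := by simp only [B]; positivity
      have h3 : B (k + 1) * 2 ^ ((k + 1) * j) = 2 * 2 ^ j * (1 / 2) ^ k * (B k * 2 ^ (k * j)) := by
        simp only [B]
        rw [hPsucc, add_mul, one_mul, pow_add]
        ring
      rw [h3, norm_mul, mul_div_assoc, div_self (norm_ne_zero_iff.2 h2.ne'), mul_one,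
        Real.norm_of_nonneg (by positivity)]
    simp_rw [h1]
    have := (tendsto_pow_atTop_nhds_zero_of_lt_one (by norm_num : (0 : ℝ) ≤ 1 / 2)
      (by norm_num)).const_mul (2 * 2 ^ j : ℝ)
    simpa using this
  -- Tychonoff's theorem gives a coordinatewise limit. The bound B, summable against every 2 ^ (k *
  -- j), then lets dominated convergence pass to the limit in each moment.
  obtain ⟨v, hv, φ, hφ, hlim⟩ := (isCompact_univ_pi fun k => isCompact_Icc (a := -B k)
    (b := B k)).tendsto_subseq (x := w) (fun N k _ => abs_le.1 (hB N k))
  have hvB : ∀ k, |v k| ≤ B k := fun k => abs_le.2 (hv k (mem_univ k))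
  refine ⟨v, fun j => ?_⟩
  have hs : Summable (fun k => |v k| * 2 ^ (k * j)) :=
    (hBsum j).of_nonneg_of_le (fun k => by positivity)
      (fun k => mul_le_mul_of_nonneg_right (hvB k) (by positivity))
  have habs : ∀ (c : ℝ) (k : ℕ), ‖c * (-(2 : ℝ) ^ k) ^ j‖ = |c| * 2 ^ (k * j) := by
    intro c k
    rw [norm_mul, norm_pow, norm_neg, Real.norm_eq_abs, Real.norm_of_nonneg (by positivity),
      pow_mul]
  refine ⟨hs, ?_⟩
  have hsum : Summable (fun k => v k * (-(2 : ℝ) ^ k) ^ j) :=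
    Summable.of_norm (hs.congr fun k => (habs _ _).symm)
  have hlim2 := tendsto_tsum_of_dominated_convergence (𝓕 := Filter.atTop)
    (f := fun N k => w (φ N) k * (-(2 : ℝ) ^ k) ^ j) (g := fun k => v k * (-(2 : ℝ) ^ k) ^ j)
    (hBsum j) (fun k => ((tendsto_pi_nhds.1 hlim k).mul_const _))
    (Filter.Eventually.of_forall fun N k => by
      rw [habs]; exact mul_le_mul_of_nonneg_right (hB _ k) (by positivity))
  have hone : ∀ᶠ N in Filter.atTop, ∑' k, w (φ N) k * (-(2 : ℝ) ^ k) ^ j = 1 := by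
    filter_upwards [Filter.eventually_ge_atTop j] with N hN
    rw [tsum_eq_sum (s := Finset.range (φ N + 1)) (fun k hk => by simp only [w, if_neg hk, zero_mul])]
    exact hwsum _ _ (hN.trans (hφ.id_le N))
  have := tendsto_nhds_unique hlim2 (tendsto_const_nhds.congr' (hone.mono fun _ h => h.symm))
  rw [← this]
  exact hsum.hasSum

/-! ### Smooth extension across the ends of a time interval -/

section Extension

universe u
variable {E F : Type u} [NormedAddCommGroup E] [NormedSpace ℝ E] [ProperSpace E]
  [NormedAddCommGroup F] [NormedSpace ℝ F] [CompleteSpace F]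

/-- The extension of a function of `t ≥ 0` by weighted reflections. -/
def reflectionExtension (w : ℕ → ℝ) (f : ℝ × E → F) (p : ℝ × E) : F :=
  if 0 ≤ p.1 then f p else ∑' k, w k • f (-(2 : ℝ) ^ k * p.1, p.2)

theorem reflectionExtension_of_nonneg (w : ℕ → ℝ) (f : ℝ × E → F) {p : ℝ × E} (hp : 0 ≤ p.1) :
    reflectionExtension w f p = f p := if_pos hp

theorem reflectionExtension_of_nonpos {w : ℕ → ℝ} (hw : IsReflectionWeight w) (f : ℝ × E → F)
    {p : ℝ × E} (hp : p.1 ≤ 0) :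
    reflectionExtension w f p = ∑' k, w k • f (-(2 : ℝ) ^ k * p.1, p.2) := by
  rcases hp.lt_or_eq with h | h
  · exact if_neg (not_le.2 h)
  · obtain ⟨t, x⟩ := p
    simp only at h
    subst h
    rw [reflectionExtension_of_nonneg w f le_rfl]
    have h1 : HasSum w 1 := by simpa using (hw 0).2
    simp only [mul_zero]
    rw [(h1.smul_const (f (0, x))).tsum_eq, one_smul]

/-- Since f vanishes for t ≥ c, it is bounded on [0, ∞) times a small closed ball, so the reflected
series converges uniformly there by the Weierstrass test. The two halves agree at t = 0 because the
weights sum to 1. -/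
theorem continuousOn_reflectionExtension {w : ℕ → ℝ} (hw : IsReflectionWeight w) {f : ℝ × E → F}
    {U : Set E} (hU : IsOpen U) (hf : ContinuousOn f (Ici 0 ×ˢ U))
    {c : ℝ} (hc : ∀ t ≥ c, ∀ x, f (t, x) = 0) :
    ContinuousOn (reflectionExtension w f) (univ ×ˢ U) := by
  have hpos : ContinuousOn (reflectionExtension w f) (Ici 0 ×ˢ U) :=
    hf.congr fun p hp => reflectionExtension_of_nonneg w f hp.1
  rintro ⟨t, x⟩ ⟨-, hx⟩
  obtain ⟨r, hr, hrU⟩ := Metric.nhds_basis_closedBall.mem_iff.1 (hU.mem_nhds hx)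
  have hneg : ContinuousOn (reflectionExtension w f) (Iic 0 ×ˢ Metric.closedBall x r) := by
    obtain ⟨C, hC⟩ := (isCompact_Icc.prod (isCompact_closedBall x r)).exists_bound_of_continuousOn
      (hf.mono (prod_mono (fun t ht => ht.1 : Icc 0 c ⊆ Ici 0) hrU))
    have hsum : ContinuousOn (fun p : ℝ × E => ∑' k, w k • f (-(2 : ℝ) ^ k * p.1, p.2))
        (Iic 0 ×ˢ Metric.closedBall x r) := by
      refine continuousOn_tsum (u := fun k => |w k| * max C 0) (fun k => ?_) ?_ ?_
      · refine ContinuousOn.const_smul (hf.comp (by fun_prop) ?_) _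
        rintro p ⟨hp1, hp2⟩
        refine ⟨?_, hrU hp2⟩
        have : p.1 ≤ 0 := hp1
        have h2 : (0 : ℝ) < 2 ^ k := by positivity
        simp only [mem_Ici]
        nlinarith
      · refine Summable.mul_right _ ?_
        simpa using (hw 0).1
      · rintro k p ⟨hp1, hp2⟩
        rw [norm_smul, Real.norm_eq_abs]
        refine mul_le_mul_of_nonneg_left ?_ (abs_nonneg _)
        have h1 : 0 ≤ -(2 : ℝ) ^ k * p.1 := by
          have : p.1 ≤ 0 := hp1
          have h2 : (0 : ℝ) < 2 ^ k := by positivity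
          nlinarith
        rcases le_total (-(2 : ℝ) ^ k * p.1) c with h | h
        · exact (hC (-(2 : ℝ) ^ k * p.1, p.2) ⟨⟨h1, h⟩, hp2⟩).trans (le_max_left _ _)
        · rw [hc _ h, norm_zero]
          exact le_max_right _ _
    exact hsum.congr fun p hp => reflectionExtension_of_nonpos hw f hp.1
  have hxr : Metric.closedBall x r ∈ 𝓝 x := Metric.closedBall_mem_nhds x hr
  refine ContinuousAt.continuousWithinAt ?_
  rcases lt_trichotomy t 0 with h | h | h
  · exact hneg.continuousAt (prod_mem_nhds (Iic_mem_nhds h) hxr)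
  · subst h
    have h1 : ContinuousWithinAt (reflectionExtension w f)
        ((Ici 0 ×ˢ U) ∪ (Iic 0 ×ˢ Metric.closedBall x r)) (0, x) :=
      (hpos _ ⟨mem_Ici.2 le_rfl, hx⟩).union (hneg _ ⟨mem_Iic.2 le_rfl, mem_of_mem_nhds hxr⟩)
    refine h1.continuousAt ?_
    filter_upwards [prod_mem_nhds Filter.univ_mem hxr] with p hp
    rcases le_total 0 p.1 with h | h
    · exact Or.inl ⟨h, hrU hp.2⟩
    · exact Or.inr ⟨h, hp.2⟩
  · exact hpos.continuousAt (prod_mem_nhds (Ici_mem_nhds h) (hU.mem_nhds hx))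

theorem uniqueDiffOn_Ici_prod {U : Set E} (hU : IsOpen U) (a : ℝ) :
    UniqueDiffOn ℝ (Ici a ×ˢ U) :=
  (uniqueDiffOn_Ici a).prod hU.uniqueDiffOn

/-- The candidate for the derivative of `reflectionExtension w f`. -/
def reflectionExtensionDeriv (w : ℕ → ℝ) (f' : ℝ × E → (ℝ × E →L[ℝ] F)) (p : ℝ × E) :
    ℝ × E →L[ℝ] F :=
  (ContinuousLinearMap.fst ℝ ℝ E).smulRight
      (reflectionExtension (fun k => w k * (-(2 : ℝ) ^ k)) (fun p => f' p (1, 0)) p) +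
    (reflectionExtension w (fun p => (f' p).comp (ContinuousLinearMap.inr ℝ ℝ E)) p).comp
      (ContinuousLinearMap.snd ℝ ℝ E)

/-- For t < 0 the series is locally a finite sum and is differentiated termwise. At t = 0 the
left-hand derivative exists because the derivative on the open side has a limit, namely the
candidate, which is already known to be continuous; it is glued to the given right-hand derivative.
-/
theorem hasFDerivAt_reflectionExtension {w : ℕ → ℝ} (hw : IsReflectionWeight w) {f : ℝ × E → F}
    {f' : ℝ × E → (ℝ × E →L[ℝ] F)} {U : Set E} (hU : IsOpen U)
    (hf : ∀ p ∈ Ici 0 ×ˢ U, HasFDerivWithinAt f (f' p) (Ici 0 ×ˢ U) p)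
    (hf' : ContinuousOn f' (Ici 0 ×ˢ U))
    {c : ℝ} (hc : ∀ t ≥ c, ∀ x, f (t, x) = 0) (hc' : ∀ t ≥ c, ∀ x, f' (t, x) = 0)
    {p : ℝ × E} (hp : p.2 ∈ U) :
    HasFDerivAt (reflectionExtension w f) (reflectionExtensionDeriv w f' p) p := by
  have hcont := continuousOn_reflectionExtension hw hU
    (fun p hp => (hf p hp).continuousWithinAt) hc
  have hcont1 := continuousOn_reflectionExtension hw.shift (f := fun p => f' p (1, 0)) hU
    (hf'.clm_apply continuousOn_const) (c := c) (fun t ht x => by simp [hc' t ht x])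
  have hcont2 := continuousOn_reflectionExtension hw
    (f := fun p => (f' p).comp (ContinuousLinearMap.inr ℝ ℝ E)) hU
    (hf'.clm_comp continuousOn_const) (c := c) (fun t ht x => by simp [hc' t ht x])
  have hcont' : ContinuousOn (reflectionExtensionDeriv w f') (univ ×ˢ U) := by
    refine ContinuousOn.add ?_ (hcont2.clm_comp continuousOn_const)
    exact ((ContinuousLinearMap.smulRightL ℝ (ℝ × E) F
      (ContinuousLinearMap.fst ℝ ℝ E)).continuous.comp_continuousOn hcont1)
  have hopen : IsOpen ((univ : Set ℝ) ×ˢ U) := isOpen_univ.prod hU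
  have hposval : ∀ p : ℝ × E, 0 ≤ p.1 → reflectionExtensionDeriv w f' p = f' p := by
    intro p hp
    ext v
    · simp [reflectionExtensionDeriv, reflectionExtension_of_nonneg _ _ hp, Prod.mk_zero_zero]
    · simp [reflectionExtensionDeriv, reflectionExtension_of_nonneg _ _ hp]
  have hposd : ∀ p ∈ Ici 0 ×ˢ U, HasFDerivWithinAt (reflectionExtension w f)
      (reflectionExtensionDeriv w f' p) (Ici 0 ×ˢ U) p := by
    intro p hp
    rw [hposval p hp.1]
    exact (hf p hp).congr (fun q hq => reflectionExtension_of_nonneg w f hq.1)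
      (reflectionExtension_of_nonneg w f hp.1)
  have hnegd : ∀ p : ℝ × E, p.1 < 0 → p.2 ∈ U → HasFDerivAt (reflectionExtension w f)
      (reflectionExtensionDeriv w f' p) p := by
    intro p hp hpU
    -- From the index n on, -2 ^ k t ≥ c for all t < p.1 / 2, a neighbourhood of p.1 as p.1 < 0; the
    -- terms beyond n vanish there.
    obtain ⟨n, hn⟩ := pow_unbounded_of_one_lt (2 * |c| / -p.1) (by norm_num : (1 : ℝ) < 2)
    have hzero : ∀ k ≥ n, ∀ t < p.1 / 2, c ≤ -(2 : ℝ) ^ k * t := by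
      intro k hk t ht
      have h1 : (2 : ℝ) ^ n ≤ 2 ^ k := pow_le_pow_right₀ (by norm_num) hk
      rw [div_lt_iff₀ (by linarith)] at hn
      have h2 : (0 : ℝ) < 2 ^ n := by positivity
      nlinarith [le_abs_self c]
    have hfin : ∀ {G : Type u} [NormedAddCommGroup G] [NormedSpace ℝ G] (v : ℕ → ℝ)
        (g : ℝ × E → G) (_ : ∀ t ≥ c, ∀ x, g (t, x) = 0) (q : ℝ × E) (_ : q.1 < p.1 / 2),
        reflectionExtension v g q =
          ∑ k ∈ Finset.range n, v k • g (-(2 : ℝ) ^ k * q.1, q.2) := by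
      intro G _ _ v g hg q hq
      rw [reflectionExtension, if_neg (by linarith), tsum_eq_sum]
      intro k hk
      rw [hg _ (hzero k (by simpa using hk) _ hq), smul_zero]
    let A : ℕ → (ℝ × E →L[ℝ] ℝ × E) := fun k =>
      ((-(2 : ℝ) ^ k) • ContinuousLinearMap.fst ℝ ℝ E).prod (ContinuousLinearMap.snd ℝ ℝ E)
    have hA : ∀ k q, A k q = (-(2 : ℝ) ^ k * q.1, q.2) := fun k q => by simp [A]
    have hsum : HasFDerivAt (fun q : ℝ × E => ∑ k ∈ Finset.range n, w k • f (A k q))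
        (∑ k ∈ Finset.range n, w k • (f' (A k p)).comp (A k)) p := by
      refine HasFDerivAt.fun_sum fun k _ => HasFDerivAt.const_smul ?_ _
      refine HasFDerivAt.comp p ?_ (A k).hasFDerivAt
      have hpos : 0 < (A k p).1 := by
        rw [hA]
        have : (0 : ℝ) < 2 ^ k := by positivity
        simp only
        nlinarith
      have hpU' : (A k p).2 ∈ U := by rw [hA]; exact hpU
      exact (hf (A k p) ⟨hpos.le, hpU'⟩).hasFDerivAt
        (prod_mem_nhds (Ici_mem_nhds hpos) (hU.mem_nhds hpU'))
    have heq : reflectionExtensionDeriv w f' p =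
        ∑ k ∈ Finset.range n, w k • (f' (A k p)).comp (A k) := by
      have h1 := hfin (fun k => w k * (-(2 : ℝ) ^ k)) (fun p => f' p (1, 0))
        (fun t ht x => by simp [hc' t ht x]) p (by linarith)
      have h2 := hfin w (fun p => (f' p).comp (ContinuousLinearMap.inr ℝ ℝ E))
        (fun t ht x => by simp [hc' t ht x]) p (by linarith)
      rw [reflectionExtensionDeriv, h1, h2]
      ext v
      · simp only [ContinuousLinearMap.comp_apply, add_apply,
          sum_apply, smul_apply,
          ContinuousLinearMap.smulRight_apply, hA, ContinuousLinearMap.inl_apply,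
          ContinuousLinearMap.coe_fst', ContinuousLinearMap.coe_snd', map_zero, add_zero, one_smul, mul_one]
        refine Finset.sum_congr rfl fun k _ => ?_
        have : ((-(2 : ℝ) ^ k, (0 : E)) : ℝ × E) = (-(2 : ℝ) ^ k) • ((1 : ℝ), (0 : E)) := by
          simp
        rw [this, map_smul, smul_smul]
      · simp [hA]
    rw [heq]
    refine hsum.congr_of_eventuallyEq ?_
    have : ∀ᶠ q : ℝ × E in 𝓝 p, q.1 < p.1 / 2 :=
      continuous_fst.continuousAt.eventually (Iio_mem_nhds (by linarith))
    filter_upwards [this] with q hq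
    simp only [hA]
    exact hfin w f hc q hq
  rcases lt_trichotomy p.1 0 with h | h | h
  · exact hnegd p h hp
  · obtain ⟨t, x⟩ := p
    simp only at h hp
    subst h
    obtain ⟨r, hr, hrU'⟩ := Metric.nhds_basis_closedBall.mem_iff.1 (hU.mem_nhds hp)
    have hrU : Metric.ball x r ⊆ U := Metric.ball_subset_closedBall.trans hrU'
    have hneg : HasFDerivWithinAt (reflectionExtension w f)
        (reflectionExtensionDeriv w f' (0, x)) (closure (Iio 0 ×ˢ Metric.ball x r)) (0, x) := by
      have hdiff : ∀ q ∈ (Iio (0 : ℝ)) ×ˢ Metric.ball x r, HasFDerivAt (reflectionExtension w f)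
          (reflectionExtensionDeriv w f' q) q := fun q hq => hnegd q hq.1 (hrU hq.2)
      refine hasFDerivWithinAt_closure_of_tendsto_fderiv
        (fun q hq => (hdiff q hq).differentiableAt.differentiableWithinAt)
        ((convex_Iio 0).prod (convex_ball x r)) (isOpen_Iio.prod Metric.isOpen_ball) ?_ ?_
      · intro q hq
        rw [closure_prod_eq] at hq
        exact (hcont.continuousAt (hopen.mem_nhds
          ⟨mem_univ _, hrU' (Metric.closure_ball_subset_closedBall hq.2)⟩)).continuousWithinAt
      · have h0 : Filter.Tendsto (reflectionExtensionDeriv w f') (𝓝[Iio 0 ×ˢ Metric.ball x r] (0, x))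
            (𝓝 (reflectionExtensionDeriv w f' (0, x))) :=
          (hcont'.continuousAt (hopen.mem_nhds ⟨mem_univ _, hp⟩)).continuousWithinAt
        refine h0.congr' ?_
        filter_upwards [self_mem_nhdsWithin] with q hq
        exact (hdiff q hq).fderiv.symm
    have h1 := (hposd (0, x) ⟨mem_Ici.2 le_rfl, hp⟩).union hneg
    refine h1.hasFDerivAt ?_
    filter_upwards [prod_mem_nhds (Filter.univ_mem (f := 𝓝 (0 : ℝ))) (Metric.ball_mem_nhds x hr)]
      with q hq
    rcases le_total 0 q.1 with h | h
    · exact Or.inl ⟨h, hrU hq.2⟩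
    · refine Or.inr ?_
      rw [closure_prod_eq, closure_Iio]
      exact ⟨h, subset_closure hq.2⟩
  · exact (hposd p ⟨h.le, hp⟩).hasFDerivAt (prod_mem_nhds (Ici_mem_nhds h) (hU.mem_nhds hp))

/-- The derivative is again built from reflection extensions, with shifted weights for the time
direction and the original ones for the space directions. Hence the induction generalizes over the
weights, the target and the cut-off c. -/
theorem contDiffOn_reflectionExtension {w : ℕ → ℝ} (hw : IsReflectionWeight w) {f : ℝ × E → F}
    {U : Set E} (hU : IsOpen U) (hf : ContDiffOn ℝ ∞ f (Ici 0 ×ˢ U))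
    {c : ℝ} (hc : ∀ t ≥ c, ∀ x, f (t, x) = 0) :
    ContDiffOn ℝ ∞ (reflectionExtension w f) (univ ×ˢ U) := by
  rw [contDiffOn_infty]
  intro n
  induction n generalizing F w c with
  | zero =>
    rw [Nat.cast_zero, contDiffOn_zero]
    exact continuousOn_reflectionExtension hw hU hf.continuousOn hc
  | succ n ih =>
    have hopen : IsOpen ((univ : Set ℝ) ×ˢ U) := isOpen_univ.prod hU
    -- Vanishing for large t is required at every x, also outside U, where the derivative within the
    -- half-space is not controlled. Redefining it as 0 for t ≥ c + 1 changes nothing on the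
    -- half-space over U.
    let f' : ℝ × E → (ℝ × E →L[ℝ] F) := fun p =>
      if c + 1 ≤ p.1 then 0 else fderivWithin ℝ f (Ici 0 ×ˢ U) p
    have heq : ∀ p ∈ Ici 0 ×ˢ U, f' p = fderivWithin ℝ f (Ici 0 ×ˢ U) p := by
      intro p hp
      by_cases h : c + 1 ≤ p.1
      · simp only [f', if_pos h]
        have h0 : f =ᶠ[𝓝 p] fun _ => 0 := by
          have : ∀ᶠ q : ℝ × E in 𝓝 p, c < q.1 :=
            continuous_fst.continuousAt.eventually (Ioi_mem_nhds (by linarith))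
          filter_upwards [this] with q hq using hc q.1 hq.le q.2
        rw [(h0.filter_mono nhdsWithin_le_nhds).fderivWithin_eq h0.self_of_nhds]
        simp
      · simp only [f', if_neg h]
    have hf'c : ContDiffOn ℝ ∞ f' (Ici 0 ×ˢ U) :=
      (hf.fderivWithin (uniqueDiffOn_Ici_prod hU 0) (m := ∞) (by simp)).congr heq
    have hd : ∀ p ∈ (univ : Set ℝ) ×ˢ U, HasFDerivAt (reflectionExtension w f)
        (reflectionExtensionDeriv w f' p) p := by
      intro p hp
      refine hasFDerivAt_reflectionExtension hw (c := c + 1) hU (fun q hq => ?_)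
        hf'c.continuousOn (fun t ht x => hc t (by linarith) x) (fun t ht x => if_pos ht) hp.2
      rw [heq q hq]
      exact ((hf.differentiableOn (by simp)) q hq).hasFDerivWithinAt
    rw [Nat.cast_succ, contDiffOn_succ_iff_fderiv_of_isOpen hopen]
    refine ⟨fun p hp => (hd p hp).differentiableAt.differentiableWithinAt, by simp, ?_⟩
    have h1 := ih hw.shift (f := fun p => f' p (1, 0)) (hf'c.clm_apply contDiffOn_const)
      (c := c + 1) (fun t ht x => by simp [f', ht])
    have h2 := ih hw (f := fun p => (f' p).comp (ContinuousLinearMap.inr ℝ ℝ E))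
      (hf'c.clm_comp contDiffOn_const) (c := c + 1) (fun t ht x => by simp [f', ht])
    refine ContDiffOn.congr (f := reflectionExtensionDeriv w f') ?_
      (fun p hp => (hd p hp).fderiv)
    refine ContDiffOn.add ?_ (h2.clm_comp contDiffOn_const)
    exact (ContinuousLinearMap.smulRightL ℝ (ℝ × E) F
      (ContinuousLinearMap.fst ℝ ℝ E)).contDiff.comp_contDiffOn h1

/-- Smooth functions of `t ∈ [0, 1]`, depending smoothly on a parameter, extend to all times. -/
theorem exists_contDiffOn_extension_Icc {f : ℝ × E → F} {U : Set E} (hU : IsOpen U)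
    (hf : ContDiffOn ℝ ∞ f (Icc 0 1 ×ˢ U)) :
    ∃ g : ℝ × E → F, ContDiffOn ℝ ∞ g (univ ×ˢ U) ∧ ∀ t ∈ Icc (0 : ℝ) 1, ∀ x, g (t, x) = f (t, x) := by
  obtain ⟨w, hw⟩ := exists_isReflectionWeight
  obtain ⟨χ, hχ, hχ0, hχ1⟩ : ∃ χ : ℝ → ℝ, ContDiff ℝ ∞ χ ∧ (∀ t ≤ 1 / 3, χ t = 1) ∧
      ∀ t ≥ 2 / 3, χ t = 0 := by
    refine ⟨fun t => 1 - Real.smoothTransition (3 * t - 1), ?_, fun t ht => ?_, fun t ht => ?_⟩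
    · exact contDiff_const.sub (Real.smoothTransition.contDiff.comp (by fun_prop))
    · beta_reduce
      rw [Real.smoothTransition.zero_of_nonpos (by linarith), sub_zero]
    · beta_reduce
      rw [Real.smoothTransition.one_of_one_le (by linarith), sub_self]
  have hext : ∀ (f₀ : ℝ × E → F), ContDiffOn ℝ ∞ f₀ (Icc 0 1 ×ˢ U) →
      ∀ χ : ℝ → ℝ, ContDiff ℝ ∞ χ → (∀ t ≥ 2 / 3, χ t = 0) →
      ∃ g : ℝ × E → F, ContDiffOn ℝ ∞ g (univ ×ˢ U) ∧
        ∀ t ∈ Icc (0 : ℝ) 1, ∀ x, g (t, x) = χ t • f₀ (t, x) := by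
    intro f₀ hf₀ χ hχ hχ1
    let f₁ : ℝ × E → F := fun p => χ p.1 • f₀ p
    have hf₁ : ContDiffOn ℝ ∞ f₁ (Ici 0 ×ˢ U) := by
      have h1 : ContDiffOn ℝ ∞ f₁ (Icc 0 1 ×ˢ U) :=
        (hχ.comp contDiff_fst).contDiffOn.smul hf₀
      rintro p ⟨hp1, hp2⟩
      rcases lt_or_ge p.1 1 with h | h
      · refine (h1 p ⟨⟨hp1, h.le⟩, hp2⟩).mono_of_mem_nhdsWithin ?_
        have : ∀ᶠ q : ℝ × E in 𝓝 p, q.1 < 1 :=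
          continuous_fst.continuousAt.eventually (Iio_mem_nhds h)
        filter_upwards [self_mem_nhdsWithin, this.filter_mono nhdsWithin_le_nhds] with q hq hq1
        exact ⟨⟨hq.1, hq1.le⟩, hq.2⟩
      · have h0 : f₁ =ᶠ[𝓝 p] fun _ => 0 := by
          have : ∀ᶠ q : ℝ × E in 𝓝 p, 2 / 3 < q.1 :=
            continuous_fst.continuousAt.eventually (Ioi_mem_nhds (by linarith))
          filter_upwards [this] with q hq
          simp [f₁, hχ1 q.1 hq.le]
        exact (contDiffAt_const.congr_of_eventuallyEq h0).contDiffWithinAt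
    refine ⟨reflectionExtension w f₁, contDiffOn_reflectionExtension hw hU hf₁ (c := 1)
      (fun t ht x => ?_), fun t ht x => ?_⟩
    · simp [f₁, hχ1 t (by linarith)]
    · rw [reflectionExtension_of_nonneg w f₁ ht.1]
  have hrefl : ∀ t ∈ Icc (0 : ℝ) 1, 1 - t ∈ Icc (0 : ℝ) 1 :=
    fun t ht => ⟨by linarith [ht.2], by linarith [ht.1]⟩
  obtain ⟨g₁, hg₁, hg₁'⟩ := hext f hf χ hχ hχ1
  -- The cut-off χ splits f into a part vanishing near t = 1, extended past 0, and a part vanishing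
  -- near t = 0, extended past 1 after the reflection t ↦ 1 - t.
  obtain ⟨g₂, hg₂, hg₂'⟩ := hext (fun p => f (1 - p.1, p.2))
    (hf.comp (by fun_prop) (fun p hp => ⟨hrefl _ hp.1, hp.2⟩))
    (fun t => 1 - χ (1 - t)) (contDiff_const.sub (hχ.comp (by fun_prop)))
    (fun t ht => by rw [hχ0 _ (by linarith), sub_self])
  refine ⟨fun p => g₁ p + g₂ (1 - p.1, p.2), hg₁.add (hg₂.comp (by fun_prop)
    (fun p hp => ⟨mem_univ _, hp.2⟩)), fun t ht x => ?_⟩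
  simp only
  rw [hg₁' t ht, hg₂' _ (hrefl t ht)]
  simp only [sub_sub_cancel]
  rw [← add_smul, add_sub_cancel, one_smul]

end Extension

/-! ### Vector fields and tangent vectors in charts -/

section ChartToolkit

variable {E : Type*} [NormedAddCommGroup E] [NormedSpace ℝ E] {H : Type*} [TopologicalSpace H]
  {I : ModelWithCorners ℝ E H} {M : Type*} [TopologicalSpace M] [ChartedSpace H M]
  [IsManifold I ∞ M]

variable (I) in
/-- The derivative at `x` of the preferred chart at `x₀`. -/
def chartDeriv (x₀ x : M) : TangentSpace I x →L[ℝ] E :=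
  mfderiv I 𝓘(ℝ, E) (extChartAt I x₀) x

variable (I) in
/-- The derivative at `y` of the inverse of the preferred chart at `x₀`. -/
def chartSymmDeriv (x₀ : M) (y : E) : E →L[ℝ] TangentSpace I ((extChartAt I x₀).symm y) :=
  mfderiv 𝓘(ℝ, E) I (extChartAt I x₀).symm y

theorem tangentBundle_trivializationAt_snd {x₀ x : M} (hx : x ∈ (chartAt H x₀).source)
    (v : TangentSpace I x) :
    (trivializationAt E (TangentSpace I) x₀ ⟨x, v⟩).2 = chartDeriv I x₀ x v := by
  have : IsManifold I 1 M := IsManifold.of_le (n := ∞) (by simp)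
  have h1 : (trivializationAt E (TangentSpace I) x₀).continuousLinearMapAt ℝ x v =
      (trivializationAt E (TangentSpace I) x₀ ⟨x, v⟩).2 := by
    rw [Bundle.Trivialization.continuousLinearMapAt_apply, Bundle.Trivialization.linearMapAt_apply,
      if_pos]
    exact hx
  have h2 := TangentBundle.continuousLinearMapAt_trivializationAt (I := I) (𝕜 := ℝ) hx
  rw [← h1]
  exact congrArg (fun L : E →L[ℝ] E => L v) h2

variable {E' : Type*} [NormedAddCommGroup E'] [NormedSpace ℝ E'] {H' : Type*} [TopologicalSpace H']
  {J : ModelWithCorners ℝ E' H'} {N : Type*} [TopologicalSpace N] [ChartedSpace H' N]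

/-- The identification of `TangentSpace I (f q)` with E uses the preferred chart at f q, which may
jump as q varies. Smoothness is therefore tested in one fixed chart x₀ for all nearby points. -/
theorem contMDiffAt_tangentBundle_iff {f : N → M} {X : ∀ q, TangentSpace I (f q)} {q₀ : N} {x₀ : M}
    (hx : f q₀ ∈ (chartAt H x₀).source) :
    ContMDiffAt J I.tangent ∞ (fun q => (⟨f q, X q⟩ : TangentBundle I M)) q₀ ↔
      ContMDiffAt J I ∞ f q₀ ∧ ContMDiffAt J 𝓘(ℝ, E) ∞
        (fun q => chartDeriv I x₀ (f q) (X q)) q₀ := by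
  have he : (⟨f q₀, X q₀⟩ : TangentBundle I M) ∈
      (trivializationAt E (TangentSpace I) x₀).source :=
    ((trivializationAt E (TangentSpace I) x₀).mem_source).2 hx
  have h1 := (trivializationAt E (TangentSpace I) x₀).contMDiffAt_iff (IM := J) (IB := I)
    (n := ∞) (f := fun q => (⟨f q, X q⟩ : TangentBundle I M)) he
  refine h1.trans (and_congr_right fun hf => ?_)
  refine Filter.EventuallyEq.contMDiffAt_iff ?_
  filter_upwards [hf.continuousAt.eventually ((chartAt H x₀).open_source.mem_nhds hx)] with q hq
  exact tangentBundle_trivializationAt_snd hq (X q)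

variable [I.Boundaryless]

theorem mfderiv_extChartAt_mfderiv_symm {x₀ : M} {y : E} (hy : y ∈ (extChartAt I x₀).target) (v : E) :
    chartDeriv I x₀ ((extChartAt I x₀).symm y) (chartSymmDeriv I x₀ y v) = v := by
  have : IsManifold I 1 M := IsManifold.of_le (n := ∞) (by simp)
  have := mfderiv_extChartAt_comp_mfderivWithin_extChartAt_symm hy
  rw [I.range_eq_univ, mfderivWithin_univ] at this
  exact congrArg (fun L : E →L[ℝ] E => L v) this

theorem mfderiv_symm_mfderiv_extChartAt {x₀ x : M} (hx : x ∈ (chartAt H x₀).source)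
    (v : TangentSpace I x) :
    (chartSymmDeriv I x₀ (extChartAt I x₀ x) (chartDeriv I x₀ x v) : E) = v := by
  have : IsManifold I 1 M := IsManifold.of_le (n := ∞) (by simp)
  have hx' : x ∈ (extChartAt I x₀).source := by rwa [extChartAt_source]
  have h1 := mfderivWithin_extChartAt_symm_comp_mfderiv_extChartAt
    ((extChartAt I x₀).map_source hx')
  rw [I.range_eq_univ, mfderivWithin_univ, (extChartAt I x₀).left_inv hx'] at h1
  exact congrArg (fun L : E →L[ℝ] E => L v) h1

theorem mdifferentiableAt_extChartAt_symm {x₀ : M} {y : E} (hy : y ∈ (extChartAt I x₀).target) :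
    MDifferentiableAt 𝓘(ℝ, E) I (extChartAt I x₀).symm y := by
  have : IsManifold I 1 M := IsManifold.of_le (n := ∞) (by simp)
  have := mdifferentiableWithinAt_extChartAt_symm (I := I) hy
  rwa [I.range_eq_univ, mdifferentiableWithinAt_univ] at this

/-- A curve that solves an ordinary differential equation in a chart solves it on the manifold. -/
theorem hasMFDerivAt_extChartAt_symm_comp {x₀ x : M} {g : ℝ → E} {s : ℝ} {v : TangentSpace I x}
    (hgs : g s ∈ (extChartAt I x₀).target) (hx : (extChartAt I x₀).symm (g s) = x)
    (hg : HasDerivAt g (chartDeriv I x₀ x v) s) :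
    HasMFDerivAt 𝓘(ℝ, ℝ) I (fun r => (extChartAt I x₀).symm (g r)) s
      ((1 : ℝ →L[ℝ] ℝ).smulRight v) := by
  subst hx
  have h1 := (mdifferentiableAt_extChartAt_symm hgs).hasMFDerivAt
  have h2 := h1.comp s hg.hasFDerivAt.hasMFDerivAt
  refine h2.congr_mfderiv ?_
  refine ContinuousLinearMap.ext fun (r : ℝ) => ?_
  have h3 := mfderiv_symm_mfderiv_extChartAt (I := I) (x₀ := x₀)
    (x := (extChartAt I x₀).symm (g s))
    (by rw [← extChartAt_source I x₀]; exact (extChartAt I x₀).map_target hgs) v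
  rw [(extChartAt I x₀).right_inv hgs] at h3
  exact ((chartSymmDeriv I x₀ (g s)).map_smul r _).trans
    (congrArg (fun w : E => r • w) h3)

/-- The expression of a smooth vector field in a chart is smooth. -/
theorem contDiffOn_vectorField_chart {V : ∀ x : M, TangentSpace I x}
    (hV : ContMDiff I I.tangent ∞ (fun x => (⟨x, V x⟩ : TangentBundle I M))) (x₀ : M) :
    ContDiffOn ℝ ∞ (fun y => chartDeriv I x₀ ((extChartAt I x₀).symm y)
      (V ((extChartAt I x₀).symm y))) (extChartAt I x₀).target := by
  rw [← contMDiffOn_iff_contDiffOn]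
  intro y hy
  have hsrc : (extChartAt I x₀).symm y ∈ (chartAt H x₀).source := by
    rw [← extChartAt_source I x₀]; exact (extChartAt I x₀).map_target hy
  have h1 := ((contMDiffAt_tangentBundle_iff (f := fun x : M => x) (X := V) hsrc).1
    (hV _)).2
  exact h1.comp_contMDiffWithinAt y ((contMDiffOn_extChartAt_symm (n := ∞) x₀) y hy)

end ChartToolkit

/-! ### Local flows on manifolds -/

section LocalFlowManifold

universe u
variable {E : Type u} [NormedAddCommGroup E] [NormedSpace ℝ E] [FiniteDimensional ℝ E]
  {H : Type*} [TopologicalSpace H]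
  {I : ModelWithCorners ℝ E H} [I.Boundaryless] {M : Type*} [TopologicalSpace M] [ChartedSpace H M]
  [IsManifold I ∞ M]

theorem exists_localFlow_manifold {V : ∀ x : M, TangentSpace I x}
    (hV : ContMDiff I I.tangent ∞ (fun x => (⟨x, V x⟩ : TangentBundle I M))) (x₀ : M) :
    ∃ ε > 0, ∃ U : Set M, IsOpen U ∧ x₀ ∈ U ∧ ∃ F : ℝ × M → M,
      ContMDiffOn (𝓘(ℝ, ℝ).prod I) I ∞ F (Ioo (-ε) ε ×ˢ U) ∧
      ∀ x ∈ U, F (0, x) = x ∧ IsMIntegralCurveOn (fun s => F (s, x)) V (Ioo (-ε) ε) := by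
  have : CompleteSpace E := FiniteDimensional.complete ℝ E
  let e := extChartAt I x₀
  have hT : IsOpen e.target := isOpen_extChartAt_target x₀
  have hx₀ : e x₀ ∈ e.target := mem_extChartAt_target x₀
  let W : E → E := fun y => chartDeriv I x₀ (e.symm y) (V (e.symm y))
  have hW : ContDiffOn ℝ ∞ W e.target := contDiffOn_vectorField_chart hV x₀
  obtain ⟨r, hr, hrT⟩ := Metric.nhds_basis_closedBall.mem_iff.1 (hT.mem_nhds hx₀)
  -- The cut-off makes the chart expression of the field globally defined and smooth on E. The flow
  -- is later restricted to small times and starting points, so that it stays in the ball of radius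
  -- r / 2, where χ = 1.
  let χ : ContDiffBump (e x₀) := ⟨r / 2, r, by positivity, by linarith⟩
  have hχW : ContDiff ℝ ∞ (fun y => χ y • W y) := by
    rw [contDiff_iff_contDiffAt]
    intro y
    by_cases hy : y ∈ e.target
    · exact χ.contDiff.contDiffAt.smul (hW.contDiffAt (hT.mem_nhds hy))
    · have hy' : y ∉ tsupport χ := fun h => hy (hrT (by rwa [χ.tsupport_eq] at h))
      refine (contDiffAt_const (c := (0 : E))).congr_of_eventuallyEq ?_
      filter_upwards [notMem_tsupport_iff_eventuallyEq.1 hy'] with z hz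
      rw [hz]; simp
  obtain ⟨δ, hδ, G, hG, hG'⟩ := exists_contDiffOn_localFlow _ hχW (e x₀)
  have h0δ : (0 : ℝ) ∈ Ioo (-δ) δ := ⟨by linarith, hδ⟩
  have hcont : ContinuousAt G (0, e x₀) := (hG.contDiffAt (prod_mem_nhds
    (Ioo_mem_nhds h0δ.1 h0δ.2) (Metric.ball_mem_nhds _ hδ))).continuousAt
  have hGx₀ : G (0, e x₀) = e x₀ := (hG' _ (Metric.mem_ball_self hδ)).1
  have hev := hcont.eventually (by rw [hGx₀]; exact Metric.ball_mem_nhds (e x₀) (half_pos hr))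
  obtain ⟨ε₀, hε₀, hball⟩ := Metric.eventually_nhds_iff_ball.1 hev
  let ε := min ε₀ δ
  have hε : 0 < ε := lt_min hε₀ hδ
  have hGmem : ∀ s ∈ Ioo (-ε) ε, ∀ y ∈ Metric.ball (e x₀) ε,
      G (s, y) ∈ Metric.ball (e x₀) (r / 2) := by
    intro s hs y hy
    apply hball
    rw [Metric.mem_ball, Prod.dist_eq, max_lt_iff]
    refine ⟨?_, lt_of_lt_of_le hy (min_le_left _ _)⟩
    simp only [Real.dist_eq, sub_zero]
    exact (abs_lt.2 hs).trans_le (min_le_left _ _)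
  have hballT : Metric.ball (e x₀) (r / 2) ⊆ e.target :=
    fun y hy => hrT (Metric.ball_subset_closedBall (Metric.ball_subset_ball (by linarith) hy))
  let U : Set M := e.source ∩ e ⁻¹' Metric.ball (e x₀) ε
  have hU : IsOpen U := (continuousOn_extChartAt x₀).isOpen_inter_preimage
    (isOpen_extChartAt_source x₀) Metric.isOpen_ball
  refine ⟨ε, hε, U, hU, ⟨mem_extChartAt_source x₀, Metric.mem_ball_self hε⟩,
    fun q => e.symm (G (q.1, e q.2)), ?_, fun x hx => ⟨?_, fun s hs => ?_⟩⟩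
  · have h1 : ContMDiffOn (𝓘(ℝ, ℝ).prod I) 𝓘(ℝ, ℝ × E) ∞ (fun q : ℝ × M => (q.1, e q.2))
        (Ioo (-ε) ε ×ˢ U) := by
      rw [modelWithCornersSelf_prod, ← chartedSpaceSelf_prod]
      refine ContMDiffOn.prodMk contMDiffOn_fst ?_
      refine (contMDiffOn_extChartAt (n := ∞) (x := x₀)).comp contMDiffOn_snd ?_
      rintro q hq
      have := hq.2.1
      rwa [extChartAt_source] at this
    have h2 : ContMDiffOn 𝓘(ℝ, ℝ × E) 𝓘(ℝ, E) ∞ G (Ioo (-δ) δ ×ˢ Metric.ball (e x₀) δ) :=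
      contMDiffOn_iff_contDiffOn.2 hG
    have h3 := h2.comp h1 (fun q hq => ⟨Ioo_subset_Ioo (neg_le_neg (min_le_right _ _))
      (min_le_right _ _) hq.1, Metric.ball_subset_ball (min_le_right _ _) hq.2.2⟩)
    exact (contMDiffOn_extChartAt_symm (n := ∞) x₀).comp h3
      (fun q hq => hballT (hGmem _ hq.1 _ hq.2.2))
  · simp only
    rw [(hG' _ (Metric.ball_subset_ball (min_le_right _ _) hx.2)).1]
    exact e.left_inv hx.1
  · refine HasMFDerivAt.hasMFDerivWithinAt ?_
    have hmem := hGmem s hs _ hx.2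
    refine hasMFDerivAt_extChartAt_symm_comp (g := fun s => G (s, e x)) (hballT hmem) rfl ?_
    have := (hG' _ (Metric.ball_subset_ball (min_le_right _ _) hx.2)).2 s
      (Ioo_subset_Ioo (neg_le_neg (min_le_right _ _)) (min_le_right _ _) hs)
    rwa [χ.one_of_mem_closedBall (Metric.ball_subset_closedBall hmem), one_smul] at this

end LocalFlowManifold

/-! ### Global flows from a uniform existence time -/

section GlobalFlow

variable {E : Type*} [NormedAddCommGroup E] [NormedSpace ℝ E] [FiniteDimensional ℝ E]
  {H : Type*} [TopologicalSpace H]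
  {I : ModelWithCorners ℝ E H} [I.Boundaryless] {M : Type*} [TopologicalSpace M] [ChartedSpace H M]
  [IsManifold I ∞ M] [T2Space M]

/-- `V` has smooth local flows whose time of existence is bounded below by `ε`. -/
def HasLocalFlows (V : ∀ x : M, TangentSpace I x) (ε : ℝ) : Prop :=
  ∀ x₀ : M, ∃ U : Set M, IsOpen U ∧ x₀ ∈ U ∧ ∃ F : ℝ × M → M,
    ContMDiffOn (𝓘(ℝ, ℝ).prod I) I ∞ F (Ioo (-ε) ε ×ˢ U) ∧
    ∀ x ∈ U, F (0, x) = x ∧ IsMIntegralCurveOn (fun s => F (s, x)) V (Ioo (-ε) ε)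

/-- A uniform existence time makes integral curves complete. Joint smoothness holds for |s| < ε by
comparison with the local flows; each time-s map is smooth as the n-fold iterate of the time-s/n
map, and the group law carries joint smoothness to all times. -/
theorem exists_globalFlow {V : ∀ x : M, TangentSpace I x}
    (hV : ContMDiff I I.tangent ∞ (fun x => (⟨x, V x⟩ : TangentBundle I M)))
    {ε : ℝ} (hε : 0 < ε) (h : HasLocalFlows V ε) :
    ∃ Φ : ℝ → M → M, ContMDiff (𝓘(ℝ, ℝ).prod I) I ∞ (fun q : ℝ × M => Φ q.1 q.2) ∧
      (∀ x, Φ 0 x = x) ∧ ∀ x, IsMIntegralCurve (fun s => Φ s x) V := by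
  have : CompleteSpace E := FiniteDimensional.complete ℝ E
  have : IsManifold I 1 M := IsManifold.of_le (n := ∞) (by simp)
  have hV1 : ContMDiff I I.tangent 1 (fun x => (⟨x, V x⟩ : TangentBundle I M)) :=
    hV.of_le (by simp)
  have hex : ∀ x : M, ∃ γ : ℝ → M, γ 0 = x ∧ IsMIntegralCurve γ V :=
    exists_isMIntegralCurve_of_isMIntegralCurveOn hV1 hε (fun x => by
      obtain ⟨U, -, hxU, F, -, hF⟩ := h x
      exact ⟨fun s => F (s, x), hF x hxU⟩)
  choose γ hγ0 hγ using hex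
  let Φ : ℝ → M → M := fun s x => γ x s
  have hadd : ∀ s t x, Φ (s + t) x = Φ s (Φ t x) := by
    intro s t x
    have h1 := isMIntegralCurve_Ioo_eq_of_contMDiff_boundaryless (t₀ := 0) hV1
      ((hγ x).comp_add t) (hγ (γ x t)) (by simp [hγ0])
    exact congrFun h1 s
  have hsmall : ∀ s ∈ Ioo (-ε) ε, ∀ x,
      ContMDiffAt (𝓘(ℝ, ℝ).prod I) I ∞ (fun q : ℝ × M => Φ q.1 q.2) (s, x) := by
    intro s hs x
    obtain ⟨U, hU, hxU, F, hF, hF'⟩ := h x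
    have hnhds : Ioo (-ε) ε ×ˢ U ∈ 𝓝 (s, x) :=
      prod_mem_nhds (Ioo_mem_nhds hs.1 hs.2) (hU.mem_nhds hxU)
    refine (hF.contMDiffAt hnhds).congr_of_eventuallyEq ?_
    filter_upwards [hnhds] with q hq
    have h0 : (0 : ℝ) ∈ Ioo (-ε) ε := ⟨by linarith, hε⟩
    exact isMIntegralCurveOn_Ioo_eqOn_of_contMDiff_boundaryless h0 hV1
      ((hγ q.2).isMIntegralCurveOn _) (hF' q.2 hq.2).2 ((hγ0 _).trans (hF' q.2 hq.2).1.symm) hq.1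
  have hsmall' : ∀ s ∈ Ioo (-ε) ε, ContMDiff I I ∞ (Φ s) := fun s hs x =>
    (hsmall s hs x).comp x (contMDiffAt_const.prodMk contMDiffAt_id)
  have hmul : ∀ s ∈ Ioo (-ε) ε, ∀ n : ℕ, ContMDiff I I ∞ (Φ (n * s)) := by
    intro s hs n
    induction n with
    | zero =>
      have : Φ ((0 : ℕ) * s) = id := by
        funext x
        simp [Φ, hγ0]
      rw [this]
      exact contMDiff_id
    | succ n ih =>
      have : Φ ((n + 1 : ℕ) * s) = Φ s ∘ Φ (n * s) := by
        funext x
        rw [Function.comp_apply, ← hadd]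
        congr 1
        push_cast
        ring
      rw [this]
      exact (hsmall' s hs).comp ih
  have hall : ∀ s, ContMDiff I I ∞ (Φ s) := by
    intro s
    obtain ⟨n, hn⟩ := exists_nat_gt (|s| / ε)
    have hn0 : (0 : ℝ) < n := lt_of_le_of_lt (by positivity) hn
    have hs : s / n ∈ Ioo (-ε) ε := by
      rw [mem_Ioo, ← abs_lt, abs_div, abs_of_pos hn0, div_lt_iff₀ hn0]
      rwa [div_lt_iff₀ hε, mul_comm] at hn
    have := hmul _ hs n
    rwa [mul_div_cancel₀ _ hn0.ne'] at this
  refine ⟨Φ, fun q => ?_, hγ0, hγ⟩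
  obtain ⟨s, x⟩ := q
  -- Near (s, x) the flow is the fixed smooth map Φ s followed by the flow for a time near 0.
  have h1 : (fun q : ℝ × M => Φ q.1 q.2) = (fun q : ℝ × M => Φ q.1 q.2) ∘
      fun q : ℝ × M => (q.1 - s, Φ s q.2) := by
    funext q
    rw [Function.comp_apply, ← hadd, sub_add_cancel]
  rw [h1]
  refine ContMDiffAt.comp (s, x) (hsmall _ (by simpa using hε) _) ?_
  exact (contMDiffAt_fst.sub contMDiffAt_const).prodMk ((hall s).contMDiffAt.comp _ contMDiffAt_snd)

end GlobalFlow

/-! ### Time-dependent and parameter-dependent flows by suspension -/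

section ParametrizedFlow

variable {E : Type*} [NormedAddCommGroup E] [NormedSpace ℝ E] [FiniteDimensional ℝ E]
  {H : Type*} [TopologicalSpace H]
  {I : ModelWithCorners ℝ E H} [I.Boundaryless] {M : Type*} [TopologicalSpace M] [ChartedSpace H M]
  [IsManifold I ∞ M] [T2Space M]
  {P : Type*} [NormedAddCommGroup P] [NormedSpace ℝ P] [FiniteDimensional ℝ P]

/-- The vector field `(κ, X)` on `P × M`. -/
def suspension (κ : P) (X : P → ∀ x : M, TangentSpace I x) (q : P × M) :
    TangentSpace (𝓘(ℝ, P).prod I) q :=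
  (κ, X q.1 q.2)

theorem contMDiff_suspension (κ : P) {X : P → ∀ x : M, TangentSpace I x}
    (hX : ContMDiff (𝓘(ℝ, P).prod I) I.tangent ∞
      (fun q : P × M => (⟨q.2, X q.1 q.2⟩ : TangentBundle I M))) :
    ContMDiff (𝓘(ℝ, P).prod I) (𝓘(ℝ, P).prod I).tangent ∞
      (fun q : P × M => (⟨q, suspension κ X q⟩ : TangentBundle (𝓘(ℝ, P).prod I) (P × M))) := by
  have : IsManifold I 1 M := IsManifold.of_le (n := ∞) (by simp)
  have h1 : ContMDiff 𝓘(ℝ, P) 𝓘(ℝ, P).tangent ∞ (fun p : P => (⟨p, κ⟩ : TangentBundle 𝓘(ℝ, P) P)) :=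
    contMDiff_vectorSpace_iff_contDiff.2 contDiff_const
  have h2 := (h1.comp (contMDiff_fst (I := 𝓘(ℝ, P)) (J := I) (M := P) (N := M))).prodMk hX
  exact (contMDiff_equivTangentBundleProd_symm (I := 𝓘(ℝ, P)) (M := P) (I' := I) (M' := M)
    (n := ∞)).comp h2

theorem hasMFDerivAt_suspension {κ : P} {X : P → ∀ x : M, TangentSpace I x} {p : P} {y : ℝ → M}
    {s : ℝ} (h : HasMFDerivAt 𝓘(ℝ, ℝ) I y s ((1 : ℝ →L[ℝ] ℝ).smulRight (X (p + s • κ) (y s)))) :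
    HasMFDerivAt 𝓘(ℝ, ℝ) (𝓘(ℝ, P).prod I) (fun r => (p + r • κ, y r)) s
      ((1 : ℝ →L[ℝ] ℝ).smulRight (suspension κ X (p + s • κ, y s))) := by
  have h1 : HasMFDerivAt 𝓘(ℝ, ℝ) 𝓘(ℝ, P) (fun r : ℝ => p + r • κ) s
      ((1 : ℝ →L[ℝ] ℝ).smulRight κ) := by
    have : HasDerivAt (fun r : ℝ => p + r • κ) κ s := by
      simpa using ((hasDerivAt_id s).smul_const κ).const_add p
    exact this.hasFDerivAt.hasMFDerivAt
  exact (h1.prodMk h).congr_mfderiv rfl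

/-- This is the flow of the suspended field (κ, X) on P × M, whose first component moves by p + s κ.
With P = ℝ and κ = 1 it treats time-dependent fields; with κ = 0 it treats families of autonomous
fields. Compactness gives a uniform existence time near J × C, and elsewhere the flow is a
translation in P for short times. -/
theorem exists_parametrizedFlow (κ : P) {X : P → ∀ x : M, TangentSpace I x}
    (hX : ContMDiff (𝓘(ℝ, P).prod I) I.tangent ∞
      (fun q : P × M => (⟨q.2, X q.1 q.2⟩ : TangentBundle I M)))
    {J : Set P} (hJ : IsCompact J) {C : Set M} (hC : IsCompact C)
    (hXJ : ∀ p x, p ∉ J → X p x = 0) (hXC : ∀ p x, x ∉ C → X p x = 0) :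
    ∃ Φ : ℝ → P → M → M,
      ContMDiff (𝓘(ℝ, ℝ).prod (𝓘(ℝ, P).prod I)) I ∞
        (fun q : ℝ × P × M => Φ q.1 q.2.1 q.2.2) ∧
      (∀ p x, Φ 0 p x = x) ∧
      (∀ p x s, HasMFDerivAt 𝓘(ℝ, ℝ) I (fun r => Φ r p x) s
        ((1 : ℝ →L[ℝ] ℝ).smulRight (X (p + s • κ) (Φ s p x)))) ∧
      (∀ (p : P) (x : M) (y : ℝ → M) (a b t₀ : ℝ), t₀ ∈ Ioo a b →
        (∀ s ∈ Ioo a b, HasMFDerivAt 𝓘(ℝ, ℝ) I y s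
          ((1 : ℝ →L[ℝ] ℝ).smulRight (X (p + s • κ) (y s)))) →
        y t₀ = Φ t₀ p x → ∀ s ∈ Ioo a b, y s = Φ s p x) := by
  have : CompleteSpace E := FiniteDimensional.complete ℝ E
  have : ProperSpace P := FiniteDimensional.proper ℝ P
  let V : ∀ q : P × M, TangentSpace (𝓘(ℝ, P).prod I) q := suspension κ X
  have hV := contMDiff_suspension κ hX
  have htrans : ContMDiff (𝓘(ℝ, ℝ).prod (𝓘(ℝ, P).prod I)) (𝓘(ℝ, P).prod I) ∞
      (fun q : ℝ × P × M => (q.2.1 + q.1 • κ, q.2.2)) :=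
    ((contMDiff_fst.comp contMDiff_snd).add (contMDiff_fst.smul contMDiff_const)).prodMk
      (contMDiff_snd.comp contMDiff_snd)
  have htrans' : ∀ (p : P) (x : M) (s : ℝ), X (p + s • κ) x = 0 →
      HasMFDerivAt 𝓘(ℝ, ℝ) (𝓘(ℝ, P).prod I) (fun r => ((p + r • κ, x) : P × M)) s
        ((1 : ℝ →L[ℝ] ℝ).smulRight (V (p + s • κ, x))) := by
    intro p x s hs
    refine hasMFDerivAt_suspension (κ := κ) (X := X) (y := fun _ => x) ?_
    rw [hs]
    refine (hasMFDerivAt_const x s).congr_mfderiv ?_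
    refine ContinuousLinearMap.ext fun (r : ℝ) => ?_
    exact (smul_zero (A := E) r).symm
  have hloc : ∃ ε > 0, HasLocalFlows V ε := by
    have hK : IsCompact (Metric.cthickening 1 J ×ˢ C) := (hJ.cthickening).prod hC
    choose ε hε U hU hxU F hF hF' using fun q : P × M => exists_localFlow_manifold hV q
    obtain ⟨t, -, ht⟩ := hK.elim_nhds_subcover U (fun q _ => (hU q).mem_nhds (hxU q))
    obtain ⟨ε₁, hε₁, hε₁t⟩ : ∃ ε₁ > 0, ∀ q ∈ t, ε₁ ≤ ε q := by
      rcases t.eq_empty_or_nonempty with h | h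
      · exact ⟨1, one_pos, by simp [h]⟩
      · exact ⟨t.inf' h ε, by simpa [Finset.lt_inf'_iff] using fun a b hab => hε (a, b),
          fun q hq => Finset.inf'_le _ hq⟩
    -- The second bound keeps the displacement s κ below 1 / 2. A parameter within 1 / 2 of a point
    -- outside the 1-thickening of J therefore cannot reach J in this time.
    let ε₂ := min ε₁ (1 / (2 * (‖κ‖ + 1)))
    have hκ : 0 < 2 * (‖κ‖ + 1) := by positivity
    refine ⟨ε₂, lt_min hε₁ (by positivity), fun q₀ => ?_⟩
    by_cases hq₀ : q₀ ∈ Metric.cthickening 1 J ×ˢ C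
    · obtain ⟨q, hq, hq'⟩ := mem_iUnion₂.1 (ht hq₀)
      have hsub : Ioo (-ε₂) ε₂ ⊆ Ioo (-ε q) (ε q) := by
        have : ε₂ ≤ ε q := (min_le_left _ _).trans (hε₁t q hq)
        exact Ioo_subset_Ioo (by linarith) this
      exact ⟨U q, hU q, hq', F q, (hF q).mono (prod_mono hsub le_rfl),
        fun x hx => ⟨(hF' q x hx).1, (hF' q x hx).2.mono hsub⟩⟩
    · have key : ∃ W : Set (P × M), IsOpen W ∧ q₀ ∈ W ∧ ∀ q ∈ W, ∀ s ∈ Ioo (-ε₂) ε₂,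
          X (q.1 + s • κ) q.2 = 0 := by
        by_cases hx : q₀.2 ∈ C
        · have hp : q₀.1 ∉ Metric.cthickening 1 J := fun h => hq₀ ⟨h, hx⟩
          refine ⟨Metric.ball q₀.1 (1 / 2) ×ˢ univ, Metric.isOpen_ball.prod isOpen_univ,
            ⟨Metric.mem_ball_self (by norm_num), mem_univ _⟩, fun q hq s hs => hXJ _ _ fun h => hp ?_⟩
          refine Metric.mem_cthickening_of_dist_le _ _ _ _ h ?_
          have h1 : dist q₀.1 q.1 < 1 / 2 := by rw [dist_comm]; exact hq.1
          have h2 : dist q.1 (q.1 + s • κ) ≤ 1 / 2 := by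
            rw [dist_eq_norm, sub_add_cancel_left, norm_neg, norm_smul, Real.norm_eq_abs]
            have h3 : |s| < 1 / (2 * (‖κ‖ + 1)) := (abs_lt.2 hs).trans_le (min_le_right _ _)
            rw [lt_div_iff₀ hκ] at h3
            nlinarith [abs_nonneg s, norm_nonneg κ]
          linarith [dist_triangle q₀.1 q.1 (q.1 + s • κ)]
        · exact ⟨univ ×ˢ Cᶜ, isOpen_univ.prod hC.isClosed.isOpen_compl, ⟨mem_univ _, hx⟩,
            fun q hq s _ => hXC _ _ hq.2⟩
      obtain ⟨W, hW, hqW, hWX⟩ := key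
      refine ⟨W, hW, hqW, fun q => (q.2.1 + q.1 • κ, q.2.2), htrans.contMDiffOn, fun q hq =>
        ⟨by simp, fun s hs => (htrans' q.1 q.2 s (hWX q hq s hs)).hasMFDerivWithinAt⟩⟩
  obtain ⟨ε, hε, hlocε⟩ := hloc
  obtain ⟨Φ, hΦ, hΦ0, hΦ'⟩ := exists_globalFlow hV hε hlocε
  have hfst : ∀ s q, (Φ s q).1 = q.1 + s • κ := by
    intro s q
    have hd : ∀ s, HasDerivAt (fun s => (Φ s q).1 - s • κ) 0 s := by
      intro s
      have h1 : HasMFDerivAt 𝓘(ℝ, ℝ) 𝓘(ℝ, P) (fun s => (Φ s q).1) s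
          ((1 : ℝ →L[ℝ] ℝ).smulRight κ) :=
        ((hasMFDerivAt_fst (x := Φ s q)).comp s (hΦ' q s)).congr_mfderiv (by
          refine ContinuousLinearMap.ext fun (r : ℝ) => ?_
          rfl)
      have h2 : HasDerivAt (fun s => (Φ s q).1) κ s := by
        exact hasMFDerivAt_iff_hasFDerivAt.1 h1
      have h3 : HasDerivAt (fun s : ℝ => s • κ) κ s := by
        simpa using (hasDerivAt_id s).smul_const κ
      exact (sub_self κ) ▸ h2.fun_sub h3
    have h3 := is_const_of_deriv_eq_zero (fun s => (hd s).differentiableAt)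
      (fun s => (hd s).deriv) s 0
    rw [hΦ0, zero_smul, sub_zero] at h3
    rw [← h3, sub_add_cancel]
  refine ⟨fun s p x => (Φ s (p, x)).2, contMDiff_snd.comp hΦ, fun p x => by simp only [hΦ0], ?_, ?_⟩
  · intro p x s
    refine ((hasMFDerivAt_snd (x := Φ s (p, x))).comp s (hΦ' (p, x) s)).congr_mfderiv ?_
    refine ContinuousLinearMap.ext fun (r : ℝ) => ?_
    change r • X (Φ s (p, x)).1 (Φ s (p, x)).2 = r • X (p + s • κ) (Φ s (p, x)).2
    rw [hfst s (p, x)]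
  · intro p x y a b t₀ ht₀ hy hyt₀ s hs
    have : IsManifold I 1 M := IsManifold.of_le (n := ∞) (by simp)
    have h1 : IsMIntegralCurveOn (fun r => ((p + r • κ, y r) : P × M)) V (Ioo a b) :=
      fun r hr => (hasMFDerivAt_suspension (hy r hr)).hasMFDerivWithinAt
    have h2 := isMIntegralCurveOn_Ioo_eqOn_of_contMDiff_boundaryless ht₀ (hV.of_le (by simp)) h1
      ((hΦ' (p, x)).isMIntegralCurveOn _) (Prod.ext (hfst t₀ (p, x)).symm hyt₀) hs
    exact congrArg Prod.snd h2

end ParametrizedFlow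

/-! ### Pull-back of one-forms and naturality of the exterior derivative -/

section FormCalculus

variable {E : Type*} [NormedAddCommGroup E] [NormedSpace ℝ E] {H : Type*} [TopologicalSpace H]
  {I : ModelWithCorners ℝ E H} [I.Boundaryless] {M : Type*} [TopologicalSpace M] [ChartedSpace H M]
  [IsManifold I ∞ M]
  {E' : Type*} [NormedAddCommGroup E'] [NormedSpace ℝ E']

theorem OneForm.IsSmooth.contDiffAt_inChart {α : OneForm I M} (hα : α.IsSmooth) {x₀ : M} :
    ContDiffAt ℝ ∞ (α.inChart x₀) (extChartAt I x₀ x₀) := by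
  have : IsManifold I 1 M := IsManifold.of_le (n := ∞) (by simp)
  have h1 := (contMDiffAt_hom_bundle _).1 (hα x₀)
  have h2 := h1.2
  rw [← contMDiffAt_iff_contDiffAt]
  have hT : extChartAt I x₀ x₀ ∈ (extChartAt I x₀).target := mem_extChartAt_target x₀
  have h3 : ContMDiffAt 𝓘(ℝ, E) I ∞ (extChartAt I x₀).symm (extChartAt I x₀ x₀) :=
    (contMDiffOn_extChartAt_symm (n := ∞) x₀).contMDiffAt
      ((isOpen_extChartAt_target x₀).mem_nhds hT)
  have h4 := ContMDiffAt.comp_of_eq h2 h3 (extChartAt_to_inv x₀)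
  refine h4.congr_of_eventuallyEq ?_
  filter_upwards [(isOpen_extChartAt_target x₀).mem_nhds hT] with y hy
  have hy' : (extChartAt I x₀).symm y ∈ (chartAt H x₀).source := by
    rw [← extChartAt_source I x₀]; exact (extChartAt I x₀).map_target hy
  refine ContinuousLinearMap.ext fun v => ?_
  have h5 := TangentBundle.symmL_trivializationAt (I := I) (𝕜 := ℝ) hy'
  rw [(extChartAt I x₀).right_inv hy, I.range_eq_univ, mfderivWithin_univ] at h5
  have h6 : (ContinuousLinearMap.inCoordinates E (TangentSpace I) ℝ (fun _ : M => ℝ) x₀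
      ((extChartAt I x₀).symm y) x₀ ((extChartAt I x₀).symm y) (α ((extChartAt I x₀).symm y))) v =
      α ((extChartAt I x₀).symm y) ((trivializationAt E (TangentSpace I) x₀).symmL ℝ
        ((extChartAt I x₀).symm y) v) :=
    congrArg (fun L : ℝ →L[ℝ] ℝ => L _)
      (Bundle.Trivial.continuousLinearMapAt_trivialization ℝ M ℝ ((extChartAt I x₀).symm y))
  refine Eq.trans ?_ h6.symm
  exact congrArg (fun L : E →L[ℝ] E => (α ((extChartAt I x₀).symm y) : E →L[ℝ] ℝ) (L v))
    h5.symm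

/-- The pull-back of a one-form under a map from a vector space. -/
def OneForm.pullback (α : OneForm I M) (G : E' → M) (q : E') : E' →L[ℝ] ℝ :=
  (α (G q)).comp (mfderiv 𝓘(ℝ, E') I G q)

theorem contDiffAt_extChartAt_comp {G : E' → M} {q : E'} (x₀ : M)
    (hx : G q ∈ (chartAt H x₀).source) (hG : ContMDiffAt 𝓘(ℝ, E') I ∞ G q) :
    ContDiffAt ℝ ∞ (fun q => extChartAt I x₀ (G q)) q :=
  contMDiffAt_iff_contDiffAt.1 ((contMDiffAt_extChartAt' hx).comp q hG)

theorem chartDeriv_mfderiv {G : E' → M} {q : E'} {x₀ : M}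
    (hx : G q ∈ (chartAt H x₀).source) (hG : MDifferentiableAt 𝓘(ℝ, E') I G q) (v : E') :
    chartDeriv I x₀ (G q) (mfderiv 𝓘(ℝ, E') I G q v) =
      fderiv ℝ (fun q => extChartAt I x₀ (G q)) q v := by
  have : IsManifold I 1 M := IsManifold.of_le (n := ∞) (by simp)
  have h1 := (mdifferentiableAt_extChartAt (I := I) hx).hasMFDerivAt.comp q hG.hasMFDerivAt
  have h2 : HasFDerivAt (fun q => extChartAt I x₀ (G q)) (show E' →L[ℝ] E from
    (chartDeriv I x₀ (G q)).comp (mfderiv 𝓘(ℝ, E') I G q)) q := hasMFDerivAt_iff_hasFDerivAt.1 h1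
  exact congrArg (fun L : E' →L[ℝ] E => L v) h2.fderiv.symm

theorem OneForm.apply_eq_inChart (α : OneForm I M) {x₀ x : M} (hx : x ∈ (chartAt H x₀).source)
    (v : TangentSpace I x) :
    α x v = α.inChart x₀ (extChartAt I x₀ x) (chartDeriv I x₀ x v) := by
  have h1 := mfderiv_symm_mfderiv_extChartAt (I := I) hx v
  have hx' : (extChartAt I x₀).symm (extChartAt I x₀ x) = x :=
    (extChartAt I x₀).left_inv (by rwa [extChartAt_source])
  have h2 : ∀ z : M, z = x → (show E →L[ℝ] ℝ from α z) = (show E →L[ℝ] ℝ from α x) := by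
    rintro z rfl; rfl
  have h3 : α.inChart x₀ (extChartAt I x₀ x) (chartDeriv I x₀ x v) =
      (show E →L[ℝ] ℝ from α ((extChartAt I x₀).symm (extChartAt I x₀ x)))
        (chartSymmDeriv I x₀ (extChartAt I x₀ x) (chartDeriv I x₀ x v)) := rfl
  rw [h3, h2 _ hx']
  exact congrArg (show E →L[ℝ] ℝ from α x) h1.symm

theorem OneForm.pullback_eventuallyEq (α : OneForm I M) {G : E' → M} {q : E'} (x₀ : M)
    (hx : G q ∈ (chartAt H x₀).source) (hG : ContMDiffAt 𝓘(ℝ, E') I ∞ G q) :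
    α.pullback G =ᶠ[𝓝 q] fun q => (α.inChart x₀ (extChartAt I x₀ (G q))).comp
      (fderiv ℝ (fun q => extChartAt I x₀ (G q)) q) := by
  have h1 : ∀ᶠ q' in 𝓝 q, ContMDiffAt 𝓘(ℝ, E') I 1 G q' :=
    
    (contMDiffAt_iff_contMDiffAt_nhds (by simp)).1 (hG.of_le (by simp))
  filter_upwards [h1, hG.continuousAt.eventually ((chartAt H x₀).open_source.mem_nhds hx)]
    with q' hq' hx'
  refine ContinuousLinearMap.ext fun v => ?_
  rw [ContinuousLinearMap.comp_apply, ← chartDeriv_mfderiv hx' (hq'.mdifferentiableAt (by simp)),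
    ← α.apply_eq_inChart hx']
  rfl

theorem OneForm.IsSmooth.contDiffAt_pullback {α : OneForm I M} (hα : α.IsSmooth) {G : E' → M}
    {q : E'} (hG : ContMDiffAt 𝓘(ℝ, E') I ∞ G q) : ContDiffAt ℝ ∞ (α.pullback G) q := by
  refine ContDiffAt.congr_of_eventuallyEq ?_
    (α.pullback_eventuallyEq (G q) (mem_chart_source H (G q)) hG)
  have h1 := contDiffAt_extChartAt_comp (G q) (mem_chart_source H (G q)) hG
  have h2 : ContDiffAt ℝ ∞ (fun q' => α.inChart (G q) (extChartAt I (G q) (G q'))) q :=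
    ContDiffAt.comp (g := α.inChart (G q)) (f := fun q' => extChartAt I (G q) (G q')) q
      hα.contDiffAt_inChart h1
  exact h2.clm_comp (h1.fderiv_right (m := ∞) (by simp))

/-- The tangent space at G q is modelled on E through the preferred chart at G q itself, so no
change of coordinates appears. -/
theorem mfderiv_eq_fderiv_extChartAt {G : E' → M} {q : E'}
    (hG : MDifferentiableAt 𝓘(ℝ, E') I G q) (v : E') :
    (mfderiv 𝓘(ℝ, E') I G q v : E) = fderiv ℝ (fun q' => extChartAt I (G q) (G q')) q v := by
  rw [hG.mfderiv]
  simp only [writtenInExtChartAt, mfld_simps, fderivWithin_univ]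
  rfl

/-- The product rule produces one extra term with the second derivative of g, which is symmetric and
cancels under antisymmetrization. -/
theorem fderiv_comp_fderiv_antisymm {a : E → E →L[ℝ] ℝ} {g : E' → E} {q : E'}
    (ha : ContDiffAt ℝ ∞ a (g q)) (hg : ContDiffAt ℝ ∞ g q) (v w : E') :
    fderiv ℝ (fun q => (a (g q)).comp (fderiv ℝ g q)) q v w -
      fderiv ℝ (fun q => (a (g q)).comp (fderiv ℝ g q)) q w v =
    fderiv ℝ a (g q) (fderiv ℝ g q v) (fderiv ℝ g q w) -
      fderiv ℝ a (g q) (fderiv ℝ g q w) (fderiv ℝ g q v) := by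
  have h1 : HasFDerivAt (fun q => a (g q)) ((fderiv ℝ a (g q)).comp (fderiv ℝ g q)) q :=
    (ha.differentiableAt (by simp)).hasFDerivAt.comp q (hg.differentiableAt (by simp)).hasFDerivAt
  have h2 : HasFDerivAt (fderiv ℝ g) (fderiv ℝ (fderiv ℝ g) q) q :=
    ((hg.fderiv_right (m := ∞) (by simp)).differentiableAt (by simp)).hasFDerivAt
  have h3 := (h1.clm_comp h2).fderiv
  have hsymm : IsSymmSndFDerivAt ℝ g q :=
    hg.isSymmSndFDerivAt (by
      rw [minSmoothness_of_isRCLikeNormedField]; exact WithTop.coe_le_coe.2 le_top)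
  rw [h3]
  have := hsymm.eq v w
  simp only [add_apply, ContinuousLinearMap.comp_apply,
    ContinuousLinearMap.compL_apply, ContinuousLinearMap.flip_apply]
  rw [this]
  ring

/-- The exterior derivative commutes with pull-back. -/
theorem OneForm.IsSmooth.fderiv_pullback {α : OneForm I M} (hα : α.IsSmooth) {G : E' → M}
    {q : E'} (hG : ContMDiffAt 𝓘(ℝ, E') I ∞ G q) (v w : E') :
    fderiv ℝ (α.pullback G) q v w - fderiv ℝ (α.pullback G) q w v =
      α.d (G q) (mfderiv 𝓘(ℝ, E') I G q v) (mfderiv 𝓘(ℝ, E') I G q w) := by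
  rw [(α.pullback_eventuallyEq (G q) (mem_chart_source H (G q)) hG).fderiv_eq]
  have hG' := hG.mdifferentiableAt (by simp)
  rw [OneForm.d]
  have h1 := mfderiv_eq_fderiv_extChartAt hG'
  have h2 := fderiv_comp_fderiv_antisymm (g := fun q' => extChartAt I (G q) (G q'))
    (hα.contDiffAt_inChart (x₀ := G q)) (contDiffAt_extChartAt_comp (G q) (mem_chart_source H (G q)) hG) v w
  refine h2.trans ?_
  rw [← h1 v, ← h1 w]

theorem contMDiffAt_extChartAt_symm {x₀ : M} {y : E} (hy : y ∈ (extChartAt I x₀).target) :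
    ContMDiffAt 𝓘(ℝ, E) I ∞ (extChartAt I x₀).symm y :=
  (contMDiffOn_extChartAt_symm (n := ∞) x₀).contMDiffAt
    ((isOpen_extChartAt_target x₀).mem_nhds hy)

theorem OneForm.IsSmooth.contDiffOn_inChart {α : OneForm I M} (hα : α.IsSmooth) (x₀ : M) :
    ContDiffOn ℝ ∞ (α.inChart x₀) (extChartAt I x₀).target := fun _ hy =>
  (hα.contDiffAt_pullback (contMDiffAt_extChartAt_symm hy)).contDiffWithinAt

/-- The exterior derivative can be computed in any chart. -/
theorem OneForm.IsSmooth.d_eq_inChart {α : OneForm I M} (hα : α.IsSmooth) {x₀ x : M}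
    (hx : x ∈ (chartAt H x₀).source) (v w : TangentSpace I x) :
    α.d x v w =
      fderiv ℝ (α.inChart x₀) (extChartAt I x₀ x) (chartDeriv I x₀ x v) (chartDeriv I x₀ x w) -
      fderiv ℝ (α.inChart x₀) (extChartAt I x₀ x) (chartDeriv I x₀ x w) (chartDeriv I x₀ x v) := by
  have hx' : x ∈ (extChartAt I x₀).source := by rwa [extChartAt_source]
  have h1 := hα.fderiv_pullback (contMDiffAt_extChartAt_symm (I := I)
    ((extChartAt I x₀).map_source hx')) (chartDeriv I x₀ x v) (chartDeriv I x₀ x w)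
  refine Eq.trans ?_ h1.symm
  have h2 : ∀ z : M, z = x → ∀ v' w' : E, α.d z v' w' = α.d x v' w' := by
    rintro z rfl _ _; rfl
  have h3 : ∀ v : TangentSpace I x, _ = (v : E) := mfderiv_symm_mfderiv_extChartAt (I := I) hx
  refine Eq.trans ?_ (h2 _ ((extChartAt I x₀).left_inv hx') _ _).symm
  change α.d x v w = α.d x (chartSymmDeriv I x₀ (extChartAt I x₀ x) (chartDeriv I x₀ x v) : E)
    (chartSymmDeriv I x₀ (extChartAt I x₀ x) (chartDeriv I x₀ x w) : E)
  rw [h3, h3]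

end FormCalculus

/-! ### Linear algebra of contact forms -/

section LinearContact

variable {E : Type*} [NormedAddCommGroup E] [NormedSpace ℝ E]

/-- The bilinear form `a ⊗ a + da` determined by the value `a` and the derivative `L` of a one-form. -/
def contactBilin (a : E →L[ℝ] ℝ) (L : E →L[ℝ] E →L[ℝ] ℝ) : E →L[ℝ] E →L[ℝ] ℝ :=
  a.smulRight a + (L - L.flip)

theorem contactBilin_apply (a : E →L[ℝ] ℝ) (L : E →L[ℝ] E →L[ℝ] ℝ) (v w : E) :
    contactBilin a L v w = a v * a w + (L v w - L w v) := by
  simp [contactBilin]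

/-- In dimension three, vectors u, v, w on which a ∧ da is nonzero form a basis. Evaluating the
contraction of a ∧ da with x on (v, w), (w, u) and (u, v) isolates the three coordinates of x. -/
theorem eq_zero_of_volume_contraction (a : E →L[ℝ] ℝ) (L : E →L[ℝ] E →L[ℝ] ℝ)
    (hE : Module.finrank ℝ E = 3) {u v w : E}
    (h : a u * (L v w - L w v) + a v * (L w u - L u w) + a w * (L u v - L v u) ≠ 0) {x : E}
    (hx : ∀ y z, a x * (L y z - L z y) + a y * (L z x - L x z) + a z * (L x y - L y x) = 0) :
    x = 0 := by
  have : FiniteDimensional ℝ E := FiniteDimensional.of_finrank_pos (by omega)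
  have key : ∀ r s t : ℝ, (∀ y z, a (r • u + s • v + t • w) * (L y z - L z y) +
      a y * (L z (r • u + s • v + t • w) - L (r • u + s • v + t • w) z) +
      a z * (L (r • u + s • v + t • w) y - L y (r • u + s • v + t • w)) = 0) →
      r = 0 ∧ s = 0 ∧ t = 0 := by
    intro r s t hrst
    have h1 := hrst v w
    have h2 := hrst w u
    have h3 := hrst u v
    simp only [map_add, map_smul, add_apply, smul_apply,
      smul_eq_mul] at h1 h2 h3
    refine ⟨(mul_eq_zero.1 (?_ : r * _ = 0)).resolve_right h,
      (mul_eq_zero.1 (?_ : s * _ = 0)).resolve_right h,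
      (mul_eq_zero.1 (?_ : t * _ = 0)).resolve_right h⟩ <;> linarith
  have hli : LinearIndependent ℝ ![u, v, w] := by
    rw [Fintype.linearIndependent_iff]
    intro g hg
    have h0 : g 0 • u + g 1 • v + g 2 • w = 0 := by simpa [Fin.sum_univ_three] using hg
    have := key (g 0) (g 1) (g 2) (by intro y z; rw [h0]; simp)
    intro i
    fin_cases i
    exacts [this.1, this.2.1, this.2.2]
  have hspan : x ∈ Submodule.span ℝ (range ![u, v, w]) := by
    have := hli.span_eq_top_of_card_eq_finrank' (by simp [hE])
    rw [this]; trivial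
  obtain ⟨c, rfl⟩ := (Submodule.mem_span_range_iff_exists_fun ℝ).1 hspan
  have h0 : ∑ i, c i • ![u, v, w] i = c 0 • u + c 1 • v + c 2 • w := by simp [Fin.sum_univ_three]
  rw [h0] at hx ⊢
  obtain ⟨h1, h2, h3⟩ := key _ _ _ hx
  rw [h1, h2, h3]
  simp

/-- The three-form `a ∧ da` determined by the value `a` and the derivative `L` of a one-form on a
space of dimension three does not vanish. -/
def IsContactPair (a : E →L[ℝ] ℝ) (L : E →L[ℝ] E →L[ℝ] ℝ) : Prop :=
  Module.finrank ℝ E = 3 ∧ ∃ u v w : E,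
    a u * (L v w - L w v) + a v * (L w u - L u w) + a w * (L u v - L v u) ≠ 0

theorem IsContactPair.finiteDimensional {a : E →L[ℝ] ℝ} {L : E →L[ℝ] E →L[ℝ] ℝ}
    (h : IsContactPair a L) : FiniteDimensional ℝ E :=
  FiniteDimensional.of_finrank_pos (by rw [h.1]; norm_num)

theorem IsContactPair.map {E' : Type*} [NormedAddCommGroup E'] [NormedSpace ℝ E']
    {a : E →L[ℝ] ℝ} {L : E →L[ℝ] E →L[ℝ] ℝ} {a' : E' →L[ℝ] ℝ} {L' : E' →L[ℝ] E' →L[ℝ] ℝ}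
    (hE' : Module.finrank ℝ E' = 3) (h : IsContactPair a L)
    (T : E →L[ℝ] E') (ha : ∀ v, a v = a' (T v))
    (hL : ∀ v w, L v w - L w v = L' (T v) (T w) - L' (T w) (T v)) : IsContactPair a' L' := by
  obtain ⟨-, u, v, w, h⟩ := h
  refine ⟨hE', T u, T v, T w, ?_⟩
  rwa [← ha, ← ha, ← ha, ← hL, ← hL, ← hL]

/-- If a(x) a + ι_x da = 0, evaluation at x gives a(x)² = 0. Then ι_x da = 0 as well, so x contracts
a ∧ da to zero and vanishes. -/
theorem contactBilin_injective {a : E →L[ℝ] ℝ} {L : E →L[ℝ] E →L[ℝ] ℝ}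
    (h : IsContactPair a L) :
    Function.Injective (contactBilin a L) := by
  obtain ⟨hE, u, v, w, h⟩ := h
  rw [injective_iff_map_eq_zero]
  intro x hx
  have h1 : ∀ y, a x * a y + (L x y - L y x) = 0 := fun y => by
    rw [← contactBilin_apply, hx]; rfl
  have h2 : a x = 0 := by
    have := h1 x
    simpa using this
  refine eq_zero_of_volume_contraction a L hE h fun y z => ?_
  have h3 := h1 y
  have h4 := h1 z
  rw [h2] at h3 h4 ⊢
  have h5 : L z x = L x z := by linarith
  have h6 : L y x = L x y := by linarith
  rw [h5, h6]; ring

theorem exists_contactBilin_equiv {a : E →L[ℝ] ℝ} {L : E →L[ℝ] E →L[ℝ] ℝ}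
    (h : IsContactPair a L) :
    ∃ e : E ≃L[ℝ] (E →L[ℝ] ℝ), (e : E →L[ℝ] E →L[ℝ] ℝ) = contactBilin a L := by
  have : FiniteDimensional ℝ E := h.finiteDimensional
  have hfin : Module.finrank ℝ E = Module.finrank ℝ (E →L[ℝ] ℝ) := by
    rw [(LinearMap.toContinuousLinearMap (𝕜 := ℝ) (E := E) (F' := ℝ)).symm.finrank_eq]
    exact (Subspace.dual_finrank_eq (K := ℝ) (V := E)).symm
  refine ⟨(LinearMap.linearEquivOfInjective (contactBilin a L : E →ₗ[ℝ] E →L[ℝ] ℝ)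
    (contactBilin_injective h) hfin).toContinuousLinearEquiv, ?_⟩
  ext; rfl

/-- The vector on which `a` takes the value `1` and which is in the kernel of `da`. -/
def linearReeb (a : E →L[ℝ] ℝ) (L : E →L[ℝ] E →L[ℝ] ℝ) : E :=
  (contactBilin a L).inverse a

/-- The contact Hamiltonian vector with value `r` and differential `l` of the Hamiltonian. -/
def linearContactField (a : E →L[ℝ] ℝ) (L : E →L[ℝ] E →L[ℝ] ℝ) (r : ℝ) (l : E →L[ℝ] ℝ) : E :=
  (contactBilin a L).inverse ((r + l (linearReeb a L)) • a - l)


theorem contactBilin_inverse {a : E →L[ℝ] ℝ} {L : E →L[ℝ] E →L[ℝ] ℝ} (h : IsContactPair a L)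
    (l : E →L[ℝ] ℝ) :
    contactBilin a L ((contactBilin a L).inverse l) = l := by
  obtain ⟨e, he⟩ := exists_contactBilin_equiv h
  rw [← he, ContinuousLinearMap.inverse_equiv]
  exact e.apply_symm_apply l

/-- The defining equation is a(r) a + ι_r da = a; evaluated at r it gives a(r)² = a(r). If a(r) were
0, then ι_r da = a and r would contract a ∧ da to zero, so r = 0 and a = 0, which is excluded. Hence
a(r) = 1 and ι_r da = 0. -/
theorem linearReeb_spec {a : E →L[ℝ] ℝ} {L : E →L[ℝ] E →L[ℝ] ℝ} (h : IsContactPair a L) :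
    a (linearReeb a L) = 1 ∧
    ∀ y, L (linearReeb a L) y - L y (linearReeb a L) = 0 := by
  obtain ⟨hE, u, v, w, h'⟩ := id h
  have h1 : ∀ y, a (linearReeb a L) * a y + (L (linearReeb a L) y - L y (linearReeb a L)) = a y :=
    fun y => by
      rw [← contactBilin_apply, linearReeb, contactBilin_inverse h]
  generalize linearReeb a L = r at *
  have h2 := h1 r
  rw [sub_self, add_zero] at h2
  have h3 : a r ≠ 0 := by
    intro h0
    have h4 : r = 0 := by
      refine eq_zero_of_volume_contraction a L hE h' fun y z => ?_
      have h5 := h1 y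
      have h6 := h1 z
      rw [h0, zero_mul, zero_add] at h5 h6
      rw [h0, h5, show L z r - L r z = -a z by linarith]; ring
    have h7 : ∀ y, a y = 0 := fun y => by
      have := h1 y
      rw [h4] at this
      simpa using this.symm
    apply h'
    rw [h7, h7, h7]; ring
  have h4 : a r = 1 := mul_right_cancel₀ h3 (h2.trans (one_mul _).symm)
  refine ⟨h4, fun y => ?_⟩
  have := h1 y
  rw [h4] at this
  linarith

theorem linearContactField_spec {a : E →L[ℝ] ℝ} {L : E →L[ℝ] E →L[ℝ] ℝ} (h : IsContactPair a L)
    (r : ℝ) (l : E →L[ℝ] ℝ) :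
    a (linearContactField a L r l) = r ∧ ∀ y, L (linearContactField a L r l) y -
      L y (linearContactField a L r l) = l (linearReeb a L) * a y - l y := by
  have h1 : ∀ y, a (linearContactField a L r l) * a y + (L (linearContactField a L r l) y -
      L y (linearContactField a L r l)) = (r + l (linearReeb a L)) * a y - l y := fun y => by
    rw [← contactBilin_apply, linearContactField, contactBilin_inverse h]
    rfl
  obtain ⟨hr1, hr2⟩ := linearReeb_spec h
  generalize linearContactField a L r l = x at *
  have h2 := h1 (linearReeb a L)
  have h3 := hr2 x
  rw [hr1] at h2
  have h4 : a x = r := by linarith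
  refine ⟨h4, fun y => ?_⟩
  have := h1 y
  rw [h4] at this
  linarith

/-- The factor c is not a free datum: evaluation at the Reeb vector forces c = l(R). Nondegeneracy
of the bilinear form then determines x. -/
theorem eq_linearContactField {a : E →L[ℝ] ℝ} {L : E →L[ℝ] E →L[ℝ] ℝ} (h : IsContactPair a L)
    {x : E} {l : E →L[ℝ] ℝ}
    {c : ℝ} (hx : ∀ y, L x y - L y x = c * a y - l y) :
    x = linearContactField a L (a x) l := by
  obtain ⟨hr1, hr2⟩ := linearReeb_spec h
  obtain ⟨h1, h2⟩ := linearContactField_spec h (a x) l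
  have hc : c = l (linearReeb a L) := by
    have h3 := hx (linearReeb a L)
    have h4 := hr2 x
    rw [hr1] at h3
    linarith
  apply contactBilin_injective h
  ext y
  rw [contactBilin_apply, contactBilin_apply, h1, h2, hx, hc]

/-- Naturality of the bilinear form under a linear isomorphism. -/
theorem linearContactField_map {E' : Type*} [NormedAddCommGroup E'] [NormedSpace ℝ E']
    {a : E →L[ℝ] ℝ} {L : E →L[ℝ] E →L[ℝ] ℝ} {a' : E' →L[ℝ] ℝ} {L' : E' →L[ℝ] E' →L[ℝ] ℝ}
    (hE' : Module.finrank ℝ E' = 3) (h : IsContactPair a L)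
    (T : E →L[ℝ] E') (hT : Function.Surjective T) (ha : ∀ v, a v = a' (T v))
    (hL : ∀ v w, L v w - L w v = L' (T v) (T w) - L' (T w) (T v)) (r : ℝ)
    {l : E →L[ℝ] ℝ} {l' : E' →L[ℝ] ℝ} (hl : ∀ v, l v = l' (T v)) :
    T (linearContactField a L r l) = linearContactField a' L' r l' := by
  have h' := h.map hE' T ha hL
  obtain ⟨h1, h2⟩ := linearContactField_spec h r l
  have h3 := eq_linearContactField h' (x := T (linearContactField a L r l)) (l := l')
    (c := l (linearReeb a L)) (fun y => by
      obtain ⟨y, rfl⟩ := hT y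
      rw [← hL, ← ha, ← hl, h2])
  rwa [← ha, h1] at h3

/-- Defining these vectors by operator inversion pays off here: inversion is smooth at an invertible
operator. -/
theorem contDiffAt_linearContactField {Q : Type*} [NormedAddCommGroup Q] [NormedSpace ℝ Q]
    {a : Q → E →L[ℝ] ℝ} {L : Q → E →L[ℝ] E →L[ℝ] ℝ} {r : Q → ℝ} {l : Q → E →L[ℝ] ℝ} {q : Q}
    (h : IsContactPair (a q) (L q))
    (ha : ContDiffAt ℝ ∞ a q) (hL : ContDiffAt ℝ ∞ L q) (hr : ContDiffAt ℝ ∞ r q)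
    (hl : ContDiffAt ℝ ∞ l q) :
    ContDiffAt ℝ ∞ (fun q => linearContactField (a q) (L q) (r q) (l q)) q := by
  have : FiniteDimensional ℝ E := h.finiteDimensional
  have : CompleteSpace E := FiniteDimensional.complete ℝ E
  obtain ⟨e, he⟩ := exists_contactBilin_equiv h
  have hB : ContDiffAt ℝ ∞ (fun q => contactBilin (a q) (L q)) q := by
    have hflip : ContDiff ℝ ∞ (fun B : E →L[ℝ] E →L[ℝ] ℝ => B.flip) :=
      IsBoundedLinearMap.contDiff ⟨⟨fun _ _ => rfl, fun _ _ => rfl⟩, 1, one_pos, fun B => by simp⟩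
    unfold contactBilin
    refine ContDiffAt.add (ha.smulRight ha) (hL.sub ?_)
    exact ContDiffAt.comp q hflip.contDiffAt hL
  have hinv : ContDiffAt ℝ ∞ (fun q => (contactBilin (a q) (L q)).inverse) q := by
    refine ContDiffAt.comp (g := ContinuousLinearMap.inverse) q ?_ hB
    rw [← he]
    exact contDiffAt_map_inverse e
  have hreeb : ContDiffAt ℝ ∞ (fun q => linearReeb (a q) (L q)) q := hinv.clm_apply ha
  exact hinv.clm_apply (((hr.add (hl.clm_apply hreeb)).smul ha).sub hl)

end LinearContact

/-! ### Smoothness on products of vector spaces -/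

section ProductModel

variable {E F G : Type*} [NormedAddCommGroup E] [NormedSpace ℝ E] [NormedAddCommGroup F]
  [NormedSpace ℝ F] [NormedAddCommGroup G] [NormedSpace ℝ G] {H : Type*} [TopologicalSpace H]
  {I : ModelWithCorners ℝ G H} {N : Type*} [TopologicalSpace N] [ChartedSpace H N]

theorem contMDiffAt_prod_self_iff {f : E × F → N} {z : E × F} :
    ContMDiffAt (𝓘(ℝ, E).prod 𝓘(ℝ, F)) I ∞ f z ↔ ContMDiffAt 𝓘(ℝ, E × F) I ∞ f z := by
  rw [modelWithCornersSelf_prod, ← chartedSpaceSelf_prod]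

theorem contMDiffAt_prod_self_iff_contDiffAt {f : E × F → G} {z : E × F} :
    ContMDiffAt (𝓘(ℝ, E).prod 𝓘(ℝ, F)) 𝓘(ℝ, G) ∞ f z ↔ ContDiffAt ℝ ∞ f z :=
  contMDiffAt_prod_self_iff.trans contMDiffAt_iff_contDiffAt

end ProductModel

/-! ### Reeb and contact Hamiltonian vector fields -/

section ContactField

variable {M : Type*} [TopologicalSpace M] [ChartedSpace (EuclideanSpace ℝ (Fin 3)) M]
  [IsManifold (𝓡 3) ∞ M] {α : OneForm (𝓡 3) M}
  {P : Type*} [NormedAddCommGroup P] [NormedSpace ℝ P]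

theorem chartDeriv_surjective {x₀ x : M} (hx : x ∈ (chartAt (EuclideanSpace ℝ (Fin 3)) x₀).source) :
    Function.Surjective (chartDeriv (𝓡 3) x₀ x) := by
  intro y
  have hx' : x ∈ (extChartAt (𝓡 3) x₀).source := by rwa [extChartAt_source]
  have h1 := mfderiv_extChartAt_mfderiv_symm (I := 𝓡 3) ((extChartAt (𝓡 3) x₀).map_source hx') y
  rw [(extChartAt (𝓡 3) x₀).left_inv hx'] at h1
  exact ⟨_, h1⟩

theorem OneForm.IsContact.isContactPair (hα : α.IsContact) (x : M) :
    IsContactPair (E := EuclideanSpace ℝ (Fin 3)) (α x)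
      (fderiv ℝ (α.inChart x) (extChartAt (𝓡 3) x x)) :=
  ⟨by simp, hα.2 x⟩

theorem OneForm.IsContact.isContactPair_chart (hα : α.IsContact) {x₀ x : M}
    (hx : x ∈ (chartAt (EuclideanSpace ℝ (Fin 3)) x₀).source) :
    IsContactPair (α.inChart x₀ (extChartAt (𝓡 3) x₀ x))
      (fderiv ℝ (α.inChart x₀) (extChartAt (𝓡 3) x₀ x)) :=
  (hα.isContactPair x).map (by simp) (chartDeriv (𝓡 3) x₀ x) (α.apply_eq_inChart hx)
    (hα.1.d_eq_inChart hx)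

/-- The contact vector field with Hamiltonian `h`. -/
def contactField (α : OneForm (𝓡 3) M) (h : M → ℝ) (x : M) : TangentSpace (𝓡 3) x :=
  linearContactField (E := EuclideanSpace ℝ (Fin 3)) (α x)
    (fderiv ℝ (α.inChart x) (extChartAt (𝓡 3) x x)) (h x) (mfderiv (𝓡 3) 𝓘(ℝ, ℝ) h x)

/-- The Reeb vector field. -/
def reebField (α : OneForm (𝓡 3) M) (x : M) : TangentSpace (𝓡 3) x :=
  linearReeb (E := EuclideanSpace ℝ (Fin 3)) (α x)
    (fderiv ℝ (α.inChart x) (extChartAt (𝓡 3) x x))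

theorem OneForm.IsContact.reebField_spec (hα : α.IsContact) (x : M) :
    α x (reebField α x) = 1 ∧ ∀ w, α.d x (reebField α x) w = 0 :=
  linearReeb_spec (hα.isContactPair x)

/-- The differential of a function on `M`. -/
def differential (h : M → ℝ) (x : M) : TangentSpace (𝓡 3) x →L[ℝ] ℝ :=
  mfderiv (𝓡 3) 𝓘(ℝ, ℝ) h x

theorem OneForm.IsContact.contactField_spec (hα : α.IsContact) (h : M → ℝ) (x : M) :
    α x (contactField α h x) = h x ∧ ∀ w, α.d x (contactField α h x) w =
      differential h x (reebField α x) * α x w - differential h x w :=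
  linearContactField_spec (hα.isContactPair x) (h x) (differential h x)

theorem OneForm.IsContact.eq_contactField (hα : α.IsContact) {h : M → ℝ} {x : M}
    {v : TangentSpace (𝓡 3) x} (hv : α x v = h x) {c : ℝ}
    (hdv : ∀ w, α.d x v w = c * α x w - differential h x w) :
    v = contactField α h x := by
  have := eq_linearContactField (hα.isContactPair x) (x := v) (l := differential h x) (c := c) hdv
  exact this.trans (congrArg (fun r => linearContactField (E := EuclideanSpace ℝ (Fin 3)) (α x)
    (fderiv ℝ (α.inChart x) (extChartAt (𝓡 3) x x)) r (differential h x)) hv)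

theorem differential_eq_chart {h : M → ℝ} {x₀ x : M}
    (hx : x ∈ (chartAt (EuclideanSpace ℝ (Fin 3)) x₀).source)
    (hh : MDifferentiableAt (𝓡 3) 𝓘(ℝ, ℝ) h x) (v : TangentSpace (𝓡 3) x) :
    differential h x v = fderiv ℝ (fun y => h ((extChartAt (𝓡 3) x₀).symm y))
      (extChartAt (𝓡 3) x₀ x) (chartDeriv (𝓡 3) x₀ x v) := by
  have hx' : x ∈ (extChartAt (𝓡 3) x₀).source := by rwa [extChartAt_source]
  have hT := (extChartAt (𝓡 3) x₀).map_source hx'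
  have h1 := (mdifferentiableAt_extChartAt_symm hT).hasMFDerivAt
  have h2 : HasMFDerivAt (𝓡 3) 𝓘(ℝ, ℝ) h ((extChartAt (𝓡 3) x₀).symm (extChartAt (𝓡 3) x₀ x))
      (mfderiv (𝓡 3) 𝓘(ℝ, ℝ) h x) := by
    rw [(extChartAt (𝓡 3) x₀).left_inv hx']; exact hh.hasMFDerivAt
  have h3 : HasFDerivAt (fun y => h ((extChartAt (𝓡 3) x₀).symm y))
    (show EuclideanSpace ℝ (Fin 3) →L[ℝ] ℝ from (differential h x : EuclideanSpace ℝ (Fin 3) →L[ℝ] ℝ).comp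
      (chartSymmDeriv (𝓡 3) x₀ (extChartAt (𝓡 3) x₀ x) :)) (extChartAt (𝓡 3) x₀ x) :=
    hasMFDerivAt_iff_hasFDerivAt.1 (h2.comp (extChartAt (𝓡 3) x₀ x) h1)
  rw [h3.fderiv]
  have h4 := mfderiv_symm_mfderiv_extChartAt hx v
  exact congrArg (differential h x : EuclideanSpace ℝ (Fin 3) →L[ℝ] ℝ) h4.symm

theorem OneForm.IsContact.chartDeriv_contactField (hα : α.IsContact) {h : M → ℝ} {x₀ x : M}
    (hx : x ∈ (chartAt (EuclideanSpace ℝ (Fin 3)) x₀).source)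
    (hh : MDifferentiableAt (𝓡 3) 𝓘(ℝ, ℝ) h x) :
    chartDeriv (𝓡 3) x₀ x (contactField α h x) =
      linearContactField (α.inChart x₀ (extChartAt (𝓡 3) x₀ x))
        (fderiv ℝ (α.inChart x₀) (extChartAt (𝓡 3) x₀ x)) (h x)
        (fderiv ℝ (fun y => h ((extChartAt (𝓡 3) x₀).symm y)) (extChartAt (𝓡 3) x₀ x)) :=
  linearContactField_map (by simp) (hα.isContactPair x) (chartDeriv (𝓡 3) x₀ x)
    (chartDeriv_surjective hx) (α.apply_eq_inChart hx) (hα.1.d_eq_inChart hx) (h x)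
    (differential_eq_chart hx hh)

/-- Contact vector fields depend smoothly on parameters. -/
theorem OneForm.IsContact.contMDiff_contactField (hα : α.IsContact) {h : P × M → ℝ}
    (hh : ContMDiff (𝓘(ℝ, P).prod (𝓡 3)) 𝓘(ℝ, ℝ) ∞ h) :
    ContMDiff (𝓘(ℝ, P).prod (𝓡 3)) (𝓡 3).tangent ∞ (fun q : P × M =>
      (⟨q.2, contactField α (fun x => h (q.1, x)) q.2⟩ : TangentBundle (𝓡 3) M)) := by
  rintro ⟨p₀, x₀⟩
  have hx₀ : x₀ ∈ (chartAt (EuclideanSpace ℝ (Fin 3)) x₀).source := mem_chart_source _ x₀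
  rw [contMDiffAt_tangentBundle_iff (x₀ := x₀) hx₀]
  refine ⟨contMDiffAt_snd, ?_⟩
  let e := extChartAt (𝓡 3) x₀
  let k : P × EuclideanSpace ℝ (Fin 3) → ℝ := fun z => h (z.1, e.symm z.2)
  let F : P × EuclideanSpace ℝ (Fin 3) → EuclideanSpace ℝ (Fin 3) := fun z =>
    linearContactField (α.inChart x₀ z.2) (fderiv ℝ (α.inChart x₀) z.2) (k z)
      (fderiv ℝ (fun y => k (z.1, y)) z.2)
  have hT : e x₀ ∈ e.target := mem_extChartAt_target x₀
  have hk : ContDiffAt ℝ ∞ k (p₀, e x₀) := by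
    rw [← contMDiffAt_prod_self_iff_contDiffAt]
    have h1 : ContMDiffAt (𝓘(ℝ, P).prod 𝓘(ℝ, EuclideanSpace ℝ (Fin 3))) (𝓡 3) ∞
        (fun z : P × EuclideanSpace ℝ (Fin 3) => e.symm z.2) (p₀, e x₀) :=
      ContMDiffAt.comp (p₀, e x₀) (contMDiffAt_extChartAt_symm hT) contMDiffAt_snd
    exact (hh (p₀, e.symm (e x₀))).comp (p₀, e x₀) (contMDiffAt_fst.prodMk h1)
  have ha : ContDiffAt ℝ ∞ (α.inChart x₀) (e x₀) := hα.1.contDiffAt_inChart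
  have hF : ContDiffAt ℝ ∞ F (p₀, e x₀) := by
    refine contDiffAt_linearContactField (hα.isContactPair_chart hx₀) ?_ ?_ hk ?_
    · exact ContDiffAt.comp (p₀, e x₀) ha contDiffAt_snd
    · exact ContDiffAt.comp (g := fderiv ℝ (α.inChart x₀)) (p₀, e x₀)
        (ha.fderiv_right (m := ∞) (by simp)) contDiffAt_snd
    · refine ContDiffAt.fderiv (m := ∞) (n := ∞) (g := fun z => z.2)
        (f := fun (z : P × EuclideanSpace ℝ (Fin 3)) y => k (z.1, y)) ?_ contDiffAt_snd (by simp)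
      have h1 : ContDiffAt ℝ ∞ (fun z : (P × EuclideanSpace ℝ (Fin 3)) ×
          EuclideanSpace ℝ (Fin 3) => (z.1.1, z.2)) ((p₀, e x₀), e x₀) :=
        (contDiff_fst.fst.prodMk contDiff_snd).contDiffAt
      exact ContDiffAt.comp (g := k) ((p₀, e x₀), e x₀) hk h1
  have hF' : ContMDiffAt (𝓘(ℝ, P).prod 𝓘(ℝ, EuclideanSpace ℝ (Fin 3)))
      𝓘(ℝ, EuclideanSpace ℝ (Fin 3)) ∞ F (p₀, e x₀) :=
    contMDiffAt_prod_self_iff_contDiffAt.2 hF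
  have h1 : ContMDiffAt (𝓘(ℝ, P).prod (𝓡 3)) (𝓘(ℝ, P).prod 𝓘(ℝ, EuclideanSpace ℝ (Fin 3))) ∞
      (fun q : P × M => (q.1, e q.2)) (p₀, x₀) :=
    contMDiffAt_fst.prodMk (ContMDiffAt.comp (p₀, x₀) (contMDiffAt_extChartAt' hx₀) contMDiffAt_snd)
  refine (ContMDiffAt.comp (p₀, x₀) hF' h1).congr_of_eventuallyEq ?_
  have h2 : ∀ᶠ q : P × M in 𝓝 (p₀, x₀), q.2 ∈ (chartAt (EuclideanSpace ℝ (Fin 3)) x₀).source :=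
    continuousAt_snd.eventually ((chartAt (EuclideanSpace ℝ (Fin 3)) x₀).open_source.mem_nhds hx₀)
  filter_upwards [h2] with q hq
  have h3 : MDifferentiableAt (𝓡 3) 𝓘(ℝ, ℝ) (fun x => h (q.1, x)) q.2 :=
    ((hh (q.1, q.2)).comp q.2 (contMDiffAt_const.prodMk contMDiffAt_id)).mdifferentiableAt (by simp)
  rw [hα.chartDeriv_contactField hq h3]
  have hq' : q.2 ∈ e.source := by rwa [extChartAt_source]
  simp only [F, k, Function.comp_apply, e.left_inv hq']
  rfl

end ContactField

/-! ### Smoothness of differentials paired with vector fields -/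

section SmoothPairings

variable {M : Type*} [TopologicalSpace M] [ChartedSpace (EuclideanSpace ℝ (Fin 3)) M]
  [IsManifold (𝓡 3) ∞ M] {α : OneForm (𝓡 3) M}
  {P : Type*} [NormedAddCommGroup P] [NormedSpace ℝ P]
  {E' : Type*} [NormedAddCommGroup E'] [NormedSpace ℝ E'] {H' : Type*} [TopologicalSpace H']
  {J : ModelWithCorners ℝ E' H'} {N : Type*} [TopologicalSpace N] [ChartedSpace H' N]
  {f : N → M} {X Y : ∀ q, TangentSpace (𝓡 3) (f q)} {q₀ : N}

theorem contMDiffAt_differential {h : P × M → ℝ}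
    (hh : ContMDiff (𝓘(ℝ, P).prod (𝓡 3)) 𝓘(ℝ, ℝ) ∞ h) {p : N → P}
    (hp : ContMDiffAt J 𝓘(ℝ, P) ∞ p q₀)
    (hX : ContMDiffAt J (𝓡 3).tangent ∞ (fun q => (⟨f q, X q⟩ : TangentBundle (𝓡 3) M)) q₀) :
    ContMDiffAt J 𝓘(ℝ, ℝ) ∞ (fun q => differential (fun x => h (p q, x)) (f q) (X q)) q₀ := by
  have hx₀ : f q₀ ∈ (chartAt (EuclideanSpace ℝ (Fin 3)) (f q₀)).source := mem_chart_source _ _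
  rw [contMDiffAt_tangentBundle_iff (x₀ := f q₀) hx₀] at hX
  obtain ⟨hf, hX⟩ := hX
  let e := extChartAt (𝓡 3) (f q₀)
  let k : P × EuclideanSpace ℝ (Fin 3) → ℝ := fun z => h (z.1, e.symm z.2)
  have hT : e (f q₀) ∈ e.target := mem_extChartAt_target _
  have hk : ContDiffAt ℝ ∞ k (p q₀, e (f q₀)) := by
    rw [← contMDiffAt_prod_self_iff_contDiffAt]
    have h1 : ContMDiffAt (𝓘(ℝ, P).prod 𝓘(ℝ, EuclideanSpace ℝ (Fin 3))) (𝓡 3) ∞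
        (fun z : P × EuclideanSpace ℝ (Fin 3) => e.symm z.2) (p q₀, e (f q₀)) :=
      ContMDiffAt.comp (p q₀, e (f q₀)) (contMDiffAt_extChartAt_symm hT) contMDiffAt_snd
    exact (hh (p q₀, e.symm (e (f q₀)))).comp (p q₀, e (f q₀)) (contMDiffAt_fst.prodMk h1)
  have hdk : ContDiffAt ℝ ∞ (fun z : P × EuclideanSpace ℝ (Fin 3) =>
      fderiv ℝ (fun y => k (z.1, y)) z.2) (p q₀, e (f q₀)) := by
    refine ContDiffAt.fderiv (m := ∞) (n := ∞) (g := fun z => z.2)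
      (f := fun (z : P × EuclideanSpace ℝ (Fin 3)) y => k (z.1, y)) ?_ contDiffAt_snd (by simp)
    have h1 : ContDiffAt ℝ ∞ (fun z : (P × EuclideanSpace ℝ (Fin 3)) ×
        EuclideanSpace ℝ (Fin 3) => (z.1.1, z.2)) ((p q₀, e (f q₀)), e (f q₀)) :=
      (contDiff_fst.fst.prodMk contDiff_snd).contDiffAt
    exact ContDiffAt.comp (g := k) ((p q₀, e (f q₀)), e (f q₀)) hk h1
  have h1 : ContMDiffAt J (𝓘(ℝ, P).prod 𝓘(ℝ, EuclideanSpace ℝ (Fin 3))) ∞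
      (fun q => (p q, e (f q))) q₀ :=
    hp.prodMk (ContMDiffAt.comp q₀ (contMDiffAt_extChartAt' hx₀) hf)
  have h2 := (ContMDiffAt.comp q₀ (contMDiffAt_prod_self_iff_contDiffAt.2 hdk) h1).clm_apply hX
  refine h2.congr_of_eventuallyEq ?_
  filter_upwards [hf.continuousAt.eventually
    ((chartAt (EuclideanSpace ℝ (Fin 3)) (f q₀)).open_source.mem_nhds hx₀)] with q hq
  refine differential_eq_chart hq ?_ _
  exact ((hh (p q, f q)).comp (f q) (contMDiffAt_const.prodMk contMDiffAt_id)).mdifferentiableAt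
    (by simp)

end SmoothPairings

/-! ### Flows of contact Hamiltonians are contact isotopies -/

section ContactFlow

variable {M : Type*} [TopologicalSpace M] [ChartedSpace (EuclideanSpace ℝ (Fin 3)) M]
  [IsManifold (𝓡 3) ∞ M] [T2Space M] {α : OneForm (𝓡 3) M}

theorem differential_const (c : ℝ) (x : M) : differential (fun _ : M => c) x = 0 :=
  mfderiv_const

theorem OneForm.d_zero_left (α : OneForm (𝓡 3) M) (x : M) (w : TangentSpace (𝓡 3) x) :
    α.d x 0 w = 0 := by
  let L := fderiv ℝ (α.inChart x) (extChartAt (𝓡 3) x x)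
  let w' : EuclideanSpace ℝ (Fin 3) := w
  change L 0 w' - L w' 0 = 0
  simp

theorem OneForm.IsContact.contactField_of_eventuallyEq_zero (hα : α.IsContact) {h : M → ℝ} {x : M}
    (hh : h =ᶠ[𝓝 x] 0) : contactField α h x = 0 := by
  have h1 : differential h x = 0 := (hh.mfderiv_eq).trans (differential_const 0 x)
  refine (hα.eq_contactField (c := 0) ?_ fun w => ?_).symm
  · rw [map_zero, hh.self_of_nhds]; rfl
  · rw [α.d_zero_left, h1, zero_mul, zero_sub]
    exact neg_zero.symm

theorem OneForm.congr_point (α : OneForm (𝓡 3) M) {x y : M} (h : x = y) :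
    (α x : EuclideanSpace ℝ (Fin 3) →L[ℝ] ℝ) = α y := by
  subst h; rfl

theorem eq_exp_mul_of_hasDerivAt {μ Q : ℝ → ℝ} (hμ : Continuous μ)
    (hQ : ∀ t, HasDerivAt Q (μ t * Q t) t) (t : ℝ) :
    Q t = Real.exp (∫ r in (0 : ℝ)..t, μ r) * Q 0 := by
  have h1 : ∀ t, HasDerivAt (fun t => Real.exp (-∫ r in (0 : ℝ)..t, μ r) * Q t) 0 t := by
    intro t
    have h2 : HasDerivAt (fun t => ∫ r in (0 : ℝ)..t, μ r) (μ t) t :=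
      hμ.integral_hasStrictDerivAt 0 t |>.hasDerivAt
    have h3 := (h2.fun_neg.exp).fun_mul (hQ t)
    exact h3.congr_deriv (by ring)
  have h2 := is_const_of_deriv_eq_zero (fun s => (h1 s).differentiableAt)
    (fun s => (h1 s).deriv) t 0
  simp only [intervalIntegral.integral_same, neg_zero, Real.exp_zero, one_mul] at h2
  rw [← h2, ← mul_assoc, ← Real.exp_add, add_neg_cancel, Real.exp_zero, one_mul]

/-- The flow of a time-dependent contact vector field rescales the contact form. -/
theorem OneForm.IsContact.isContactAt_of_flow (hα : α.IsContact) {h : ℝ × M → ℝ}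
    (hh : ContMDiff (𝓘(ℝ, ℝ).prod (𝓡 3)) 𝓘(ℝ, ℝ) ∞ h) {φ : ℝ → M → M}
    (hφ : ContMDiff (𝓘(ℝ, ℝ).prod (𝓡 3)) (𝓡 3) ∞ (fun q : ℝ × M => φ q.1 q.2))
    (hφ0 : ∀ x, φ 0 x = x)
    (hφ' : ∀ x s, HasMFDerivAt 𝓘(ℝ, ℝ) (𝓡 3) (fun r => φ r x) s
      ((1 : ℝ →L[ℝ] ℝ).smulRight (contactField α (fun y => h (s, y)) (φ s x))))
    (t : ℝ) (x : M) : IsContactAt α α (φ t) x := by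
  let E := EuclideanSpace ℝ (Fin 3)
  let e := extChartAt (𝓡 3) x
  let G : ℝ × E → M := fun z => φ z.1 (e.symm z.2)
  have hex : e.symm (e x) = x := extChartAt_to_inv x
  have hT : IsOpen e.target := isOpen_extChartAt_target x
  have hxT : e x ∈ e.target := mem_extChartAt_target x
  have hG : ∀ s : ℝ, ∀ y ∈ e.target, ContMDiffAt 𝓘(ℝ, ℝ × E) (𝓡 3) ∞ G (s, y) := by
    intro s y hy
    rw [← contMDiffAt_prod_self_iff]
    have h1 : ContMDiffAt (𝓘(ℝ, ℝ).prod 𝓘(ℝ, E)) (𝓡 3) ∞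
        (fun z : ℝ × E => e.symm z.2) (s, y) :=
      ContMDiffAt.comp (s, y) (contMDiffAt_extChartAt_symm hy) contMDiffAt_snd
    exact (hφ (s, e.symm y)).comp (s, y) (contMDiffAt_fst.prodMk h1)
  -- On ℝ × E the Lie derivative becomes an ordinary one. Here A(∂_s) = h ∘ G, and dA(∂_s, w) is dα
  -- of the contact field against dG(w), so ∂_s (A(w)) = dA(∂_s, w) + ∂_w (A(∂_s)) = dh(R) A(w) for
  -- w in the space directions. This is a linear equation whose rate μ = dh(R) does not depend on w.
  let A := α.pullback G
  have hA : ∀ s : ℝ, ∀ y ∈ e.target, DifferentiableAt ℝ A (s, y) := fun s y hy =>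
    (hα.1.contDiffAt_pullback (hG s y hy)).differentiableAt (by simp)
  have hGt : ∀ s : ℝ, ∀ y ∈ e.target, mfderiv 𝓘(ℝ, ℝ × E) (𝓡 3) G (s, y) ((1, 0) : ℝ × E) =
      contactField α (fun y => h (s, y)) (G (s, y)) := by
    intro s y hy
    have h1 : HasMFDerivAt 𝓘(ℝ, ℝ) 𝓘(ℝ, ℝ × E) (fun r : ℝ => (r, y)) s
        (ContinuousLinearMap.inl ℝ ℝ E) := by
      refine HasFDerivAt.hasMFDerivAt ?_
      exact hasFDerivAt_prodMk_left s y
    have h2 := ((hG s y hy).mdifferentiableAt (by simp)).hasMFDerivAt.comp s h1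
    have h3 := hasMFDerivAt_unique h2 (hφ' (e.symm y) s)
    refine (congrArg (fun L : ℝ →L[ℝ] E => L (1 : ℝ)) h3).trans ?_
    exact one_smul ℝ (_ : E)
  have hGy : ∀ s : ℝ, HasMFDerivAt 𝓘(ℝ, E) (𝓡 3) (fun y => G (s, y)) (e x)
      ((mfderiv 𝓘(ℝ, ℝ × E) (𝓡 3) G (s, e x)).comp (ContinuousLinearMap.inr ℝ ℝ E)) := by
    intro s
    have h1 : HasMFDerivAt 𝓘(ℝ, E) 𝓘(ℝ, ℝ × E) (fun y : E => (s, y)) (e x)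
        (ContinuousLinearMap.inr ℝ ℝ E) := by
      refine HasFDerivAt.hasMFDerivAt ?_
      exact hasFDerivAt_prodMk_right s (e x)
    exact ((hG s _ hxT).mdifferentiableAt (by simp)).hasMFDerivAt.comp (e x) h1
  let μ : ℝ → ℝ := fun s => differential (fun y => h (s, y)) (φ s x) (reebField α (φ s x))
  have hμ : Continuous μ := by
    have h1 : ContMDiff 𝓘(ℝ, ℝ) (𝓡 3) ∞ (fun s => φ s x) :=
      hφ.comp (contMDiff_id.prodMk contMDiff_const)
    have h2 : ContMDiff 𝓘(ℝ, ℝ) (𝓡 3).tangent ∞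
        (fun s => (⟨φ s x, reebField α (φ s x)⟩ : TangentBundle (𝓡 3) M)) := by
      have h3 := (hα.contMDiff_contactField (P := ℝ) (h := fun _ => 1) contMDiff_const).comp
        ((contMDiff_const (c := (0 : ℝ))).prodMk h1)
      convert h3 using 2 with s
      refine congrArg (fun v => (⟨φ s x, v⟩ : TangentBundle (𝓡 3) M)) ?_
      refine hα.eq_contactField (c := 0) (hα.reebField_spec _).1 fun w => ?_
      rw [(hα.reebField_spec _).2, differential_const, zero_mul, zero_sub]
      exact neg_zero.symm
    have h3 : ContMDiff 𝓘(ℝ, ℝ) 𝓘(ℝ, ℝ) ∞ μ := fun s =>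
      contMDiffAt_differential hh (p := fun s => s) contMDiffAt_id (h2 s)
    exact h3.continuous
  have hQ : ∀ (w : E) (s : ℝ), HasDerivAt (fun s => A (s, e x) ((0, w) : ℝ × E))
      (μ s * A (s, e x) ((0, w) : ℝ × E)) s := by
    intro w s
    have h1 : HasDerivAt (fun s => A (s, e x) ((0, w) : ℝ × E))
        (fderiv ℝ A (s, e x) ((1, 0) : ℝ × E) ((0, w) : ℝ × E)) s := by
      have h2 := (hA s _ hxT).hasFDerivAt.comp_hasDerivAt s
        ((hasDerivAt_id s).prodMk (hasDerivAt_const s (e x)))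
      exact h2.clm_apply (hasDerivAt_const s ((0, w) : ℝ × E)) |>.congr_deriv (by simp)
    have h2 := hα.1.fderiv_pullback (hG s _ hxT) ((1, 0) : ℝ × E) ((0, w) : ℝ × E)
    rw [hGt s _ hxT] at h2
    have h3 : fderiv ℝ A (s, e x) ((0, w) : ℝ × E) ((1, 0) : ℝ × E) =
        differential (fun y => h (s, y)) (G (s, e x))
          (mfderiv 𝓘(ℝ, ℝ × E) (𝓡 3) G (s, e x) ((0, w) : ℝ × E)) := by
      have h5 : HasFDerivAt (fun y => A (s, y) ((1, 0) : ℝ × E))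
          (((fderiv ℝ A (s, e x)).comp (ContinuousLinearMap.inr ℝ ℝ E)).flip ((1, 0) : ℝ × E))
          (e x) := by
        have h6 := (hA s _ hxT).hasFDerivAt.comp (e x) (hasFDerivAt_prodMk_right s (e x))
        exact (h6.clm_apply (hasFDerivAt_const ((1, 0) : ℝ × E) (e x))).congr_fderiv (by
          ext y; simp; rfl)
      have h6 : MDifferentiableAt (𝓡 3) 𝓘(ℝ, ℝ) (fun y => h (s, y)) (G (s, e x)) :=
        ((hh (s, G (s, e x))).comp (G (s, e x))
          (contMDiffAt_const.prodMk contMDiffAt_id)).mdifferentiableAt (by simp)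
      have h7 := h6.hasMFDerivAt.comp (e x) (hGy s)
      have h8 : HasFDerivAt (fun y => A (s, y) ((1, 0) : ℝ × E)) (show E →L[ℝ] ℝ from
          ((differential (fun y => h (s, y)) (G (s, e x)) : E →L[ℝ] ℝ).comp
          (show E →L[ℝ] E from (mfderiv 𝓘(ℝ, ℝ × E) (𝓡 3) G (s, e x)).comp
          (ContinuousLinearMap.inr ℝ ℝ E)))) (e x) := by
        refine (hasMFDerivAt_iff_hasFDerivAt.1 h7).congr_of_eventuallyEq ?_
        filter_upwards [hT.mem_nhds hxT] with y hy
        refine (congrArg (α (G (s, y))) (hGt s y hy)).trans ?_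
        exact (hα.contactField_spec (fun y => h (s, y)) (G (s, y))).1
      exact congrArg (fun L : E →L[ℝ] ℝ => L w) (h5.unique h8)
    refine h1.congr_deriv ?_
    have h4 := (hα.contactField_spec (fun y => h (s, y)) (G (s, e x))).2
      (mfderiv 𝓘(ℝ, ℝ × E) (𝓡 3) G (s, e x) ((0, w) : ℝ × E))
    have h5 : fderiv ℝ A (s, e x) ((1, 0) : ℝ × E) ((0, w) : ℝ × E) - 
      fderiv ℝ A (s, e x) ((0, w) : ℝ × E) ((1, 0) : ℝ × E) = _ := h2.trans h4
    rw [← h3] at h5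
    have h6 : ∀ z, z = φ s x → differential (fun y => h (s, y)) z (reebField α z) = μ s := by
      rintro z rfl; rfl
    rw [h6 (G (s, e x)) (by simp only [G, hex])] at h5
    exact sub_left_inj.1 h5
  refine ⟨Real.exp (∫ r in (0 : ℝ)..t, μ r), Real.exp_pos _, fun v => ?_⟩
  have h1 := eq_exp_mul_of_hasDerivAt hμ (hQ (chartDeriv (𝓡 3) x x v)) t
  have h2 : ∀ s, A (s, e x) ((0, chartDeriv (𝓡 3) x x v) : ℝ × E) =
      α (φ s x) (mfderiv (𝓡 3) (𝓡 3) (φ s) x v) := by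
    intro s
    have h3 : HasMFDerivAt (𝓡 3) (𝓡 3) (φ s) (e.symm (e x)) (mfderiv (𝓡 3) (𝓡 3) (φ s) x) := by
      rw [hex]
      exact ((hφ.comp (contMDiff_const.prodMk contMDiff_id)).mdifferentiable
        (by simp) x).hasMFDerivAt
    have h4 := h3.comp (e x) (mdifferentiableAt_extChartAt_symm hxT).hasMFDerivAt
    have h5 := hasMFDerivAt_unique (hGy s) h4
    have h6 := congrArg (fun L : E →L[ℝ] E => L (chartDeriv (𝓡 3) x x v)) h5
    have h7 := mfderiv_symm_mfderiv_extChartAt (mem_chart_source (EuclideanSpace ℝ (Fin 3)) x) v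
    have h8 : G (s, e x) = φ s x := by simp only [G, hex]
    refine (congrArg (fun L : E →L[ℝ] ℝ => L _) (α.congr_point h8)).trans ?_
    exact congrArg (α (φ s x) : E →L[ℝ] ℝ) (h6.trans
      (congrArg (mfderiv (𝓡 3) (𝓡 3) (φ s) x : E →L[ℝ] E) h7))
  rw [h2, h2] at h1
  have h3 : φ 0 = id := funext hφ0
  rw [h1, h3, mfderiv_id]
  rfl

/-- A compactly supported time-dependent Hamiltonian generates an ambient contact isotopy. -/
theorem OneForm.IsContact.exists_contactFlow (hα : α.IsContact) {h : ℝ × M → ℝ}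
    (hh : ContMDiff (𝓘(ℝ, ℝ).prod (𝓡 3)) 𝓘(ℝ, ℝ) ∞ h)
    {J : Set ℝ} (hJ : IsCompact J) {C : Set M} (hC : IsCompact C)
    (hhJ : ∀ t x, t ∉ J → h (t, x) = 0) (hhC : ∀ t x, x ∉ C → h (t, x) = 0) :
    ∃ φ : ℝ → (M ≃ₘ⟮𝓡 3, 𝓡 3⟯ M), IsContactIsotopy α φ ∧
      ContMDiff (𝓘(ℝ, ℝ).prod (𝓡 3)) (𝓡 3) ∞ (fun q : ℝ × M => φ q.1 q.2) ∧
      (∀ x s, HasMFDerivAt 𝓘(ℝ, ℝ) (𝓡 3) (fun r => φ r x) s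
        ((1 : ℝ →L[ℝ] ℝ).smulRight (contactField α (fun y => h (s, y)) (φ s x)))) ∧
      (∀ (x : M) (y : ℝ → M) (a b t₀ : ℝ), t₀ ∈ Ioo a b →
        (∀ s ∈ Ioo a b, HasMFDerivAt 𝓘(ℝ, ℝ) (𝓡 3) y s
          ((1 : ℝ →L[ℝ] ℝ).smulRight (contactField α (fun z => h (s, z)) (y s)))) →
        y t₀ = φ t₀ x → ∀ s ∈ Ioo a b, y s = φ s x) := by
  obtain ⟨Φ, hΦ, hΦ0, hΦ', huniq⟩ := exists_parametrizedFlow (1 : ℝ) (X := fun t x =>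
      contactField α (fun y => h (t, y)) x) (hα.contMDiff_contactField hh) hJ hC
    (fun t x ht => hα.contactField_of_eventuallyEq_zero
      (Filter.Eventually.of_forall fun y => hhJ t y ht))
    (fun t x hx => hα.contactField_of_eventuallyEq_zero
      (Filter.mem_of_superset (hC.isClosed.isOpen_compl.mem_nhds hx) fun y hy => hhC t y hy))
  -- Time-dependent flows compose with a shift of the starting time. So the time-t map from time 0
  -- is inverted by flowing for time -t from starting time t.
  have hadd : ∀ s s' p x, Φ s (p + s') (Φ s' p x) = Φ (s + s') p x := by
    intro s s' p x
    refine (huniq (p + s') (Φ s' p x) (fun r => Φ (r + s') p x) (-(|s| + 1)) (|s| + 1) 0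
      ⟨by linarith [abs_nonneg s], by linarith [abs_nonneg s]⟩ ?_ ?_ s
      ⟨by linarith [neg_abs_le s], by linarith [le_abs_self s]⟩).symm
    · intro r _
      have h1 : HasMFDerivAt 𝓘(ℝ, ℝ) 𝓘(ℝ, ℝ) (fun r : ℝ => r + s') r (1 : ℝ →L[ℝ] ℝ) :=
        ((hasFDerivAt_id r).add_const s').hasMFDerivAt
      refine ((hΦ' p x (r + s')).comp r h1).congr_mfderiv ?_
      have h2 : p + s' + r • (1 : ℝ) = p + (r + s') • (1 : ℝ) := by
        simp only [smul_eq_mul, mul_one]; ring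
      rw [h2]
      rfl
    · simp only [zero_add, hΦ0]
  have hsm : ∀ s p, ContMDiff (𝓡 3) (𝓡 3) ∞ (Φ s p) := fun s p =>
    hΦ.comp (contMDiff_const.prodMk (contMDiff_const.prodMk contMDiff_id))
  let φ : ℝ → (M ≃ₘ⟮𝓡 3, 𝓡 3⟯ M) := fun t =>
    { toFun := Φ t 0
      invFun := Φ (-t) t
      left_inv := fun x => by
        have := hadd (-t) t 0 x
        rwa [zero_add, neg_add_cancel, hΦ0] at this
      right_inv := fun x => by
        have := hadd t (-t) t x
        rwa [add_neg_cancel, hΦ0] at this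
      contMDiff_toFun := hsm t 0
      contMDiff_invFun := hsm (-t) t }
  have hφ : ContMDiff (𝓘(ℝ, ℝ).prod (𝓡 3)) (𝓡 3) ∞ (fun q : ℝ × M => φ q.1 q.2) :=
    hΦ.comp (contMDiff_fst.prodMk (contMDiff_const.prodMk contMDiff_snd))
  have hφ' : ∀ x s, HasMFDerivAt 𝓘(ℝ, ℝ) (𝓡 3) (fun r => φ r x) s
      ((1 : ℝ →L[ℝ] ℝ).smulRight (contactField α (fun y => h (s, y)) (φ s x))) := by
    intro x s
    have := hΦ' 0 x s
    rwa [zero_add, smul_eq_mul, mul_one] at this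
  refine ⟨φ, ⟨hφ.contMDiffOn, hΦ0 0, fun t _ x =>
    hα.isContactAt_of_flow hh (φ := fun t => φ t) hφ (hΦ0 0) hφ' t x⟩, hφ, hφ', ?_⟩
  intro x y a b t₀ ht₀ hy
  refine huniq 0 x y a b t₀ ht₀ fun s hs => ?_
  rw [zero_add, smul_eq_mul, mul_one]
  exact hy s hs

end ContactFlow

/-! ### Isotopies on a closed time interval, extended smoothly in charts -/

section ChartExtension

universe u
variable {E₁ F : Type u} [NormedAddCommGroup E₁] [NormedSpace ℝ E₁] [FiniteDimensional ℝ E₁]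
  [NormedAddCommGroup F] [NormedSpace ℝ F] [CompleteSpace F]
  {H₁ : Type*} [TopologicalSpace H₁] {I₁ : ModelWithCorners ℝ E₁ H₁}
  {A : Type*} [TopologicalSpace A] [ChartedSpace H₁ A] [IsManifold I₁ ∞ A]
  {H₂ : Type*} [TopologicalSpace H₂] {J : ModelWithCorners ℝ F H₂}
  {N : Type*} [TopologicalSpace N] [ChartedSpace H₂ N] [IsManifold J ∞ N]

theorem exists_contDiffOn_extension_Icc_of_lt {f : ℝ × E₁ → F} {U : Set E₁} (hU : IsOpen U)
    {c d : ℝ} (hcd : c < d) (hf : ContDiffOn ℝ ∞ f (Icc c d ×ˢ U)) :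
    ∃ g : ℝ × E₁ → F, ContDiffOn ℝ ∞ g (univ ×ˢ U) ∧ ∀ t ∈ Icc c d, ∀ x, g (t, x) = f (t, x) := by
  have : ProperSpace E₁ := FiniteDimensional.proper ℝ E₁
  have hdc : 0 < d - c := sub_pos.2 hcd
  have h1 : ContDiffOn ℝ ∞ (fun z : ℝ × E₁ => f (c + (d - c) * z.1, z.2)) (Icc 0 1 ×ˢ U) := by
    refine hf.comp (g := f) (f := fun z : ℝ × E₁ => (c + (d - c) * z.1, z.2))
      (by fun_prop) fun z hz => ⟨⟨?_, ?_⟩, hz.2⟩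
    · have := mul_nonneg hdc.le hz.1.1
      simp only; linarith
    · have := mul_le_mul_of_nonneg_left hz.1.2 hdc.le
      simp only; linarith
  obtain ⟨g, hg, hgf⟩ := exists_contDiffOn_extension_Icc hU h1
  refine ⟨fun z => g ((z.1 - c) / (d - c), z.2), ?_, fun t ht x => ?_⟩
  · refine hg.comp (g := g) (f := fun z : ℝ × E₁ => ((z.1 - c) / (d - c), z.2))
      (by fun_prop) fun z hz => ⟨mem_univ _, hz.2⟩
  · simp only
    rw [hgf _ ⟨div_nonneg (sub_nonneg.2 ht.1) hdc.le,
      (div_le_one hdc).2 (sub_le_sub_right ht.2 c)⟩, mul_div_cancel₀ _ hdc.ne', add_sub_cancel]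

theorem exists_Icc_subset_of_mem_nhdsWithin {t₀ : ℝ} (ht₀ : t₀ ∈ Icc (0 : ℝ) 1) {S : Set ℝ}
    (hS : S ∈ 𝓝[Icc 0 1] t₀) : ∃ c d, c < d ∧ Icc c d ⊆ S ∧ Icc c d ∈ 𝓝[Icc 0 1] t₀ := by
  obtain ⟨δ, hδ, hS⟩ := Metric.mem_nhdsWithin_iff.1 hS
  have hE : Icc (max 0 (t₀ - δ / 2)) (min 1 (t₀ + δ / 2)) =
      Icc 0 1 ∩ Icc (t₀ - δ / 2) (t₀ + δ / 2) := Icc_inter_Icc.symm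
  refine ⟨max 0 (t₀ - δ / 2), min 1 (t₀ + δ / 2), ?_, ?_, ?_⟩
  · rw [max_lt_iff, lt_min_iff, lt_min_iff]
    exact ⟨⟨one_pos, by linarith [ht₀.1]⟩, by linarith [ht₀.2], by linarith⟩
  · rw [hE]
    refine fun t ht => hS ⟨?_, ht.1⟩
    rw [Metric.mem_ball, Real.dist_eq, abs_lt]
    constructor <;> linarith [ht.2.1, ht.2.2]
  · rw [hE]
    exact Filter.inter_mem self_mem_nhdsWithin
      (mem_nhdsWithin_of_mem_nhds (Icc_mem_nhds (by linarith) (by linarith)))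

theorem extChartAt_target_mem_nhds_of_isInteriorPoint {a : A} (ha : I₁.IsInteriorPoint a) :
    (extChartAt I₁ a).target ∈ 𝓝 (extChartAt I₁ a a) := by
  have h1 := extChartAt_target_mem_nhdsWithin (I := I₁) a
  rwa [nhdsWithin_eq_nhds.2] at h1
  exact mem_interior_iff_mem_nhds.1 ha

theorem contMDiffOn_prod_self_iff_contDiffOn {f : ℝ × E₁ → F} {s : Set (ℝ × E₁)} :
    ContMDiffOn (𝓘(ℝ, ℝ).prod 𝓘(ℝ, E₁)) 𝓘(ℝ, F) ∞ f s ↔ ContDiffOn ℝ ∞ f s := by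
  rw [← contMDiffOn_iff_contDiffOn, modelWithCornersSelf_prod, ← chartedSpaceSelf_prod]

/-- Near an interior point, a family of maps which is smooth in `t ∈ [0, 1]` extends smoothly, in
charts, to a neighbourhood of the time interval. -/
theorem exists_chart_extension {G : ℝ → A → N}
    (hG : ContMDiffOn (𝓘(ℝ, ℝ).prod I₁) J ∞ (fun q : ℝ × A => G q.1 q.2)
      (Icc (0 : ℝ) 1 ×ˢ (univ : Set A))) {t₀ : ℝ} (ht₀ : t₀ ∈ Icc (0 : ℝ) 1) {a₀ : A}
    (ha₀ : I₁.IsInteriorPoint a₀) :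
    ∃ (U : Set (ℝ × E₁)) (g : ℝ × E₁ → F), IsOpen U ∧ (t₀, extChartAt I₁ a₀ a₀) ∈ U ∧
      ContDiffOn ℝ ∞ g U ∧ ∀ z ∈ U, z.2 ∈ interior (extChartAt I₁ a₀).target ∧ (z.1 ∈ Icc (0 : ℝ) 1 →
        G z.1 ((extChartAt I₁ a₀).symm z.2) ∈ (chartAt H₂ (G t₀ a₀)).source ∧
        g z = extChartAt J (G t₀ a₀) (G z.1 ((extChartAt I₁ a₀).symm z.2))) := by
  let e := extChartAt I₁ a₀
  let c := extChartAt J (G t₀ a₀)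
  have hT : e.target ∈ 𝓝 (e a₀) := extChartAt_target_mem_nhds_of_isInteriorPoint ha₀
  let K : ℝ × E₁ → N := fun z => G z.1 (e.symm z.2)
  have hK : ContMDiffOn (𝓘(ℝ, ℝ).prod 𝓘(ℝ, E₁)) J ∞ K (Icc 0 1 ×ˢ e.target) := by
    refine hG.comp (f := fun z : ℝ × E₁ => (z.1, e.symm z.2)) (ContMDiffOn.prodMk contMDiffOn_fst ?_)
      fun z hz => ⟨hz.1, mem_univ _⟩
    exact (contMDiffOn_extChartAt_symm (n := ∞) a₀).comp contMDiffOn_snd fun z hz => hz.2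
  have hK0 : K (t₀, e a₀) = G t₀ a₀ := by simp only [K, e, extChartAt_to_inv]
  have hev : ∀ᶠ z in 𝓝[Icc 0 1] t₀ ×ˢ 𝓝 (e a₀), K z ∈ (chartAt H₂ (G t₀ a₀)).source := by
    have h1 := (hK (t₀, e a₀) ⟨ht₀, mem_of_mem_nhds hT⟩).continuousWithinAt.eventually
      ((chartAt H₂ (G t₀ a₀)).open_source.mem_nhds (by rw [hK0]; exact mem_chart_source _ _))
    rwa [nhdsWithin_prod_eq, nhdsWithin_eq_nhds.2 hT] at h1
  obtain ⟨S, hS, V, hV, hSV⟩ := Filter.mem_prod_iff.1 hev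
  -- The extension needs a nondegenerate closed interval of times in [0, 1] during which the image
  -- stays in a single chart; at an end time it is one-sided.
  obtain ⟨c₁, d₁, hcd, hcdS, hcdn⟩ := exists_Icc_subset_of_mem_nhdsWithin ht₀
    (Filter.inter_mem hS self_mem_nhdsWithin)
  obtain ⟨V', hV'V, hV', haV'⟩ := mem_nhds_iff.1 (Filter.inter_mem hV hT)
  obtain ⟨T, hT', htT, hTc⟩ := mem_nhdsWithin.1 hcdn
  have hf : ContDiffOn ℝ ∞ (fun z => c (K z)) (Icc c₁ d₁ ×ˢ V') := by
    rw [← contMDiffOn_prod_self_iff_contDiffOn]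
    refine (contMDiffOn_extChartAt (n := ∞) (x := G t₀ a₀)).comp
      (hK.mono (prod_mono (fun t ht => (hcdS ht).2) fun v hv => (hV'V hv).2)) ?_
    exact fun z hz => hSV ⟨(hcdS hz.1).1, (hV'V hz.2).1⟩
  obtain ⟨g, hg, hgf⟩ := exists_contDiffOn_extension_Icc_of_lt hV' hcd hf
  refine ⟨T ×ˢ V', g, hT'.prod hV', ⟨htT, haV'⟩, hg.mono (prod_mono (subset_univ _) le_rfl),
    fun z hz => ⟨interior_maximal (fun v hv => (hV'V hv).2) hV' hz.2, fun hz1 => ?_⟩⟩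
  have hz1' := hTc ⟨hz.1, hz1⟩
  exact ⟨hSV ⟨(hcdS hz1').1, (hV'V hz.2).1⟩, hgf _ hz1' _⟩

/-- A linear map of the form `(s, w) ↦ (s, L (s, w))` is invertible if `w ↦ L (0, w)` is injective. -/
theorem exists_equiv_fst_prod {L : ℝ × E₁ →L[ℝ] E₁} (hL : ∀ w, L (0, w) = 0 → w = 0) :
    ∃ e : (ℝ × E₁) ≃L[ℝ] (ℝ × E₁),
      (e : ℝ × E₁ →L[ℝ] ℝ × E₁) = (ContinuousLinearMap.fst ℝ ℝ E₁).prod L := by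
  have hinj : Function.Injective ((ContinuousLinearMap.fst ℝ ℝ E₁).prod L : ℝ × E₁ →ₗ[ℝ] ℝ × E₁) := by
    rw [← LinearMap.ker_eq_bot, LinearMap.ker_eq_bot']
    rintro ⟨s, w⟩ h
    have h1 : s = 0 := congrArg Prod.fst h
    subst h1
    rw [hL w (congrArg Prod.snd h)]
    rfl
  refine ⟨(LinearEquiv.ofInjectiveEndo _ hinj).toContinuousLinearEquiv, ?_⟩
  ext <;> rfl

/-- Near an interior point, the inverses of a smooth path of diffeomorphisms form, in charts, a
smooth family. -/
theorem exists_inverse_family {η : ℝ → (A ≃ₘ⟮I₁, I₁⟯ A)}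
    (hη : ContMDiffOn (𝓘(ℝ, ℝ).prod I₁) I₁ ∞ (fun q : ℝ × A => η q.1 q.2)
      (Icc (0 : ℝ) 1 ×ˢ (univ : Set A))) {t₀ : ℝ} (ht₀ : t₀ ∈ Icc (0 : ℝ) 1) {a₀ : A}
    (ha₀ : I₁.IsInteriorPoint a₀) (hb₀ : I₁.IsInteriorPoint (η t₀ a₀)) :
    ∃ (W : Set (ℝ × E₁)) (k : ℝ × E₁ → E₁), IsOpen W ∧
      (t₀, extChartAt I₁ (η t₀ a₀) (η t₀ a₀)) ∈ W ∧ ContDiffOn ℝ ∞ k W ∧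
      k (t₀, extChartAt I₁ (η t₀ a₀) (η t₀ a₀)) = extChartAt I₁ a₀ a₀ ∧
      ∀ z ∈ W, z.2 ∈ interior (extChartAt I₁ (η t₀ a₀)).target ∧ (z.1 ∈ Icc (0 : ℝ) 1 →
        (η z.1).symm ((extChartAt I₁ (η t₀ a₀)).symm z.2) = (extChartAt I₁ a₀).symm (k z)) := by
  have : CompleteSpace E₁ := FiniteDimensional.complete ℝ E₁
  obtain ⟨U, g, hU, hz₀, hg, hgU⟩ := exists_chart_extension (G := fun t a => η t a) hη ht₀ ha₀
  set b₀ := η t₀ a₀ with hb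
  let e := extChartAt I₁ a₀
  let c := extChartAt I₁ b₀
  have hT : c.target ∈ 𝓝 (c b₀) := extChartAt_target_mem_nhds_of_isInteriorPoint hb₀
  have hgz₀ : g (t₀, e a₀) = c b₀ := by
    rw [((hgU _ hz₀).2 ht₀).2]
    simp only [extChartAt_to_inv, c, hb]
  have hgd : HasFDerivAt g (fderiv ℝ g (t₀, e a₀)) (t₀, e a₀) :=
    ((hg.contDiffAt (hU.mem_nhds hz₀)).differentiableAt (by simp)).hasFDerivAt
  -- The chart expression j of the inverse of η t₀ is a left inverse of g (t₀, ·) near the point, so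
  -- the spatial derivative is injective and the inverse function theorem applies to (t, u) ↦ (t, g
  -- (t, u)).
  have hinj : ∀ w, fderiv ℝ g (t₀, e a₀) (0, w) = 0 → w = 0 := by
    let j : E₁ → E₁ := fun v => e ((η t₀).symm (c.symm v))
    have hj : DifferentiableAt ℝ j (c b₀) := by
      have h1 : ContMDiffAt 𝓘(ℝ, E₁) I₁ ∞ c.symm (c b₀) :=
        (contMDiffOn_extChartAt_symm (n := ∞) b₀).contMDiffAt hT
      have h2 : ContMDiffAt 𝓘(ℝ, E₁) I₁ ∞ (fun v => (η t₀).symm (c.symm v)) (c b₀) :=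
        ((η t₀).symm.contMDiff _).comp (c b₀) h1
      have h3 : (η t₀).symm (c.symm (c b₀)) = a₀ := by
        rw [extChartAt_to_inv, hb]; exact (η t₀).symm_apply_apply a₀
      have h4 : ContMDiffAt 𝓘(ℝ, E₁) 𝓘(ℝ, E₁) ∞ j (c b₀) :=
        ContMDiffAt.comp (c b₀) (contMDiffAt_extChartAt'
          (by rw [h3]; exact mem_chart_source _ _)) h2
      exact (contMDiffAt_iff_contDiffAt.1 h4).differentiableAt (by simp)
    have h1 : HasFDerivAt (fun u => j (g (t₀, u))) ((fderiv ℝ j (c b₀)).comp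
        ((fderiv ℝ g (t₀, e a₀)).comp (ContinuousLinearMap.inr ℝ ℝ E₁))) (e a₀) := by
      have h2 := hgd.comp (e a₀) (hasFDerivAt_prodMk_right t₀ (e a₀))
      rw [← hgz₀] at hj ⊢
      exact hj.hasFDerivAt.comp (e a₀) h2
    have h2 : (fun u => j (g (t₀, u))) =ᶠ[𝓝 (e a₀)] id := by
      have h3 : ∀ᶠ u in 𝓝 (e a₀), (t₀, u) ∈ U :=
        (Continuous.prodMk_right t₀).continuousAt.eventually (hU.mem_nhds hz₀)
      filter_upwards [h3] with u hu
      obtain ⟨h4, h5⟩ := hgU _ hu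
      obtain ⟨h6, h7⟩ := h5 ht₀
      simp only [j, h7, id]
      rw [← extChartAt_source I₁] at h6
      have h8 : c.symm (c (η t₀ (e.symm u))) = η t₀ (e.symm u) := c.left_inv h6
      change e ((η t₀).symm (c.symm (c (η t₀ (e.symm u))))) = u
      rw [h8, (η t₀).symm_apply_apply]
      exact e.right_inv (interior_subset h4)
    intro w hw
    have h3 := congrArg (fun L : E₁ →L[ℝ] E₁ => L w) (h1.unique ((hasFDerivAt_id _).congr_of_eventuallyEq h2))
    simpa [hw] using h3.symm
  obtain ⟨f', hf'⟩ := exists_equiv_fst_prod hinj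
  obtain ⟨Θ, hz₀Θ, hΘU, hΘ, hΘs⟩ := exists_contDiffOn_localInverse (f := fun z : ℝ × E₁ => (z.1, g z))
    hU (contDiffOn_fst.prodMk hg) hz₀ f' (by rw [hf']; exact hasFDerivAt_fst.prodMk hgd)
  have hz₁ : (t₀, c b₀) ∈ Θ.target := by
    have := Θ.map_source hz₀Θ
    rw [hΘ] at this
    change (t₀, g (t₀, e a₀)) ∈ _ at this
    rwa [hgz₀] at this
  have hk : Θ.symm (t₀, c b₀) = (t₀, e a₀) := by
    have := Θ.left_inv hz₀Θ
    rw [hΘ] at this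
    change Θ.symm (t₀, g (t₀, e a₀)) = _ at this
    rwa [hgz₀] at this
  refine ⟨Θ.target ∩ univ ×ˢ interior c.target, fun z => (Θ.symm z).2,
    Θ.open_target.inter (isOpen_univ.prod isOpen_interior),
    ⟨hz₁, mem_univ _, mem_interior_iff_mem_nhds.2 hT⟩,
    contDiff_snd.comp_contDiffOn (hΘs.mono inter_subset_left), by simp only; rw [hk],
    fun z hz => ⟨hz.2.2, fun hzt => ?_⟩⟩
  have h1 := Θ.right_inv hz.1
  rw [hΘ] at h1
  have h2 : (Θ.symm z).1 = z.1 := (Prod.ext_iff.1 h1).1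
  have h3 : g (Θ.symm z) = z.2 := (Prod.ext_iff.1 h1).2
  obtain ⟨h4, h5⟩ := hgU _ (hΘU (Θ.map_target hz.1))
  obtain ⟨h6, h7⟩ := h5 (h2.symm ▸ hzt)
  rw [h3, h2] at h7
  rw [h2, ← extChartAt_source I₁] at h6
  rw [h7, (extChartAt I₁ b₀).left_inv h6]
  exact (η z.1).symm_apply_apply _

/-- The reparametrized isotopy `γ t ∘ (η t)⁻¹`. -/
def reparametrizedIsotopy (γ : ℝ → A → N) (η : ℝ → (A ≃ₘ⟮I₁, I₁⟯ A)) (t : ℝ) (b : A) : N :=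
  γ t ((η t).symm b)

theorem exists_chart_reparametrizedIsotopy {γ : ℝ → A → N} {η : ℝ → (A ≃ₘ⟮I₁, I₁⟯ A)}
    (hγ : ContMDiffOn (𝓘(ℝ, ℝ).prod I₁) J ∞ (fun q : ℝ × A => γ q.1 q.2)
      (Icc (0 : ℝ) 1 ×ˢ (univ : Set A)))
    (hη : ContMDiffOn (𝓘(ℝ, ℝ).prod I₁) I₁ ∞ (fun q : ℝ × A => η q.1 q.2)
      (Icc (0 : ℝ) 1 ×ˢ (univ : Set A))) {t₀ : ℝ} (ht₀ : t₀ ∈ Icc (0 : ℝ) 1) {b₀ : A}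
    (hb₀ : I₁.IsInteriorPoint b₀) (ha₀ : I₁.IsInteriorPoint ((η t₀).symm b₀)) :
    ∃ (W : Set (ℝ × E₁)) (g : ℝ × E₁ → F), IsOpen W ∧ (t₀, extChartAt I₁ b₀ b₀) ∈ W ∧
      ContDiffOn ℝ ∞ g W ∧ ∀ z ∈ W, z.2 ∈ interior (extChartAt I₁ b₀).target ∧ (z.1 ∈ Icc (0 : ℝ) 1 →
        reparametrizedIsotopy γ η z.1 ((extChartAt I₁ b₀).symm z.2) ∈
          (chartAt H₂ (reparametrizedIsotopy γ η t₀ b₀)).source ∧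
        g z = extChartAt J (reparametrizedIsotopy γ η t₀ b₀)
          (reparametrizedIsotopy γ η z.1 ((extChartAt I₁ b₀).symm z.2))) := by
  obtain ⟨a₀, rfl⟩ : ∃ a₀, b₀ = η t₀ a₀ := ⟨_, ((η t₀).apply_symm_apply b₀).symm⟩
  have h0 : (η t₀).symm (η t₀ a₀) = a₀ := (η t₀).symm_apply_apply a₀
  rw [h0] at ha₀
  obtain ⟨U, g, hU, hz₀, hg, hgU⟩ := exists_chart_extension hγ ht₀ ha₀
  obtain ⟨W, k, hW, hzW, hk, hk₀, hkW⟩ := exists_inverse_family hη ht₀ ha₀ hb₀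
  have hcont : ContinuousOn (fun z : ℝ × E₁ => (z.1, k z)) W :=
    continuousOn_fst.prodMk hk.continuousOn
  refine ⟨W ∩ (fun z : ℝ × E₁ => (z.1, k z)) ⁻¹' U, fun z => g (z.1, k z),
    hcont.isOpen_inter_preimage hW hU, ⟨hzW, ?_⟩, ?_, fun z hz => ⟨(hkW z hz.1).1, fun hzt => ?_⟩⟩
  · rw [mem_preimage, hk₀]; exact hz₀
  · exact hg.comp (contDiffOn_fst.prodMk (hk.mono inter_subset_left)) fun z hz => hz.2
  · have h1 := (hkW z hz.1).2 hzt
    have h2 := (hgU _ hz.2).2 hzt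
    simp only [reparametrizedIsotopy, h0, h1]
    exact h2

end ChartExtension

/-! ### Hamiltonians with prescribed one-jet along an isotopy -/

section LocalHamiltonian

universe u
variable {E₁ E : Type u} [NormedAddCommGroup E₁] [NormedSpace ℝ E₁] [FiniteDimensional ℝ E₁]
  [NormedAddCommGroup E] [NormedSpace ℝ E] [FiniteDimensional ℝ E]

/-- The value at `(v, ·)` of the exterior derivative of a one-form on a vector space. -/
def extDerivForm (a : E → E →L[ℝ] ℝ) (x v : E) : E →L[ℝ] ℝ :=
  fderiv ℝ a x v - (fderiv ℝ a x).flip v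

theorem extDerivForm_apply (a : E → E →L[ℝ] ℝ) (x v w : E) :
    extDerivForm a x v w = fderiv ℝ a x v w - fderiv ℝ a x w v := rfl

theorem contDiffOn_extDerivForm {Q : Type*} [NormedAddCommGroup Q] [NormedSpace ℝ Q] {s : Set Q}
    {a : E → E →L[ℝ] ℝ} {T : Set E} (hT : IsOpen T) (ha : ContDiffOn ℝ ∞ a T) {x v : Q → E}
    (hx : ContDiffOn ℝ ∞ x s) (hv : ContDiffOn ℝ ∞ v s) (hxT : MapsTo x s T) :
    ContDiffOn ℝ ∞ (fun q => extDerivForm a (x q) (v q)) s := by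
  have h1 : ContDiffOn ℝ ∞ (fun q => fderiv ℝ a (x q)) s :=
    (ha.fderiv_of_isOpen hT (m := ∞) (by simp)).comp hx hxT
  have hflip : ContDiff ℝ ∞ (fun B : E →L[ℝ] E →L[ℝ] ℝ => B.flip) :=
    IsBoundedLinearMap.contDiff ⟨⟨fun _ _ => rfl, fun _ _ => rfl⟩, 1, one_pos, fun B => by simp⟩
  exact (h1.clm_apply hv).sub ((hflip.comp_contDiffOn h1).clm_apply hv)

/-- Let A be the pull-back of a under g. By hypothesis A(0, w) does not change with time, so dA(∂_t,
w) reduces to -∂_w (A(∂_t)), while naturality of d makes it the exterior derivative of a on the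
velocity and dg(0, w). Constancy is known only for times in S, which suffices since derivatives
within S are unique. -/
theorem fderiv_apply_time {W : Set (ℝ × E₁)} (hW : IsOpen W) {g : ℝ × E₁ → E}
    (hg : ContDiffOn ℝ ∞ g W) {a : E → E →L[ℝ] ℝ} {T : Set E} (hT : IsOpen T)
    (ha : ContDiffOn ℝ ∞ a T) (hgT : MapsTo g W T) {S : Set ℝ} (hS : UniqueDiffOn ℝ S)
    {β : E₁ → E₁ → ℝ}
    (hβ : ∀ z ∈ W, z.1 ∈ S → ∀ w, a (g z) (fderiv ℝ g z (0, w)) = β z.2 w)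
    {z : ℝ × E₁} (hz : z ∈ W) (hzS : z.1 ∈ S) (w : E₁) :
    fderiv ℝ (fun z => a (g z) (fderiv ℝ g z (1, 0))) z (0, w) =
      -extDerivForm a (g z) (fderiv ℝ g z (1, 0)) (fderiv ℝ g z (0, w)) := by
  have hgz := hg.contDiffAt (hW.mem_nhds hz)
  have haz := ha.contDiffAt (hT.mem_nhds (hgT hz))
  have h1 := fderiv_comp_fderiv_antisymm haz hgz ((1, 0) : ℝ × E₁) ((0, w) : ℝ × E₁)
  set A : ℝ × E₁ → ℝ × E₁ →L[ℝ] ℝ := fun q => (a (g q)).comp (fderiv ℝ g q) with hA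
  have hAd : DifferentiableAt ℝ A z := by
    have h2 : ContDiffAt ℝ ∞ (fun q => a (g q)) z := ContDiffAt.comp z haz hgz
    exact (h2.clm_comp (hgz.fderiv_right (m := ∞) (by simp))).differentiableAt (by simp)
  have hev : ∀ v : ℝ × E₁, HasFDerivAt (fun q => A q v) ((fderiv ℝ A z).flip v) z := by
    intro v
    exact (hAd.hasFDerivAt.clm_apply (hasFDerivAt_const v z)).congr_fderiv (by ext <;> simp)
  have h2 : fderiv ℝ A z (1, 0) (0, w) = 0 := by
    have h3 : HasDerivAt (fun s => A (s, z.2) (0, w)) (fderiv ℝ A z (1, 0) (0, w)) z.1 :=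
      (hev (0, w)).comp_hasDerivAt (f := fun s : ℝ => (s, z.2)) z.1
        ((hasDerivAt_id z.1).prodMk (hasDerivAt_const z.1 z.2))
    have h4 : HasDerivWithinAt (fun s => A (s, z.2) (0, w)) 0 S z.1 := by
      refine (hasDerivWithinAt_const z.1 S (β z.2 w)).congr_of_eventuallyEq ?_ (hβ z hz hzS w)
      have h5 : ∀ᶠ s in 𝓝 z.1, (s, z.2) ∈ W :=
        (Continuous.prodMk_left z.2).continuousAt.eventually (hW.mem_nhds hz)
      filter_upwards [mem_nhdsWithin_of_mem_nhds h5, self_mem_nhdsWithin] with s hs hsS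
      exact hβ _ hs hsS w
    exact (hS z.1 hzS).eq_deriv _ h3.hasDerivWithinAt h4
  have h3 : fderiv ℝ (fun z => a (g z) (fderiv ℝ g z (1, 0))) z (0, w) =
      fderiv ℝ A z (0, w) (1, 0) := by
    have := (hev (1, 0)).fderiv
    exact (congrArg (fun L : ℝ × E₁ →L[ℝ] ℝ => L (0, w)) this)
  rw [h3, extDerivForm_apply, ← h1, h2]
  ring

/-- A Hamiltonian with prescribed one-jet along an isotopy that preserves the restriction of a
one-form. -/
theorem exists_local_hamiltonian {W : Set (ℝ × E₁)} (hW : IsOpen W) {g : ℝ × E₁ → E}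
    (hg : ContDiffOn ℝ ∞ g W) {a : E → E →L[ℝ] ℝ} {T : Set E} (hT : IsOpen T)
    (ha : ContDiffOn ℝ ∞ a T) (hgT : MapsTo g W T) {S : Set ℝ} (hS : UniqueDiffOn ℝ S)
    {β : E₁ → E₁ → ℝ}
    (hβ : ∀ z ∈ W, z.1 ∈ S → ∀ w, a (g z) (fderiv ℝ g z (0, w)) = β z.2 w)
    {z₀ : ℝ × E₁} (hz₀ : z₀ ∈ W) (hinj : ∀ w, fderiv ℝ g z₀ (0, w) = 0 → w = 0) :
    ∃ (O : Set (ℝ × E)) (h : ℝ × E → ℝ) (W' : Set (ℝ × E₁)), IsOpen O ∧ IsOpen W' ∧ z₀ ∈ W' ∧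
      W' ⊆ W ∧ ContDiffOn ℝ ∞ h O ∧ ∀ z ∈ W', (z.1, g z) ∈ O ∧ (z.1 ∈ S →
        h (z.1, g z) = a (g z) (fderiv ℝ g z (1, 0)) ∧
        HasFDerivAt (fun x => h (z.1, x)) (-extDerivForm a (g z) (fderiv ℝ g z (1, 0))) (g z)) := by
  have : CompleteSpace E₁ := FiniteDimensional.complete ℝ E₁
  -- A linear left inverse of the spatial derivative makes (t, u) ↦ (t, ℓ (g (t, u))) a local
  -- diffeomorphism. Its inverse composed with ℓ is a retraction Z that preserves time and projects
  -- space to the parameters of the isotopy.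
  obtain ⟨ℓ, hℓ⟩ : ∃ ℓ : E →L[ℝ] E₁, ∀ w, ℓ (fderiv ℝ g z₀ (0, w)) = w := by
    let L : E₁ →ₗ[ℝ] E := (fderiv ℝ g z₀).comp (ContinuousLinearMap.inr ℝ ℝ E₁)
    obtain ⟨ℓ, hℓ⟩ := L.exists_leftInverse_of_injective (LinearMap.ker_eq_bot'.2 hinj)
    exact ⟨LinearMap.toContinuousLinearMap ℓ, fun w => LinearMap.congr_fun hℓ w⟩
  have hgd : ∀ z ∈ W, HasFDerivAt g (fderiv ℝ g z) z := fun z hz =>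
    ((hg.contDiffAt (hW.mem_nhds hz)).differentiableAt (by simp)).hasFDerivAt
  obtain ⟨f', hf'⟩ := exists_equiv_fst_prod (L := ℓ.comp (fderiv ℝ g z₀)) (fun w hw =>
    (hℓ w).symm.trans hw)
  obtain ⟨Θ, hz₀Θ, hΘW, hΘ, hΘs⟩ := exists_contDiffOn_localInverse
    (f := fun z : ℝ × E₁ => (z.1, ℓ (g z))) hW (contDiffOn_fst.prodMk (ℓ.contDiff.comp_contDiffOn hg))
    hz₀ f' (by rw [hf']; exact hasFDerivAt_fst.prodMk (ℓ.hasFDerivAt.comp z₀ (hgd z₀ hz₀)))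
  let r : ℝ × E → ℝ × E₁ := fun q => (q.1, ℓ q.2)
  have hr : ContDiff ℝ ∞ r := contDiff_fst.prodMk (ℓ.contDiff.comp contDiff_snd)
  let O : Set (ℝ × E) := r ⁻¹' Θ.target
  have hO : IsOpen O := Θ.open_target.preimage hr.continuous
  let Z : ℝ × E → ℝ × E₁ := fun q => Θ.symm (r q)
  have hZ : ContDiffOn ℝ ∞ Z O := hΘs.comp hr.contDiffOn fun q hq => hq
  have hZW : MapsTo Z O W := fun q hq => hΘW (Θ.map_target hq)
  let V : ℝ × E₁ → E := fun z => fderiv ℝ g z (1, 0)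
  have hV : ContDiffOn ℝ ∞ V W :=
    (hg.fderiv_of_isOpen hW (m := ∞) (by simp)).clm_apply contDiffOn_const
  let p : ℝ × E₁ → ℝ := fun z => a (g z) (V z)
  have hp : ContDiffOn ℝ ∞ p W := (ha.comp hg hgT).clm_apply hV
  let C : ℝ × E₁ → E →L[ℝ] ℝ := fun z => extDerivForm a (g z) (V z)
  have hC : ContDiffOn ℝ ∞ C W := contDiffOn_extDerivForm hT ha hg hV hgT
  -- A first-order Taylor expansion along the isotopy: on the trace it has the value p, and in
  -- directions killed by the retraction its derivative is -C. In tangential directions the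
  -- derivative of p is -C as well, by `fderiv_apply_time`.
  let h : ℝ × E → ℝ := fun q => p (Z q) - C (Z q) (q.2 - g (Z q))
  have hZg : ∀ z ∈ Θ.source, Z (z.1, g z) = z := by
    intro z hz
    have := Θ.left_inv hz
    rw [hΘ] at this
    exact this
  have hmem : ∀ z ∈ Θ.source, (z.1, g z) ∈ O := by
    intro z hz
    have := Θ.map_source hz
    rw [hΘ] at this
    exact this
  refine ⟨O, h, Θ.source, hO, Θ.open_source, hz₀Θ, hΘW, ?_, fun z hz => ⟨hmem z hz, fun hzS => ⟨?_, ?_⟩⟩⟩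
  · exact (hp.comp hZ hZW).sub ((hC.comp hZ hZW).clm_apply (contDiffOn_snd.sub (hg.comp hZ hZW)))
  · simp only [h, hZg z hz, sub_self, map_zero, sub_zero]
    rfl
  · have hzW := hΘW hz
    have hq := hmem z hz
    obtain ⟨D, hD⟩ : ∃ D, HasFDerivAt (fun x => Z (z.1, x)) D (g z) := by
      have h1 := ((hZ.contDiffAt (hO.mem_nhds hq)).differentiableAt (by simp)).hasFDerivAt
      exact ⟨_, h1.comp (g z) (hasFDerivAt_prodMk_right z.1 (g z))⟩
    have hD1 : ∀ ξ, D ξ = (0, (D ξ).2) := by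
      have h1 : HasFDerivAt (fun x => (Z (z.1, x)).1) ((ContinuousLinearMap.fst ℝ ℝ E₁).comp D) (g z) :=
        hasFDerivAt_fst.comp (g z) hD
      have h2 : (fun x => (Z (z.1, x)).1) =ᶠ[𝓝 (g z)] fun _ => z.1 := by
        have h3 : ∀ᶠ x in 𝓝 (g z), (z.1, x) ∈ O :=
          (Continuous.prodMk_right z.1).continuousAt.eventually (hO.mem_nhds hq)
        filter_upwards [h3] with x hx
        have h4 := Θ.right_inv hx
        rw [hΘ] at h4
        exact (Prod.ext_iff.1 h4).1
      have h3 := h1.unique ((hasFDerivAt_const z.1 (g z)).congr_of_eventuallyEq h2)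
      intro ξ
      exact Prod.ext (congrArg (fun L : E →L[ℝ] ℝ => L ξ) h3) rfl
    have hZz := hZg z hz
    have hpd : HasFDerivAt p (fderiv ℝ p z) (Z (z.1, g z)) := by
      rw [hZz]
      exact ((hp.contDiffAt (hW.mem_nhds hzW)).differentiableAt (by simp)).hasFDerivAt
    have hCd : HasFDerivAt C (fderiv ℝ C z) (Z (z.1, g z)) := by
      rw [hZz]
      exact ((hC.contDiffAt (hW.mem_nhds hzW)).differentiableAt (by simp)).hasFDerivAt
    have hgd' : HasFDerivAt g (fderiv ℝ g z) (Z (z.1, g z)) := by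
      rw [hZz]; exact hgd z hzW
    have h1 := (hpd.comp (g z) hD).sub ((hCd.comp (g z) hD).clm_apply
      ((hasFDerivAt_id (g z)).sub (hgd'.comp (g z) hD)))
    refine h1.congr_fderiv ?_
    refine ContinuousLinearMap.ext fun ξ => ?_
    have h2 := fderiv_apply_time hW hg hT ha hgT hS hβ hzW hzS (D ξ).2
    simp only [Pi.sub_apply, Function.comp_apply, hZz, id, sub_self, sub_apply, neg_apply,
      ContinuousLinearMap.comp_apply, map_zero, add_zero,
      ContinuousLinearMap.id_apply, map_sub]
    rw [hD1 ξ]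
    simp only [C, p, V]
    rw [h2]
    ring

end LocalHamiltonian

/-! ### Isotopies with constant pull-back of the contact form -/

section CharacteristicIsotopy

variable {M : Type*} [TopologicalSpace M] [ChartedSpace (EuclideanSpace ℝ (Fin 3)) M]
  [IsManifold (𝓡 3) ∞ M] {α : OneForm (𝓡 3) M}
  {E₁ : Type} [NormedAddCommGroup E₁] [NormedSpace ℝ E₁] [FiniteDimensional ℝ E₁]
  {H₁ : Type*} [TopologicalSpace H₁] {I₁ : ModelWithCorners ℝ E₁ H₁}
  {A : Type*} [TopologicalSpace A] [ChartedSpace H₁ A] [IsManifold I₁ ∞ A]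

/-- A path of embeddings, constant on `S` for the times in `[0, 1]`, along which the pull-back of `α`
is constant, and which is smooth (in charts) away from the boundary. -/
structure IsCharacteristicIsotopy (α : OneForm (𝓡 3) M) (I₁ : ModelWithCorners ℝ E₁ H₁)
    (S : Set A) (ψ : ℝ → A → M) : Prop where
  chart : ∀ t₀ ∈ Icc (0 : ℝ) 1, ∀ b₀ : A, I₁.IsInteriorPoint b₀ →
    ∃ (W : Set (ℝ × E₁)) (g : ℝ × E₁ → EuclideanSpace ℝ (Fin 3)), IsOpen W ∧
      (t₀, extChartAt I₁ b₀ b₀) ∈ W ∧ ContDiffOn ℝ ∞ g W ∧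
      ∀ z ∈ W, z.2 ∈ interior (extChartAt I₁ b₀).target ∧ (z.1 ∈ Icc (0 : ℝ) 1 →
        ψ z.1 ((extChartAt I₁ b₀).symm z.2) ∈
          (chartAt (EuclideanSpace ℝ (Fin 3)) (ψ t₀ b₀)).source ∧
        g z = extChartAt (𝓡 3) (ψ t₀ b₀) (ψ z.1 ((extChartAt I₁ b₀).symm z.2)))
  smooth : ∀ t ∈ Icc (0 : ℝ) 1, ContMDiff I₁ (𝓡 3) ∞ (ψ t)
  immersive : ∀ t ∈ Icc (0 : ℝ) 1, ∀ b, Function.Injective (mfderiv I₁ (𝓡 3) (ψ t) b)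
  injective : ∀ t ∈ Icc (0 : ℝ) 1, Function.Injective (ψ t)
  form : ∀ t ∈ Icc (0 : ℝ) 1, ∀ (b : A) (w : TangentSpace I₁ b),
    α (ψ t b) (mfderiv I₁ (𝓡 3) (ψ t) b w) = α (ψ 0 b) (mfderiv I₁ (𝓡 3) (ψ 0) b w)
  fixed : ∀ t ∈ Icc (0 : ℝ) 1, ∀ b ∈ S, ψ t b = ψ 0 b

/-- The vector `v` is the velocity at time `t` of the curve `s ↦ ψ s b`, `s ∈ [0, 1]`. -/
def IsVelocity (ψ : ℝ → A → M) (t : ℝ) (b : A) (v : TangentSpace (𝓡 3) (ψ t b)) : Prop :=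
  HasMFDerivWithinAt 𝓘(ℝ, ℝ) (𝓡 3) (fun s => ψ s b) (Icc (0 : ℝ) 1) t
    ((1 : ℝ →L[ℝ] ℝ).smulRight v)

/-- At time `t`, the one-jet of `h` at the point `ψ t b` generates the velocity of the isotopy. -/
def GeneratesVelocity (α : OneForm (𝓡 3) M) (h : ℝ × M → ℝ) (ψ : ℝ → A → M) (t : ℝ) (b : A) : Prop :=
  ∃ v, IsVelocity ψ t b v ∧ h (t, ψ t b) = α (ψ t b) v ∧
    ∀ w, differential (fun x => h (t, x)) (ψ t b) w = -α.d (ψ t b) v w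

theorem mfderiv_extChartAt_symm_injective {b : A} {v : E₁} (hv : v ∈ interior (extChartAt I₁ b).target) :
    Function.Injective (mfderiv 𝓘(ℝ, E₁) I₁ (extChartAt I₁ b).symm v) := by
  have : IsManifold I₁ 1 A := IsManifold.of_le (n := ∞) (by simp)
  have hv' := interior_subset hv
  have h1 : MDifferentiableAt 𝓘(ℝ, E₁) I₁ (extChartAt I₁ b).symm v :=
    ((contMDiffOn_extChartAt_symm (n := ∞) b).contMDiffAt
      (mem_interior_iff_mem_nhds.1 hv)).mdifferentiableAt (by simp)
  have h2 : MDifferentiableAt I₁ 𝓘(ℝ, E₁) (extChartAt I₁ b) ((extChartAt I₁ b).symm v) :=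
    mdifferentiableAt_extChartAt (by
      rw [← extChartAt_source I₁]; exact (extChartAt I₁ b).map_target hv')
  have h3 := h2.hasMFDerivAt.comp v h1.hasMFDerivAt
  have h4 : HasMFDerivAt 𝓘(ℝ, E₁) 𝓘(ℝ, E₁) (extChartAt I₁ b ∘ (extChartAt I₁ b).symm) v
      (ContinuousLinearMap.id ℝ E₁) := by
    refine HasMFDerivAt.congr_of_eventuallyEq (hasMFDerivAt_id v) ?_
    filter_upwards [mem_interior_iff_mem_nhds.1 hv] with u hu
    exact (extChartAt I₁ b).right_inv hu
  have h5 := hasMFDerivAt_unique h3 h4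
  refine Function.LeftInverse.injective
    (g := mfderiv I₁ 𝓘(ℝ, E₁) (extChartAt I₁ b) ((extChartAt I₁ b).symm v)) fun w => ?_
  exact congrArg (fun L : E₁ →L[ℝ] E₁ => L w) h5

theorem chartDeriv_injective {x₀ x : M} (hx : x ∈ (chartAt (EuclideanSpace ℝ (Fin 3)) x₀).source) :
    Function.Injective (chartDeriv (𝓡 3) x₀ x) := by
  intro v w h
  have h1 := mfderiv_symm_mfderiv_extChartAt hx v
  have h2 := mfderiv_symm_mfderiv_extChartAt hx w
  rw [h] at h1
  exact h1.symm.trans h2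

theorem IsCharacteristicIsotopy.exists_local_hamiltonian {S : Set A} {ψ : ℝ → A → M}
    (hα : α.IsSmooth) (hψ : IsCharacteristicIsotopy α I₁ S ψ) {t₀ : ℝ} (ht₀ : t₀ ∈ Icc (0 : ℝ) 1)
    {b₀ : A} (hb₀ : I₁.IsInteriorPoint b₀) :
    ∃ (O : Set (ℝ × M)) (h : ℝ × M → ℝ) (B : Set (ℝ × A)), IsOpen O ∧ IsOpen B ∧ (t₀, b₀) ∈ B ∧
      ContMDiffOn (𝓘(ℝ, ℝ).prod (𝓡 3)) 𝓘(ℝ, ℝ) ∞ h O ∧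
      ∀ q ∈ B, q.1 ∈ Icc (0 : ℝ) 1 → (q.1, ψ q.1 q.2) ∈ O ∧ GeneratesVelocity α h ψ q.1 q.2 := by
  obtain ⟨W₀, g, hW₀, hzW₀, hg₀, hgW₀⟩ := hψ.chart t₀ ht₀ b₀ hb₀
  set x₀ := ψ t₀ b₀ with hx₀
  let κ := extChartAt (𝓡 3) x₀
  let c := extChartAt I₁ b₀
  have hκT : IsOpen κ.target := isOpen_extChartAt_target x₀
  let W : Set (ℝ × E₁) := W₀ ∩ g ⁻¹' κ.target
  have hW : IsOpen W := hg₀.continuousOn.isOpen_inter_preimage hW₀ hκT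
  have hgW : ∀ z ∈ W, z.2 ∈ interior c.target ∧ (z.1 ∈ Icc (0 : ℝ) 1 →
      ψ z.1 (c.symm z.2) ∈ (chartAt (EuclideanSpace ℝ (Fin 3)) x₀).source ∧
        g z = κ (ψ z.1 (c.symm z.2))) := fun z hz => hgW₀ z hz.1
  have hzW : (t₀, c b₀) ∈ W := by
    refine ⟨hzW₀, ?_⟩
    rw [mem_preimage, ((hgW₀ _ hzW₀).2 ht₀).2]
    have := ((hgW₀ _ hzW₀).2 ht₀).1
    rw [← extChartAt_source (𝓡 3)] at this
    exact κ.map_source this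
  have hg : ContDiffOn ℝ ∞ g W := hg₀.mono inter_subset_left
  let a := α.inChart x₀
  have ha : ContDiffOn ℝ ∞ a κ.target := hα.contDiffOn_inChart x₀
  have hsymm : ∀ z ∈ W, MDifferentiableAt 𝓘(ℝ, E₁) I₁ c.symm z.2 := fun z hz =>
    ((contMDiffOn_extChartAt_symm (n := ∞) b₀).contMDiffAt
      (mem_interior_iff_mem_nhds.1 (hgW z hz).1)).mdifferentiableAt (by simp)
  have hψd : ∀ t ∈ Icc (0 : ℝ) 1, ∀ b, MDifferentiableAt I₁ (𝓡 3) (ψ t) b := fun t ht b =>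
    (hψ.smooth t ht).mdifferentiable (by simp) b
  have hcomp : ∀ z ∈ W, z.1 ∈ Icc (0 : ℝ) 1 → ∀ w, fderiv ℝ g z (0, w) =
      chartDeriv (𝓡 3) x₀ (ψ z.1 (c.symm z.2)) (mfderiv I₁ (𝓡 3) (ψ z.1) (c.symm z.2)
        (mfderiv 𝓘(ℝ, E₁) I₁ c.symm z.2 w)) := by
    intro z hz hzt w
    have h1 := (hψd z.1 hzt (c.symm z.2)).hasMFDerivAt.comp z.2 (hsymm z hz).hasMFDerivAt
    have h2 := chartDeriv_mfderiv (G := ψ z.1 ∘ c.symm) (x₀ := x₀) ((hgW z hz).2 hzt).1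
      h1.mdifferentiableAt w
    rw [h1.mfderiv] at h2
    refine Eq.trans ?_ h2.symm
    have h3 : HasFDerivAt (fun v => g (z.1, v)) ((fderiv ℝ g z).comp
        (ContinuousLinearMap.inr ℝ ℝ E₁)) z.2 :=
      HasFDerivAt.comp (g := g) z.2
        ((hg.contDiffAt (hW.mem_nhds hz)).differentiableAt (by simp)).hasFDerivAt
        (hasFDerivAt_prodMk_right z.1 z.2)
    have h4 : (fun v => κ ((ψ z.1 ∘ c.symm) v)) =ᶠ[𝓝 z.2] fun v => g (z.1, v) := by
      have h5 : ∀ᶠ v in 𝓝 z.2, (z.1, v) ∈ W :=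
        (Continuous.prodMk_right z.1).continuousAt.eventually (hW.mem_nhds hz)
      filter_upwards [h5] with v hv
      exact ((hgW _ hv).2 hzt).2.symm
    have h6 := (h3.congr_of_eventuallyEq h4).fderiv
    exact (congrArg (fun L : E₁ →L[ℝ] EuclideanSpace ℝ (Fin 3) => L w) h6).symm
  have hβ : ∀ z ∈ W, z.1 ∈ Icc (0 : ℝ) 1 → ∀ w, a (g z) (fderiv ℝ g z (0, w)) =
      α (ψ 0 (c.symm z.2)) (mfderiv I₁ (𝓡 3) (ψ 0) (c.symm z.2)
        (mfderiv 𝓘(ℝ, E₁) I₁ c.symm z.2 w)) := by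
    intro z hz hzt w
    rw [hcomp z hz hzt w, ← hψ.form z.1 hzt, α.apply_eq_inChart ((hgW z hz).2 hzt).1,
      ((hgW z hz).2 hzt).2]
  have hinj : ∀ w, fderiv ℝ g (t₀, c b₀) (0, w) = 0 → w = 0 := by
    intro w hw
    rw [hcomp _ hzW ht₀ w] at hw
    have h1 := (map_eq_zero_iff _ (chartDeriv_injective ((hgW _ hzW).2 ht₀).1)).1 hw
    have h2 := (map_eq_zero_iff _ (hψ.immersive t₀ ht₀ _)).1 h1
    exact (map_eq_zero_iff _ (mfderiv_extChartAt_symm_injective (hgW _ hzW).1)).1 h2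
  obtain ⟨O₁, h₁, W', hO₁, hW', hzW', hW'W, hh₁, hh₁W⟩ := _root_.exists_local_hamiltonian hW hg hκT ha
    (fun z hz => hz.2) (uniqueDiffOn_Icc_zero_one) (β := fun v w => α (ψ 0 (c.symm v))
      (mfderiv I₁ (𝓡 3) (ψ 0) (c.symm v) (mfderiv 𝓘(ℝ, E₁) I₁ c.symm v w))) hβ hzW hinj
  let h : ℝ × M → ℝ := fun q => h₁ (q.1, κ q.2)
  have hκc : ContinuousOn (fun q : ℝ × M => (q.1, κ q.2)) (univ ×ˢ κ.source) :=
    continuousOn_fst.prodMk ((continuousOn_extChartAt x₀).comp continuousOn_snd fun q hq => hq.2)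
  let O : Set (ℝ × M) := univ ×ˢ κ.source ∩ (fun q : ℝ × M => (q.1, κ q.2)) ⁻¹' O₁
  have hO : IsOpen O := hκc.isOpen_inter_preimage
    (isOpen_univ.prod (isOpen_extChartAt_source x₀)) hO₁
  have hcc : ContinuousOn (fun q : ℝ × A => (q.1, c q.2)) (univ ×ˢ c.source) :=
    continuousOn_fst.prodMk ((continuousOn_extChartAt b₀).comp continuousOn_snd fun q hq => hq.2)
  have hh : ContMDiffOn (𝓘(ℝ, ℝ).prod (𝓡 3)) 𝓘(ℝ, ℝ) ∞ h O := by
    refine (contMDiffOn_prod_self_iff_contDiffOn.2 hh₁).comp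
      (contMDiffOn_fst.prodMk ((contMDiffOn_extChartAt (n := ∞) (x := x₀)).comp contMDiffOn_snd
        fun q hq => ?_)) fun q hq => hq.2
    have := hq.1.2
    rwa [extChartAt_source] at this
  refine ⟨O, h, univ ×ˢ c.source ∩ (fun q : ℝ × A => (q.1, c q.2)) ⁻¹' W', hO,
    hcc.isOpen_inter_preimage (isOpen_univ.prod (isOpen_extChartAt_source b₀)) hW',
    ⟨⟨mem_univ _, mem_extChartAt_source b₀⟩, hzW'⟩, hh, ?_⟩
  rintro ⟨t, b⟩ ⟨⟨-, hbs⟩, hz⟩ ht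
  change t ∈ Icc (0 : ℝ) 1 at ht
  have hbs' : c.symm (c b) = b := c.left_inv hbs
  change (t, c b) ∈ W' at hz
  obtain ⟨hz1, hz2⟩ := hh₁W _ hz
  obtain ⟨hz3, hz4⟩ := hz2 ht
  obtain ⟨hsrc, hgκ⟩ := (hgW _ (hW'W hz)).2 ht
  change ψ t (c.symm (c b)) ∈ _ at hsrc
  change g (t, c b) = κ (ψ t (c.symm (c b))) at hgκ
  rw [hbs'] at hsrc hgκ
  have hsrc' : ψ t b ∈ κ.source := by rwa [extChartAt_source]
  have hO' : (t, ψ t b) ∈ O := by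
    refine ⟨⟨mem_univ _, hsrc'⟩, ?_⟩
    change (t, κ (ψ t b)) ∈ O₁
    rw [← hgκ]
    exact hz1
  refine ⟨hO', ?_⟩
  obtain ⟨v, hv⟩ := chartDeriv_surjective hsrc (fderiv ℝ g (t, c b) (1, 0))
  refine ⟨v, ?_, ?_, ?_⟩
  · have h1 : HasDerivAt (fun s => g (s, c b)) (chartDeriv (𝓡 3) x₀ (ψ t b) v) t := by
      rw [hv]
      exact HasFDerivAt.comp_hasDerivAt (f := fun s : ℝ => (s, c b)) t
        ((hg.contDiffAt (hW.mem_nhds (hW'W hz))).differentiableAt (by simp)).hasFDerivAt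
        ((hasDerivAt_id t).prodMk (hasDerivAt_const t (c b)))
    have h2 := hasMFDerivAt_extChartAt_symm_comp (I := 𝓡 3) (x₀ := x₀) (x := ψ t b)
      (by rw [hgκ]; exact κ.map_source hsrc') (by rw [hgκ]; exact κ.left_inv hsrc') h1
    have h3 : ∀ᶠ s in 𝓝[Icc 0 1] t, (fun s => ψ s b) s = κ.symm (g (s, c b)) := by
      have h5 : ∀ᶠ s in 𝓝 t, (s, c b) ∈ W :=
        (Continuous.prodMk_left (c b)).continuousAt.eventually (hW.mem_nhds (hW'W hz))
      filter_upwards [mem_nhdsWithin_of_mem_nhds h5, self_mem_nhdsWithin] with s hs hst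
      obtain ⟨h6, h7⟩ := (hgW _ hs).2 hst
      change ψ s (c.symm (c b)) ∈ _ at h6
      change g (s, c b) = κ (ψ s (c.symm (c b))) at h7
      rw [hbs'] at h6 h7
      rw [h7]
      exact (κ.left_inv (by rwa [extChartAt_source])).symm
    have h4 := h2.hasMFDerivWithinAt (s := Icc 0 1) |>.congr_of_eventuallyEq h3
      (h3.self_of_nhdsWithin ht)
    exact h4
  · change h₁ (t, κ (ψ t b)) = _
    rw [α.apply_eq_inChart hsrc, hv, ← hgκ]
    exact hz3
  · intro w
    have h1 : MDifferentiableAt (𝓡 3) 𝓘(ℝ, ℝ) (fun x => h (t, x)) (ψ t b) :=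
      ((hh.contMDiffAt (hO.mem_nhds hO')).comp (ψ t b)
        (contMDiffAt_const.prodMk contMDiffAt_id)).mdifferentiableAt (by simp)
    rw [differential_eq_chart hsrc h1, hα.d_eq_inChart hsrc, hv]
    have h2 : (fun y => h (t, κ.symm y)) =ᶠ[𝓝 (κ (ψ t b))] fun y => h₁ (t, y) := by
      filter_upwards [hκT.mem_nhds (κ.map_source hsrc')] with y hy
      simp only [h]
      rw [κ.right_inv hy]
    have h3 : HasFDerivAt (fun y => h (t, κ.symm y))
        (-extDerivForm a (g (t, c b)) (fderiv ℝ g (t, c b) (1, 0))) (κ (ψ t b)) := by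
      refine HasFDerivAt.congr_of_eventuallyEq ?_ h2
      rw [← hgκ]
      exact hz4
    rw [h3.fderiv, hgκ]
    rfl

end CharacteristicIsotopy

/-! ### Patching the local Hamiltonians -/

section GlobalHamiltonian

variable {M : Type*} [TopologicalSpace M] [ChartedSpace (EuclideanSpace ℝ (Fin 3)) M]
  [IsManifold (𝓡 3) ∞ M] {α : OneForm (𝓡 3) M}
  {E₁ : Type} [NormedAddCommGroup E₁] [NormedSpace ℝ E₁] [FiniteDimensional ℝ E₁]
  {H₁ : Type*} [TopologicalSpace H₁] {I₁ : ModelWithCorners ℝ E₁ H₁}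
  {A : Type*} [TopologicalSpace A] [ChartedSpace H₁ A] [IsManifold I₁ ∞ A]
  {S : Set A} {ψ : ℝ → A → M}

theorem differential_mul {f g : M → ℝ} {x : M} (hf : MDifferentiableAt (𝓡 3) 𝓘(ℝ, ℝ) f x)
    (hg : MDifferentiableAt (𝓡 3) 𝓘(ℝ, ℝ) g x) (w : TangentSpace (𝓡 3) x) :
    differential (fun y => f y * g y) x w = f x * differential g x w + g x * differential f x w := by
  have h1 : HasMFDerivAt (𝓡 3) 𝓘(ℝ, ℝ) f x (differential f x) := hf.hasMFDerivAt
  have h2 : HasMFDerivAt (𝓡 3) 𝓘(ℝ, ℝ) g x (differential g x) := hg.hasMFDerivAt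
  exact congrArg (fun L : EuclideanSpace ℝ (Fin 3) →L[ℝ] ℝ => L w) (h1.mul h2).mfderiv

theorem differential_sum {ι : Type} {s : Finset ι} {f : ι → M → ℝ} {x : M}
    (hf : ∀ i ∈ s, MDifferentiableAt (𝓡 3) 𝓘(ℝ, ℝ) (f i) x) (w : TangentSpace (𝓡 3) x) :
    differential (fun y => ∑ i ∈ s, f i y) x w = ∑ i ∈ s, differential (f i) x w := by
  have h1 : HasMFDerivAt (𝓡 3) 𝓘(ℝ, ℝ) (∑ i ∈ s, f i) x (∑ i ∈ s, differential (f i) x) :=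
    HasMFDerivAt.sum fun i hi => (hf i hi).hasMFDerivAt
  have h2 : (fun y => ∑ i ∈ s, f i y) = ∑ i ∈ s, f i := by ext y; simp
  rw [h2]
  have h3 : differential (∑ i ∈ s, f i) x = ∑ i ∈ s, differential (f i) x := h1.mfderiv
  rw [h3]
  exact sum_apply s _ w

theorem differential_congr {f g : M → ℝ} {x : M} (h : f =ᶠ[𝓝 x] g) (w : TangentSpace (𝓡 3) x) :
    differential f x w = differential g x w :=
  congrArg (fun L : EuclideanSpace ℝ (Fin 3) →L[ℝ] ℝ => L w) h.mfderiv_eq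

theorem IsVelocity.unique {t : ℝ} (ht : t ∈ Icc (0 : ℝ) 1) {b : A} {v v' : TangentSpace (𝓡 3) (ψ t b)}
    (h : IsVelocity ψ t b v) (h' : IsVelocity ψ t b v') : v = v' := by
  have h1 : UniqueMDiffWithinAt 𝓘(ℝ, ℝ) (Icc (0 : ℝ) 1) t :=
    (uniqueDiffOn_Icc_zero_one t ht).uniqueMDiffWithinAt
  have h2 := congrArg (fun L : ℝ →L[ℝ] EuclideanSpace ℝ (Fin 3) => L 1) (h1.eq h h')
  exact (one_smul ℝ (v : EuclideanSpace ℝ (Fin 3))).symm.trans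
    (h2.trans (one_smul ℝ (v' : EuclideanSpace ℝ (Fin 3))))

theorem IsCharacteristicIsotopy.isVelocity_zero (hψ : IsCharacteristicIsotopy α I₁ S ψ) {t : ℝ}
    (ht : t ∈ Icc (0 : ℝ) 1) {b : A} (hb : b ∈ S) : IsVelocity ψ t b 0 := by
  have h1 : HasMFDerivWithinAt 𝓘(ℝ, ℝ) (𝓡 3) (fun _ : ℝ => ψ t b) (Icc (0 : ℝ) 1) t
      ((1 : ℝ →L[ℝ] ℝ).smulRight (0 : TangentSpace (𝓡 3) (ψ t b))) := by
    refine (hasMFDerivWithinAt_const (ψ t b) (Icc (0 : ℝ) 1) t).congr_mfderiv ?_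
    refine ContinuousLinearMap.ext fun (r : ℝ) => ?_
    exact (smul_zero (A := EuclideanSpace ℝ (Fin 3)) r).symm
  refine h1.congr_of_eventuallyEq ?_ rfl
  filter_upwards [self_mem_nhdsWithin] with s hs
  rw [hψ.fixed s hs b hb, hψ.fixed t ht b hb]

theorem IsCharacteristicIsotopy.continuousOn (hψ : IsCharacteristicIsotopy α I₁ S ψ)
    (hS : S ∈ 𝓝ˢ (I₁.boundary A)) :
    ContinuousOn (fun q : ℝ × A => ψ q.1 q.2) (Icc (0 : ℝ) 1 ×ˢ univ) := by
  rintro ⟨t₀, b₀⟩ ⟨ht₀, -⟩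
  change t₀ ∈ Icc (0 : ℝ) 1 at ht₀
  rcases I₁.isInteriorPoint_or_isBoundaryPoint b₀ with hb₀ | hb₀
  · obtain ⟨W, g, hW, hzW, hg, hgW⟩ := hψ.chart t₀ ht₀ b₀ hb₀
    set x₀ := ψ t₀ b₀ with hx₀
    let κ := extChartAt (𝓡 3) x₀
    let c := extChartAt I₁ b₀
    have hcb : c.symm (c b₀) = b₀ := extChartAt_to_inv b₀
    have hg₀ : g (t₀, c b₀) = κ x₀ := by
      have h1 := ((hgW _ hzW).2 ht₀).2
      change g (t₀, c b₀) = κ (ψ t₀ (c.symm (c b₀))) at h1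
      rw [h1, hcb]
    have h1 : ContinuousAt (fun q : ℝ × A => (q.1, c q.2)) (t₀, b₀) :=
      continuousAt_fst.prodMk (ContinuousAt.comp (f := Prod.snd) (x := (t₀, b₀))
        (continuousAt_extChartAt b₀) continuousAt_snd)
    have h2 : ContinuousAt (fun q : ℝ × A => g (q.1, c q.2)) (t₀, b₀) :=
      ContinuousAt.comp (f := fun q : ℝ × A => (q.1, c q.2)) (x := (t₀, b₀))
        (hg.continuousOn.continuousAt (hW.mem_nhds hzW)) h1
    have h3 : ContinuousAt (fun q : ℝ × A => κ.symm (g (q.1, c q.2))) (t₀, b₀) := by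
      refine ContinuousAt.comp (g := κ.symm) ?_ h2
      rw [hg₀]
      exact continuousAt_extChartAt_symm x₀
    refine h3.continuousWithinAt.congr_of_eventuallyEq ?_ ?_
    · have h4 : ∀ᶠ q : ℝ × A in 𝓝 (t₀, b₀), q.2 ∈ c.source :=
        continuousAt_snd.eventually (extChartAt_source_mem_nhds b₀)
      filter_upwards [mem_nhdsWithin_of_mem_nhds (h1.eventually (hW.mem_nhds hzW)),
        mem_nhdsWithin_of_mem_nhds h4, self_mem_nhdsWithin] with q hq hqs hq1
      obtain ⟨h5, h6⟩ := (hgW _ hq).2 hq1.1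
      change ψ q.1 (c.symm (c q.2)) ∈ _ at h5
      change g (q.1, c q.2) = κ (ψ q.1 (c.symm (c q.2))) at h6
      rw [c.left_inv hqs] at h5 h6
      rw [h6]
      exact (κ.left_inv (by rwa [extChartAt_source])).symm
    · simp only
      rw [hg₀]
      exact (extChartAt_to_inv x₀).symm
  · have hS₀ : S ∈ 𝓝 b₀ := mem_nhdsSet_iff_forall.1 hS b₀ hb₀
    have h1 : ContinuousAt (fun q : ℝ × A => ψ 0 q.2) (t₀, b₀) :=
      ((hψ.smooth 0 (by simp)).continuous.comp continuous_snd).continuousAt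
    have h2 : ∀ᶠ q : ℝ × A in 𝓝 (t₀, b₀), q.2 ∈ S := continuousAt_snd.eventually hS₀
    refine h1.continuousWithinAt.congr_of_eventuallyEq ?_ (hψ.fixed _ ht₀ _ (mem_of_mem_nhds hS₀))
    filter_upwards [mem_nhdsWithin_of_mem_nhds h2, self_mem_nhdsWithin] with q hq hq1
    exact hψ.fixed _ hq1.1 _ hq

/-- The local Hamiltonian is controlled on a neighbourhood B in parameter space, whereas patching
needs control at every point of the trace that lies in an open subset of ℝ × M. Compactness and
injectivity permit deleting the closed image of the parameters outside B without losing the point.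
Near the boundary of A the velocity is zero and h = 0 works. -/
theorem IsCharacteristicIsotopy.exists_local_generator [T2Space M] [CompactSpace A]
    (hα : α.IsSmooth) (hψ : IsCharacteristicIsotopy α I₁ S ψ) (hS : S ∈ 𝓝ˢ (I₁.boundary A))
    {t₀ : ℝ} (ht₀ : t₀ ∈ Icc (0 : ℝ) 1) (b₀ : A) :
    ∃ (O : Set (ℝ × M)) (h : ℝ × M → ℝ), IsOpen O ∧ (t₀, ψ t₀ b₀) ∈ O ∧
      ContMDiffOn (𝓘(ℝ, ℝ).prod (𝓡 3)) 𝓘(ℝ, ℝ) ∞ h O ∧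
      ∀ t ∈ Icc (0 : ℝ) 1, ∀ b, (t, ψ t b) ∈ O → GeneratesVelocity α h ψ t b := by
  have key : ∃ (O : Set (ℝ × M)) (h : ℝ × M → ℝ) (B : Set (ℝ × A)), IsOpen O ∧ IsOpen B ∧
      (t₀, b₀) ∈ B ∧ ContMDiffOn (𝓘(ℝ, ℝ).prod (𝓡 3)) 𝓘(ℝ, ℝ) ∞ h O ∧
      ∀ q ∈ B, q.1 ∈ Icc (0 : ℝ) 1 → (q.1, ψ q.1 q.2) ∈ O ∧ GeneratesVelocity α h ψ q.1 q.2 := by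
    rcases I₁.isInteriorPoint_or_isBoundaryPoint b₀ with hb₀ | hb₀
    · exact hψ.exists_local_hamiltonian hα ht₀ hb₀
    · have hS₀ : S ∈ 𝓝 b₀ := mem_nhdsSet_iff_forall.1 hS b₀ hb₀
      refine ⟨univ, fun _ => 0, univ ×ˢ interior S, isOpen_univ, isOpen_univ.prod isOpen_interior,
        ⟨mem_univ _, mem_interior_iff_mem_nhds.2 hS₀⟩, contMDiffOn_const, fun q hq hqt =>
        ⟨mem_univ _, 0, hψ.isVelocity_zero hqt (interior_subset hq.2), (map_zero _).symm, fun w => ?_⟩⟩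
      rw [α.d_zero_left, differential_const, neg_zero]
      rfl
  obtain ⟨O, h, B, hO, hB, hbB, hh, hOB⟩ := key
  let D : Set (ℝ × A) := Icc (0 : ℝ) 1 ×ˢ univ \ B
  have hD : IsCompact D := (isCompact_Icc.prod isCompact_univ).diff hB
  let Γ : ℝ × A → ℝ × M := fun q => (q.1, ψ q.1 q.2)
  have hΓ : ContinuousOn Γ (Icc (0 : ℝ) 1 ×ˢ univ) :=
    continuousOn_fst.prodMk (hψ.continuousOn hS)
  have hΓD : IsClosed (Γ '' D) := (hD.image_of_continuousOn (hΓ.mono sdiff_subset)).isClosed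
  refine ⟨O \ Γ '' D, h, hO.sdiff hΓD, ⟨(hOB _ hbB ht₀).1, ?_⟩, hh.mono sdiff_subset, ?_⟩
  · rintro ⟨⟨t, b⟩, ⟨-, hB'⟩, hq⟩
    have h1 : t = t₀ := congrArg Prod.fst hq
    subst h1
    have h2 : b = b₀ := hψ.injective t ht₀ (congrArg Prod.snd hq)
    subst h2
    exact hB' hbB
  · intro t ht b hb
    refine (hOB (t, b) ?_ ht).2
    by_contra hB'
    exact hb.2 ⟨(t, b), ⟨⟨ht, mem_univ _⟩, hB'⟩, rfl⟩

/-- On the trace all local Hamiltonians have the same one-jet. In a partition of unity the terms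
containing differentials of the weights all carry the common factor α(v), and these differentials
sum to zero near the trace, so the glued function has this one-jet too. -/
theorem IsCharacteristicIsotopy.exists_generator [T2Space M] [SecondCountableTopology M]
    [CompactSpace A] (hα : α.IsSmooth) (hψ : IsCharacteristicIsotopy α I₁ S ψ)
    (hS : S ∈ 𝓝ˢ (I₁.boundary A)) :
    ∃ h : ℝ × M → ℝ, ContMDiff (𝓘(ℝ, ℝ).prod (𝓡 3)) 𝓘(ℝ, ℝ) ∞ h ∧
      ∀ t ∈ Icc (0 : ℝ) 1, ∀ b, GeneratesVelocity α h ψ t b := by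
  have : LocallyCompactSpace M := ChartedSpace.locallyCompactSpace (EuclideanSpace ℝ (Fin 3)) M
  let K : Set (ℝ × M) := (fun q : ℝ × A => (q.1, ψ q.1 q.2)) '' Icc (0 : ℝ) 1 ×ˢ univ
  have hK : IsCompact K := (isCompact_Icc.prod isCompact_univ).image_of_continuousOn
    (continuousOn_fst.prodMk (hψ.continuousOn hS))
  have hloc : ∀ x ∈ K, ∃ (O : Set (ℝ × M)) (h : ℝ × M → ℝ), IsOpen O ∧ x ∈ O ∧
      ContMDiffOn (𝓘(ℝ, ℝ).prod (𝓡 3)) 𝓘(ℝ, ℝ) ∞ h O ∧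
      ∀ t ∈ Icc (0 : ℝ) 1, ∀ b, (t, ψ t b) ∈ O → GeneratesVelocity α h ψ t b := by
    rintro _ ⟨⟨t₀, b₀⟩, ⟨ht₀, -⟩, rfl⟩
    exact hψ.exists_local_generator hα hS ht₀ b₀
  choose! O h hO hxO hh hgen using hloc
  obtain ⟨s, hsK, hKs⟩ := hK.elim_nhds_subcover O fun x hx => (hO x hx).mem_nhds (hxO x hx)
  let p : Fin s.card → ℝ × M := fun i => s.equivFin.symm i
  have hpK : ∀ i, p i ∈ K := fun i => hsK _ (s.equivFin.symm i).2
  -- The index `none` stands for the complement of the trace; its weight vanishes near the trace and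
  -- drops out of every computation there.
  let U : Option (Fin s.card) → Set (ℝ × M) := fun o => o.elim Kᶜ fun i => O (p i)
  obtain ⟨ρ, hρ⟩ := SmoothPartitionOfUnity.exists_isSubordinate (𝓘(ℝ, ℝ).prod (𝓡 3))
    (isClosed_univ (X := ℝ × M)) U (by
      rintro (_ | i)
      · exact hK.isClosed.isOpen_compl
      · exact hO _ (hpK i)) (by
      intro x _
      by_cases hx : x ∈ K
      · obtain ⟨y, hy, hxy⟩ := mem_iUnion₂.1 (hKs hx)
        refine mem_iUnion.2 ⟨some (s.equivFin ⟨y, hy⟩), ?_⟩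
        simpa [U, p] using hxy
      · exact mem_iUnion.2 ⟨none, hx⟩)
  have hρd : ∀ (o) (t : ℝ) (x : M),
      MDifferentiableAt (𝓡 3) 𝓘(ℝ, ℝ) (fun y => ρ o (t, y)) x := fun o t x =>
    ((ρ o).contMDiff.comp (contMDiff_const.prodMk contMDiff_id)).mdifferentiable (by simp) x
  refine ⟨fun q => ∑ i, ρ (some i) q * h (p i) q, ?_, fun t ht b => ?_⟩
  · refine ContMDiff.sum fun i _ => ?_
    exact ρ.contMDiff_smul (n := ⊤) (i := some i) fun x hx =>
      (hh _ (hpK i)).contMDiffAt ((hO _ (hpK i)).mem_nhds (hρ (some i) hx))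
  set x := ψ t b with hx
  have hxK : (t, x) ∈ K := ⟨(t, b), ⟨ht, mem_univ _⟩, rfl⟩
  have hzero : ∀ o, (t, x) ∉ tsupport (ρ o) → (fun y => ρ o (t, y)) =ᶠ[𝓝 x] fun _ => 0 := by
    intro o ho
    exact (Continuous.prodMk_right t).continuousAt.eventually (notMem_tsupport_iff_eventuallyEq.1 ho)
  have hnone : (fun y => ρ none (t, y)) =ᶠ[𝓝 x] fun _ => 0 := hzero none fun h => hρ none h hxK
  have hsum : ∀ q, ρ none q + ∑ i, ρ (some i) q = 1 := by
    intro q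
    have h1 := ρ.sum_eq_one (mem_univ q)
    rw [finsum_eq_sum_of_fintype, Fintype.sum_option] at h1
    exact h1
  have hsum0 : ∑ i, ρ (some i) (t, x) = 1 := by
    have h1 := hsum (t, x)
    have h2 : ρ none (t, x) = 0 := hnone.self_of_nhds
    rwa [h2, zero_add] at h1
  have hsumd : ∀ w, ∑ i, differential (fun y => ρ (some i) (t, y)) x w = 0 := by
    intro w
    rw [← differential_sum fun i _ => hρd (some i) t x]
    have h1 : (fun y => ∑ i, ρ (some i) (t, y)) =ᶠ[𝓝 x] fun _ => 1 := by
      filter_upwards [hnone] with y hy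
      have h2 := hsum (t, y)
      rwa [hy, zero_add] at h2
    rw [differential_congr h1, differential_const]
    rfl
  obtain ⟨i₀, hi₀⟩ : ∃ i, (t, x) ∈ O (p i) := by
    obtain ⟨y, hy, hxy⟩ := mem_iUnion₂.1 (hKs hxK)
    exact ⟨s.equivFin ⟨y, hy⟩, by simpa [p] using hxy⟩
  obtain ⟨v, hv, -, -⟩ := hgen _ (hpK i₀) t ht b hi₀
  have hterm : ∀ i, MDifferentiableAt (𝓡 3) 𝓘(ℝ, ℝ) (fun y => ρ (some i) (t, y) * h (p i) (t, y)) x ∧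
      ρ (some i) (t, x) * h (p i) (t, x) = ρ (some i) (t, x) * α x v ∧
      ∀ w, differential (fun y => ρ (some i) (t, y) * h (p i) (t, y)) x w =
        ρ (some i) (t, x) * -α.d x v w + α x v * differential (fun y => ρ (some i) (t, y)) x w := by
    intro i
    by_cases hi : (t, x) ∈ O (p i)
    · obtain ⟨v', hv', h1, h2⟩ := hgen _ (hpK i) t ht b hi
      have hvv : v' = v := hv'.unique ht hv
      subst hvv
      have h3 : MDifferentiableAt (𝓡 3) 𝓘(ℝ, ℝ) (fun y => h (p i) (t, y)) x :=
        (((hh _ (hpK i)).contMDiffAt ((hO _ (hpK i)).mem_nhds hi)).comp x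
          (contMDiffAt_const.prodMk contMDiffAt_id)).mdifferentiableAt (by simp)
      refine ⟨(hρd (some i) t x).mul h3, by rw [h1], fun w => ?_⟩
      rw [differential_mul (hρd (some i) t x) h3, h2, h1]
    · have h1 := hzero (some i) fun h => hi (hρ (some i) h)
      have h2 : (fun y => ρ (some i) (t, y) * h (p i) (t, y)) =ᶠ[𝓝 x] fun _ => (0 : ℝ) := by
        filter_upwards [h1] with y hy
        rw [hy, zero_mul]
      have h3 : ρ (some i) (t, x) = 0 := h1.self_of_nhds
      refine ⟨?_, by rw [h3, zero_mul, zero_mul], fun w => ?_⟩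
      · exact mdifferentiableAt_const.congr_of_eventuallyEq h2
      · rw [differential_congr h2, differential_congr h1, differential_const, h3]
        change (0 : ℝ) = 0 * _ + _ * 0
        ring
  refine ⟨v, hv, ?_, fun w => ?_⟩
  · change ∑ i, ρ (some i) (t, x) * h (p i) (t, x) = α x v
    rw [Finset.sum_congr rfl fun i _ => (hterm i).2.1, ← Finset.sum_mul, hsum0, one_mul]
  · change differential (fun y => ∑ i, ρ (some i) (t, y) * h (p i) (t, y)) x w = -α.d x v w
    rw [differential_sum fun i _ => (hterm i).1, Finset.sum_congr rfl fun i _ => (hterm i).2.2 w,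
      Finset.sum_add_distrib, ← Finset.sum_mul, ← Finset.mul_sum, hsumd, hsum0]
    ring

end GlobalHamiltonian

/-! ### From Hamiltonians to ambient contact isotopies -/

section ExtensionOfIsotopies

variable {M : Type*} [TopologicalSpace M] [ChartedSpace (EuclideanSpace ℝ (Fin 3)) M]
  [IsManifold (𝓡 3) ∞ M] {α : OneForm (𝓡 3) M}
  {E₁ : Type} [NormedAddCommGroup E₁] [NormedSpace ℝ E₁] [FiniteDimensional ℝ E₁]
  {H₁ : Type*} [TopologicalSpace H₁] {I₁ : ModelWithCorners ℝ E₁ H₁}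
  {A : Type*} [TopologicalSpace A] [ChartedSpace H₁ A] [IsManifold I₁ ∞ A]
  {S : Set A} {ψ : ℝ → A → M}

theorem hasMFDerivWithinAt_congr_field {X : ∀ x : M, TangentSpace (𝓡 3) x} {f g : ℝ → M} {s : Set ℝ}
    {t : ℝ} (h : HasMFDerivWithinAt 𝓘(ℝ, ℝ) (𝓡 3) f s t ((1 : ℝ →L[ℝ] ℝ).smulRight (X (f t))))
    (hfg : g =ᶠ[𝓝[s] t] f) (ht : g t = f t) :
    HasMFDerivWithinAt 𝓘(ℝ, ℝ) (𝓡 3) g s t ((1 : ℝ →L[ℝ] ℝ).smulRight (X (g t))) := by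
  have h1 : ∀ z z' : M, z = z' →
      (X z : EuclideanSpace ℝ (Fin 3)) = (X z' : EuclideanSpace ℝ (Fin 3)) := by
    rintro z _ rfl; rfl
  refine (h.congr_of_eventuallyEq hfg ht).congr_mfderiv ?_
  refine ContinuousLinearMap.ext fun (r : ℝ) => ?_
  exact congrArg (fun v : EuclideanSpace ℝ (Fin 3) => r • v) (h1 _ _ ht.symm)

/-- Along the trace the one-jet of h satisfies α(v) = h and ι_v dα = -dh, so v is the contact field
of h by uniqueness, with c = 0. Cutting off in time and space gives a complete flow without changing
the field along the trace, and integral curves do the rest. -/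
theorem IsCharacteristicIsotopy.exists_contactIsotopy [T2Space M] [SecondCountableTopology M]
    [CompactSpace A] (hα : α.IsContact) (hψ : IsCharacteristicIsotopy α I₁ S ψ)
    (hS : S ∈ 𝓝ˢ (I₁.boundary A)) :
    ∃ φ : ℝ → (M ≃ₘ⟮𝓡 3, 𝓡 3⟯ M), IsContactIsotopy α φ ∧
      (∀ t ∈ Icc (0 : ℝ) 1, ∀ b : A, φ t (ψ 0 b) = ψ t b) ∧
      ∃ W ∈ 𝓝ˢ (ψ 0 '' I₁.boundary A), ∀ t ∈ Icc (0 : ℝ) 1, ∀ x ∈ W, φ t x = x := by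
  have : LocallyCompactSpace M := ChartedSpace.locallyCompactSpace (EuclideanSpace ℝ (Fin 3)) M
  have h01 : (0 : ℝ) ∈ Icc (0 : ℝ) 1 := by simp
  obtain ⟨h, hh, hgen⟩ := hψ.exists_generator hα.1 hS
  have hbS : I₁.boundary A ⊆ interior S := subset_interior_iff_mem_nhdsSet.2 hS
  -- Only parameters outside the interior of S can move. By injectivity of ψ t their trace misses
  -- the image of the boundary, so the cut-off χ can be 1 near K and 0 near that image.
  let K : Set M := (fun q : ℝ × A => ψ q.1 q.2) '' Icc (0 : ℝ) 1 ×ˢ (interior S)ᶜ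
  have hK : IsCompact K :=
    (isCompact_Icc.prod isOpen_interior.isClosed_compl.isCompact).image_of_continuousOn
      ((hψ.continuousOn hS).mono (prod_mono le_rfl (subset_univ _)))
  obtain ⟨L, hL, hKL⟩ := exists_compact_superset hK
  have hbd : IsClosed (ψ 0 '' I₁.boundary A) :=
    ((I₁.isClosed_boundary (n := ∞) (by simp)).isCompact.image
      (hψ.smooth 0 h01).continuous).isClosed
  have hdisj : Disjoint ((interior L)ᶜ ∪ ψ 0 '' I₁.boundary A) K := by
    rw [disjoint_left]
    rintro _ (hx | ⟨b, hb, hx⟩) hxK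
    · exact hx (hKL hxK)
    · obtain ⟨⟨t, b'⟩, ⟨ht, hb'⟩, rfl⟩ := hxK
      change t ∈ Icc (0 : ℝ) 1 at ht
      change ψ 0 b = ψ t b' at hx
      rw [← hψ.fixed t ht b (interior_subset (hbS hb))] at hx
      have := hψ.injective t ht hx
      subst this
      exact hb' (hbS hb)
  obtain ⟨χ, hχ0, hχ1, -⟩ := exists_contMDiffMap_zero_one_nhds_of_isClosed (𝓡 3) (n := ⊤)
    (isOpen_interior.isClosed_compl.union hbd) hK.isClosed hdisj
  obtain ⟨τ, hτ0, hτ1, -⟩ := exists_contMDiffMap_zero_one_nhds_of_isClosed 𝓘(ℝ, ℝ) (n := ⊤)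
    (s := (Ioo (-1 : ℝ) 2)ᶜ) (t := Icc (0 : ℝ) 1) isOpen_Ioo.isClosed_compl isClosed_Icc (by
      rw [disjoint_left]
      intro t ht ht'
      exact ht ⟨by linarith [ht'.1], by linarith [ht'.2]⟩)
  let h' : ℝ × M → ℝ := fun q => τ q.1 * (χ q.2 * h q)
  have hh' : ContMDiff (𝓘(ℝ, ℝ).prod (𝓡 3)) 𝓘(ℝ, ℝ) ∞ h' :=
    (τ.contMDiff.comp contMDiff_fst).mul ((χ.contMDiff.comp contMDiff_snd).mul hh)
  have hvel : ∀ t ∈ Icc (0 : ℝ) 1, ∀ b,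
      IsVelocity ψ t b (contactField α (fun y => h' (t, y)) (ψ t b)) := by
    intro t ht b
    obtain ⟨v, hv, h1, h2⟩ := hgen t ht b
    have hτt : τ t = 1 := hτ1.self_of_nhdsSet t ht
    have hd : MDifferentiableAt (𝓡 3) 𝓘(ℝ, ℝ) (fun y => h (t, y)) (ψ t b) :=
      (hh.comp (contMDiff_const.prodMk contMDiff_id)).mdifferentiable (by simp) _
    have hfun : (fun y => h' (t, y)) = fun y => χ y * h (t, y) := by
      funext y
      simp only [h', hτt, one_mul]
    have key : v = contactField α (fun y => h' (t, y)) (ψ t b) := by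
      rw [hfun]
      -- Here χ need not be 1. But the velocity is zero, so h has vanishing one-jet at this point
      -- and so does χ h.
      by_cases hb : b ∈ interior S
      · have hv0 : v = 0 := hv.unique ht (hψ.isVelocity_zero ht (interior_subset hb))
        subst hv0
        rw [map_zero] at h1
        refine hα.eq_contactField (c := 0) ?_ fun w => ?_
        · simp only [h1, mul_zero, map_zero]
        · rw [differential_mul (χ.contMDiff.mdifferentiable (by simp) _) hd, h1, h2,
            α.d_zero_left]
          ring
      · have hχ : ∀ᶠ y in 𝓝 (ψ t b), χ y = 1 :=
          (Filter.eventually_iff_exists_mem.2 ⟨_, mem_nhdsSet_iff_forall.1 hχ1 _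
            ⟨(t, b), ⟨ht, hb⟩, rfl⟩, fun y hy => hy⟩)
        have hev : (fun y => χ y * h (t, y)) =ᶠ[𝓝 (ψ t b)] fun y => h (t, y) := by
          filter_upwards [hχ] with y hy
          rw [hy, one_mul]
        refine hα.eq_contactField (c := 0) ?_ fun w => ?_
        · exact h1.symm.trans hev.self_of_nhds.symm
        · rw [differential_congr hev, h2]
          ring
    rw [← key]
    exact hv
  obtain ⟨φ, hφ, hφs, hφ', huniq⟩ := hα.exists_contactFlow hh' (isCompact_Icc (a := (-1 : ℝ)) (b := 2))
    hL (fun t x ht => by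
      have : τ t = 0 := hτ0.self_of_nhdsSet t fun h => ht (Ioo_subset_Icc_self h)
      simp only [h', this, zero_mul]) (fun t x hx => by
      have : χ x = 0 := hχ0.self_of_nhdsSet x (Or.inl fun h => hx (interior_subset h))
      simp only [h', this, zero_mul, mul_zero])
  refine ⟨φ, hφ, fun t ht b => ?_, ?_⟩
  · let y : ℝ → M := fun s => if s < 0 then φ s (ψ 0 b) else ψ s b
    have hy0 : y 0 = ψ 0 b := if_neg (lt_irrefl _)
    have hy : ∀ s ∈ Ioo (-1 : ℝ) 1, HasMFDerivAt 𝓘(ℝ, ℝ) (𝓡 3) y s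
        ((1 : ℝ →L[ℝ] ℝ).smulRight (contactField α (fun z => h' (s, z)) (y s))) := by
      intro s hs
      rcases lt_trichotomy s 0 with hs0 | rfl | hs0
      · refine (hasMFDerivWithinAt_congr_field (s := Iio 0) (X := contactField α fun z => h' (s, z))
          (hφ' (ψ 0 b) s).hasMFDerivWithinAt ?_ (if_pos hs0)).hasMFDerivAt (Iio_mem_nhds hs0)
        filter_upwards [self_mem_nhdsWithin] with r hr
        exact if_pos hr
      · have h1 : HasMFDerivWithinAt 𝓘(ℝ, ℝ) (𝓡 3) y (Iic 0) 0
            ((1 : ℝ →L[ℝ] ℝ).smulRight (contactField α (fun z => h' (0, z)) (y 0))) := by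
          refine hasMFDerivWithinAt_congr_field (X := contactField α fun z => h' (0, z))
            (hφ' (ψ 0 b) 0).hasMFDerivWithinAt ?_ (hy0.trans (hφ.start _).symm)
          filter_upwards [self_mem_nhdsWithin] with r hr
          rcases (mem_Iic.1 hr).lt_or_eq with hr | rfl
          · exact if_pos hr
          · exact hy0.trans (hφ.start _).symm
        have h2 : HasMFDerivWithinAt 𝓘(ℝ, ℝ) (𝓡 3) y (Icc 0 1) 0
            ((1 : ℝ →L[ℝ] ℝ).smulRight (contactField α (fun z => h' (0, z)) (y 0))) := by
          refine hasMFDerivWithinAt_congr_field (X := contactField α fun z => h' (0, z))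
            (hvel 0 h01 b) ?_ hy0
          filter_upwards [self_mem_nhdsWithin] with r hr
          exact if_neg (not_lt.2 hr.1)
        refine (h1.union h2).hasMFDerivAt ?_
        rw [Iic_union_Icc_eq_Iic zero_le_one]
        exact Iic_mem_nhds one_pos
      · have hs1 : Icc (0 : ℝ) 1 ∈ 𝓝 s := Icc_mem_nhds hs0 hs.2
        refine (hasMFDerivWithinAt_congr_field (X := contactField α fun z => h' (s, z))
          (hvel s ⟨hs0.le, hs.2.le⟩ b) ?_ (if_neg hs0.le.not_gt)).hasMFDerivAt hs1
        filter_upwards [self_mem_nhdsWithin] with r hr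
        exact if_neg (not_lt.2 hr.1)
    have h1 := huniq (ψ 0 b) y (-1) 1 0 ⟨by norm_num, one_pos⟩ hy (hy0.trans (hφ.start _).symm)
    have h2 : EqOn (fun s => φ s (ψ 0 b)) (fun s => ψ s b) (Ico 0 1) := fun s hs => by
      have h3 := h1 s ⟨by linarith [hs.1], hs.2⟩
      rw [show y s = ψ s b from if_neg (not_lt.2 hs.1)] at h3
      exact h3.symm
    refine h2.of_subset_closure (t := Icc 0 1) ?_ ?_ Ico_subset_Icc_self ?_ ht
    · exact (hφs.continuous.comp (continuous_id.prodMk continuous_const)).continuousOn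
    · exact (hψ.continuousOn hS).comp (continuousOn_id.prodMk continuousOn_const)
        fun s hs => ⟨hs, mem_univ _⟩
    · rw [closure_Ico zero_ne_one]
  · obtain ⟨W, hW, hbW, hW0⟩ := mem_nhdsSet_iff_exists.1
      (Filter.mem_of_superset hχ0 fun x hx => hx)
    refine ⟨W, hW.mem_nhdsSet.2 (subset_union_right.trans hbW), fun t ht x hx => ?_⟩
    refine (huniq x (fun _ => x) (-1) 2 0 ⟨by norm_num, by norm_num⟩ (fun s hs => ?_)
      (hφ.start x).symm t ⟨by linarith [ht.1], by linarith [ht.2]⟩).symm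
    have h1 : contactField α (fun z => h' (s, z)) x = 0 := by
      refine hα.contactField_of_eventuallyEq_zero ?_
      filter_upwards [hW.mem_nhds hx] with z hz
      have : χ z = 0 := hW0 hz
      simp only [h', this, zero_mul, mul_zero]
      rfl
    rw [h1]
    refine (hasMFDerivAt_const x s).congr_mfderiv ?_
    refine ContinuousLinearMap.ext fun (r : ℝ) => ?_
    exact (smul_zero (A := EuclideanSpace ℝ (Fin 3)) r).symm

/-- The reparametrized isotopy is characteristic. -/
theorem isCharacteristicIsotopy_reparametrizedIsotopy {γ : ℝ → A → M} {η : ℝ → (A ≃ₘ⟮I₁, I₁⟯ A)}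
    (hγ : ContMDiffOn (𝓘(ℝ, ℝ).prod I₁) (𝓡 3) ∞ (fun q : ℝ × A => γ q.1 q.2)
      (Icc (0 : ℝ) 1 ×ˢ (univ : Set A)))
    (hγe : ∀ t ∈ Icc (0 : ℝ) 1, IsSmoothEmb I₁ (𝓡 3) (γ t))
    (hη : ContMDiffOn (𝓘(ℝ, ℝ).prod I₁) I₁ ∞ (fun q : ℝ × A => η q.1 q.2)
      (Icc (0 : ℝ) 1 ×ˢ (univ : Set A)))
    (hη0 : ∀ a : A, η 0 a = a) (hS : S ∈ 𝓝ˢ (I₁.boundary A))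
    (hS' : ∀ t ∈ Icc (0 : ℝ) 1, ∀ a ∈ S, γ t a = γ 0 a ∧ η t a = a)
    (hform : ∀ t ∈ Icc (0 : ℝ) 1, ∀ (a : A) (v : TangentSpace I₁ a),
      α (γ t a) (mfderiv I₁ (𝓡 3) (γ t) a v) = α (γ 0 (η t a)) (mfderiv I₁ (𝓡 3) (γ 0) (η t a)
        (mfderiv I₁ I₁ (η t) a v))) :
    IsCharacteristicIsotopy α I₁ S (reparametrizedIsotopy γ η) := by
  have h01 : (0 : ℝ) ∈ Icc (0 : ℝ) 1 := by simp
  have hsymm : ∀ t ∈ Icc (0 : ℝ) 1, ∀ b ∈ S, (η t).symm b = b := fun t ht b hb => by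
    conv_lhs => rw [← (hS' t ht b hb).2]
    exact (η t).symm_apply_apply b
  have h0 : reparametrizedIsotopy γ η 0 = γ 0 := by
    funext b
    have : (η 0).symm b = b := by
      conv_lhs => rw [← hη0 b]
      exact (η 0).symm_apply_apply b
    rw [reparametrizedIsotopy, this]
  have hd : ∀ t ∈ Icc (0 : ℝ) 1, ∀ b, HasMFDerivAt I₁ (𝓡 3) (reparametrizedIsotopy γ η t) b
      ((mfderiv I₁ (𝓡 3) (γ t) ((η t).symm b)).comp (mfderiv I₁ I₁ (η t).symm b)) := by
    intro t ht b
    exact ((hγe t ht).smooth.mdifferentiable (by simp) _).hasMFDerivAt.comp b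
      ((η t).symm.contMDiff.mdifferentiable (by simp) b).hasMFDerivAt
  have hinv : ∀ t b, HasMFDerivAt I₁ I₁ (η t ∘ (η t).symm) b
      ((mfderiv I₁ I₁ (η t) ((η t).symm b)).comp (mfderiv I₁ I₁ (η t).symm b)) := fun t b =>
    ((η t).contMDiff.mdifferentiable (by simp) _).hasMFDerivAt.comp b
      ((η t).symm.contMDiff.mdifferentiable (by simp) b).hasMFDerivAt
  have hinv' : ∀ t b (w : E₁), (mfderiv I₁ I₁ (η t) ((η t).symm b)
      (mfderiv I₁ I₁ (η t).symm b w) : E₁) = w := by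
    intro t b w
    have h1 : HasMFDerivAt I₁ I₁ (η t ∘ (η t).symm) b (ContinuousLinearMap.id ℝ E₁) := by
      have h2 : η t ∘ (η t).symm = id := funext fun b => (η t).apply_symm_apply b
      rw [h2]
      exact hasMFDerivAt_id b
    exact congrArg (fun L : E₁ →L[ℝ] E₁ => L w) (hasMFDerivAt_unique (hinv t b) h1)
  refine ⟨fun t₀ ht₀ b₀ hb₀ => ?_, fun t ht => ?_, fun t ht b => ?_, fun t ht => ?_,
    fun t ht b w => ?_, fun t ht b hb => ?_⟩
  · refine exists_chart_reparametrizedIsotopy hγ hη ht₀ hb₀ ?_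
    rcases I₁.isInteriorPoint_or_isBoundaryPoint ((η t₀).symm b₀) with h | h
    · exact h
    · have h1 := (hS' t₀ ht₀ _ (subset_of_mem_nhdsSet hS h)).2
      rw [(η t₀).apply_symm_apply] at h1
      rwa [← h1]
  · exact (hγe t ht).smooth.comp (η t).symm.contMDiff
  · rw [(hd t ht b).mfderiv]
    have h1 : Function.Injective (mfderiv I₁ I₁ (η t).symm b) :=
      Function.LeftInverse.injective (g := mfderiv I₁ I₁ (η t) ((η t).symm b)) (hinv' t b)
    exact ((hγe t ht).immersive _).comp h1
  · exact (hγe t ht).embedding.injective.comp (η t).symm.injective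
  · rw [h0, (hd t ht b).mfderiv]
    have h1 := hform t ht ((η t).symm b) (mfderiv I₁ I₁ (η t).symm b w)
    refine h1.trans ?_
    have h2 : ∀ (b' : A) (w' : E₁), b' = b → w' = (w : E₁) →
        α (γ 0 b') (mfderiv I₁ (𝓡 3) (γ 0) b' w') = α (γ 0 b) (mfderiv I₁ (𝓡 3) (γ 0) b w) := by
      rintro _ _ rfl rfl; rfl
    exact h2 _ _ ((η t).apply_symm_apply b) (hinv' t b w)
  · rw [h0, reparametrizedIsotopy, hsymm t ht b hb]
    exact (hS' t ht b hb).1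

/-- The extension of isotopies of unions of knots and arcs to ambient contact isotopies. -/
theorem exists_contactIsotopy_extension [T2Space M] [SecondCountableTopology M]
    [CompactSpace A] (hα : α.IsContact) {γ : ℝ → A → M} {η : ℝ → (A ≃ₘ⟮I₁, I₁⟯ A)}
    (hγ : ContMDiffOn (𝓘(ℝ, ℝ).prod I₁) (𝓡 3) ∞ (fun q : ℝ × A => γ q.1 q.2)
      (Icc (0 : ℝ) 1 ×ˢ (univ : Set A)))
    (hγe : ∀ t ∈ Icc (0 : ℝ) 1, IsSmoothEmb I₁ (𝓡 3) (γ t))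
    (hη : ContMDiffOn (𝓘(ℝ, ℝ).prod I₁) I₁ ∞ (fun q : ℝ × A => η q.1 q.2)
      (Icc (0 : ℝ) 1 ×ˢ (univ : Set A)))
    (hη0 : ∀ a : A, η 0 a = a)
    (hS : ∃ S ∈ 𝓝ˢ (I₁.boundary A), ∀ t ∈ Icc (0 : ℝ) 1, ∀ a ∈ S, γ t a = γ 0 a ∧ η t a = a)
    (hform : ∀ t ∈ Icc (0 : ℝ) 1, ∀ (a : A) (v : TangentSpace I₁ a),
      α (γ t a) (mfderiv I₁ (𝓡 3) (γ t) a v) = α (γ 0 (η t a)) (mfderiv I₁ (𝓡 3) (γ 0) (η t a)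
        (mfderiv I₁ I₁ (η t) a v))) :
    ∃ φ : ℝ → (M ≃ₘ⟮𝓡 3, 𝓡 3⟯ M), IsContactIsotopy α φ ∧
      (∀ t ∈ Icc (0 : ℝ) 1, ∀ a : A, φ t (γ 0 a) = γ t ((η t).symm a)) ∧
      ∃ W ∈ 𝓝ˢ (γ 0 '' I₁.boundary A), ∀ t ∈ Icc (0 : ℝ) 1, ∀ x ∈ W, φ t x = x := by
  obtain ⟨S, hS, hS'⟩ := hS
  have h1 := isCharacteristicIsotopy_reparametrizedIsotopy hγ hγe hη hη0 hS hS' hform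
  have h0 : reparametrizedIsotopy γ η 0 = γ 0 := by
    funext b
    have : (η 0).symm b = b := by
      conv_lhs => rw [← hη0 b]
      exact (η 0).symm_apply_apply b
    rw [reparametrizedIsotopy, this]
  have h2 := h1.exists_contactIsotopy hα hS
  rw [h0] at h2
  exact h2

end ExtensionOfIsotopies

/-! ### A generic constant vector avoids a one-parameter family of linear systems -/

section GenericSection

variable {ι : Type*} [Fintype ι] [DecidableEq ι]

/-- Solves the equations `i` and `j` of the system `D = h S b` for `b i` and `b j`; the parameter is
the coordinate `u i` and the coordinate `u j` is not used. -/
def eliminateTwo (h : ℝ → ℝ) (D : ι → ℝ → ℝ) (S : ι → ι → ℝ → ℝ) (i j : ι) (u : ι → ℝ) (k : ι) : ℝ :=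
  if k = i then (D j (u i) / h (u i) - ∑ l ∈ (Finset.univ.erase i).erase j, S j l (u i) * u l) /
    S j i (u i)
  else if k = j then
    (D i (u i) / h (u i) - ∑ l ∈ (Finset.univ.erase i).erase j, S i l (u i) * u l) / S i j (u i)
  else u k

theorem eliminateTwo_update (h : ℝ → ℝ) (D : ι → ℝ → ℝ) (S : ι → ι → ℝ → ℝ) {i j : ι} (hij : i ≠ j)
    (u : ι → ℝ) (r : ℝ) :
    eliminateTwo h D S i j (Function.update u j r) = eliminateTwo h D S i j u := by
  have h1 : ∀ T : ι → ℝ → ℝ, ∑ l ∈ (Finset.univ.erase i).erase j, T l (u i) * Function.update u j r l =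
      ∑ l ∈ (Finset.univ.erase i).erase j, T l (u i) * u l := fun T => by
    refine Finset.sum_congr rfl fun l hl => ?_
    rw [Function.update_of_ne (Finset.ne_of_mem_erase hl)]
  funext k
  simp only [eliminateTwo, Function.update_of_ne hij]
  rw [h1 (S j), h1 (S i)]
  by_cases hki : k = i
  · rw [if_pos hki, if_pos hki]
  · by_cases hkj : k = j
    · rw [if_neg hki, if_neg hki, if_pos hkj, if_pos hkj]
    · rw [if_neg hki, if_neg hki, if_neg hkj, if_neg hkj, Function.update_of_ne hkj]

/-- Antisymmetry removes b i from equation i and b j from equation j. Hence one nonzero entry S i j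
solves equation j for b i and equation i for b j separately, and b is recovered from its remaining
coordinates and θ. -/
theorem eq_eliminateTwo {h : ℝ → ℝ} {D : ι → ℝ → ℝ} {S : ι → ι → ℝ → ℝ}
    (hS : ∀ i j θ, S i j θ = -S j i θ) {i j : ι} (hij : i ≠ j) {b : ι → ℝ} {θ : ℝ} (hθ : h θ ≠ 0)
    (hSθ : S i j θ ≠ 0) (hb : ∀ k, D k θ = h θ * ∑ l, S k l θ * b l) :
    b = eliminateTwo h D S i j (Function.update b i θ) := by
  have hS0 : ∀ k, S k k θ = 0 := fun k => by have := hS k k θ; linarith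
  have h1 : ∀ k, ∑ l ∈ (Finset.univ.erase i).erase j, S k l θ * Function.update b i θ l =
      ∑ l ∈ (Finset.univ.erase i).erase j, S k l θ * b l := fun k => by
    refine Finset.sum_congr rfl fun l hl => ?_
    rw [Function.update_of_ne (Finset.ne_of_mem_erase (Finset.mem_of_mem_erase hl))]
  have h2 : ∀ k, ∑ l, S k l θ * b l = S k i θ * b i + (S k j θ * b j +
      ∑ l ∈ (Finset.univ.erase i).erase j, S k l θ * b l) := fun k => by
    rw [Finset.add_sum_erase _ (fun l => S k l θ * b l)
      (Finset.mem_erase.2 ⟨hij.symm, Finset.mem_univ j⟩),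
      Finset.add_sum_erase _ (fun l => S k l θ * b l) (Finset.mem_univ i)]
  have hSji : S j i θ ≠ 0 := by rw [hS j i]; exact neg_ne_zero.2 hSθ
  funext k
  simp only [eliminateTwo, Function.update_self]
  rw [h1, h1]
  by_cases hki : k = i
  · rw [if_pos hki, eq_div_iff hSji, hb j, mul_div_cancel_left₀ _ hθ, h2, hS0 j, hki]
    ring
  · rw [if_neg hki]
    by_cases hkj : k = j
    · rw [if_pos hkj, eq_div_iff hSθ, hb i, mul_div_cancel_left₀ _ hθ, h2, hS0 i, hkj]
      ring
    · rw [if_neg hkj, Function.update_of_ne hki]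

theorem differentiableAt_eliminateTwo {h : ℝ → ℝ} {D : ι → ℝ → ℝ} {S : ι → ι → ℝ → ℝ}
    (hh : Differentiable ℝ h) (hD : ∀ i, Differentiable ℝ (D i))
    (hSd : ∀ i j, Differentiable ℝ (S i j)) {i j : ι} {u : ι → ℝ} (hu : h (u i) ≠ 0)
    (hij : S i j (u i) ≠ 0) (hji : S j i (u i) ≠ 0) :
    DifferentiableAt ℝ (eliminateTwo h D S i j) u := by
  have hp : ∀ l, DifferentiableAt ℝ (fun u : ι → ℝ => u l) u := fun l => differentiableAt_apply l u
  have hc : ∀ f : ℝ → ℝ, Differentiable ℝ f → DifferentiableAt ℝ (fun u : ι → ℝ => f (u i)) u :=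
    fun f hf => (hf (u i)).comp u (hp i)
  have hsum : ∀ k, DifferentiableAt ℝ (fun u : ι → ℝ =>
      ∑ l ∈ (Finset.univ.erase i).erase j, S k l (u i) * u l) u := fun k =>
    DifferentiableAt.fun_sum fun l _ => (hc _ (hSd k l)).mul (hp l)
  have hdiv : ∀ {f g : ℝ → ℝ}, Differentiable ℝ f → Differentiable ℝ g → g (u i) ≠ 0 →
      DifferentiableAt ℝ (fun u : ι → ℝ => f (u i) * (g (u i))⁻¹) u := fun hf hg h0 =>
    (hc _ hf).fun_mul ((hc _ hg).inv h0)
  rw [differentiableAt_pi]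
  intro k
  simp only [eliminateTwo, div_eq_mul_inv]
  by_cases hki : k = i
  · simp only [if_pos hki]
    exact (((hdiv (hD j) hh hu).fun_sub (hsum j)).fun_mul ((hc _ (hSd j i)).inv hji))
  · by_cases hkj : k = j
    · simp only [if_neg hki, if_pos hkj]
      exact (((hdiv (hD i) hh hu).fun_sub (hsum i)).fun_mul ((hc _ (hSd i j)).inv hij))
    · simp only [if_neg hki, if_neg hkj]
      exact hp k

/-- A generic constant vector `b` solves none of the linear systems `D θ = h θ • S θ b`, where `S` is
antisymmetric and nonzero. -/
theorem exists_forall_ne_antisymm_system {h : ℝ → ℝ} {D : ι → ℝ → ℝ} {S : ι → ι → ℝ → ℝ}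
    (hh : Differentiable ℝ h) (hD : ∀ i, Differentiable ℝ (D i))
    (hSd : ∀ i j, Differentiable ℝ (S i j)) (hS : ∀ i j θ, S i j θ = -S j i θ)
    (hS0 : ∀ θ, ∃ i j, S i j θ ≠ 0) :
    ∃ b : ι → ℝ, ∀ θ, h θ ≠ 0 → ∃ k, D k θ ≠ h θ * ∑ l, S k l θ * b l := by
  let Ω : ι → ι → Set (ι → ℝ) := fun i j => {u | i ≠ j ∧ h (u i) ≠ 0 ∧ S i j (u i) ≠ 0}
  let 𝓑 : Set (ι → ℝ) := ⋃ i, ⋃ j, eliminateTwo h D S i j '' Ω i j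
  have hnull : MeasureTheory.volume 𝓑 = 0 := by
    refine MeasureTheory.measure_iUnion_null fun i => MeasureTheory.measure_iUnion_null fun j => ?_
    have hd : ∀ u ∈ Ω i j, HasFDerivAt (eliminateTwo h D S i j)
        (fderiv ℝ (eliminateTwo h D S i j) u) u := fun u hu =>
      (differentiableAt_eliminateTwo hh hD hSd hu.2.1 hu.2.2
        (by rw [hS j i]; exact neg_ne_zero.2 hu.2.2)).hasFDerivAt
    -- The elimination map ignores the coordinate u j, so its derivative kills that basis vector and
    -- has determinant zero; its image is null. The bad vectors b lie in the finite union of these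
    -- images.
    refine MeasureTheory.addHaar_image_eq_zero_of_det_fderivWithin_eq_zero _
      (fun u hu => (hd u hu).hasFDerivWithinAt) fun u hu => ?_
    have h1 : fderiv ℝ (eliminateTwo h D S i j) u (Pi.single j 1) = 0 := by
      have h2 : HasDerivAt (fun r : ℝ => Function.update u j r) (Pi.single j 1) (u j) :=
        hasDerivAt_update u j (u j)
      have h3 := HasFDerivAt.comp_hasDerivAt (f := fun r : ℝ => Function.update u j r) (u j)
        (by rw [Function.update_eq_self]; exact hd u hu) h2
      have h4 : eliminateTwo h D S i j ∘ (fun r : ℝ => Function.update u j r) =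
          fun _ => eliminateTwo h D S i j u := by
        funext r
        exact eliminateTwo_update h D S hu.1 u r
      rw [h4] at h3
      exact h3.unique (hasDerivAt_const _ _)
    refine LinearMap.det_eq_zero_iff_ker_ne_bot.2 fun h5 => ?_
    have h6 : (Pi.single j 1 : ι → ℝ) = 0 := by
      rw [← Submodule.mem_bot ℝ, ← h5]
      exact h1
    exact one_ne_zero ((Pi.single_eq_same (M := fun _ => ℝ) j 1).symm.trans (congrFun h6 j))
  obtain ⟨b, hb⟩ : ∃ b, b ∉ 𝓑 := by
    by_contra! hall
    rw [eq_univ_of_forall hall] at hnull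
    exact (NeZero.ne (MeasureTheory.volume (α := ι → ℝ))) (MeasureTheory.Measure.measure_univ_eq_zero.1 hnull)
  refine ⟨b, fun θ hθ => ?_⟩
  by_contra! hall
  obtain ⟨i, j, hij⟩ := hS0 θ
  have hne : i ≠ j := by
    rintro rfl
    have := hS i i θ
    exact hij (by linarith)
  refine hb (mem_iUnion.2 ⟨i, mem_iUnion.2 ⟨j, Function.update b i θ, ⟨hne, ?_, ?_⟩, ?_⟩⟩)
  · rwa [Function.update_self]
  · rwa [Function.update_self]
  · exact (eq_eliminateTwo hS hne hθ hij hall).symm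

end GenericSection

/-! ### Legendrian fields dual to functions -/

section LegendrianField

variable {M : Type*} [TopologicalSpace M] [ChartedSpace (EuclideanSpace ℝ (Fin 3)) M]
  [IsManifold (𝓡 3) ∞ M] [T2Space M] {α : OneForm (𝓡 3) M}
  {P : Type*} [NormedAddCommGroup P] [NormedSpace ℝ P]

theorem OneForm.exists_d_eq_bilin (α : OneForm (𝓡 3) M) (x : M) :
    ∃ B : TangentSpace (𝓡 3) x →L[ℝ] TangentSpace (𝓡 3) x →L[ℝ] ℝ, ∀ v w, α.d x v w = B v w := by
  let L : EuclideanSpace ℝ (Fin 3) →L[ℝ] EuclideanSpace ℝ (Fin 3) →L[ℝ] ℝ :=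
    fderiv ℝ (α.inChart x) (extChartAt (𝓡 3) x x)
  exact ⟨(L - L.flip : EuclideanSpace ℝ (Fin 3) →L[ℝ] EuclideanSpace ℝ (Fin 3) →L[ℝ] ℝ), fun v w => rfl⟩

theorem OneForm.d_swap (α : OneForm (𝓡 3) M) (x : M) (v w : TangentSpace (𝓡 3) x) :
    α.d x v w = -α.d x w v := by
  simp only [OneForm.d]
  ring

/-- Such a vector satisfies the equations that characterise the contact field of the zero
Hamiltonian. -/
theorem OneForm.IsContact.eq_zero_of_forall_d_eq_zero (hα : α.IsContact) {x : M}
    {v : TangentSpace (𝓡 3) x} (hv : α x v = 0) (hd : ∀ w, α.d x v w = 0) : v = 0 := by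
  have h1 : v = contactField α (fun _ => 0) x := hα.eq_contactField (c := 0) hv fun w => by
    rw [hd, differential_const, zero_mul, zero_sub]
    exact neg_zero.symm
  rw [h1]
  exact hα.contactField_of_eventuallyEq_zero (Filter.Eventually.of_forall fun _ => rfl)

theorem OneForm.IsContact.contactField_eq_reebField (hα : α.IsContact) {h : M → ℝ} {x : M}
    (hh : h =ᶠ[𝓝 x] fun _ => 1) : contactField α h x = reebField α x := by
  refine (hα.eq_contactField (c := 0) ?_ fun w => ?_).symm
  · rw [(hα.reebField_spec x).1, hh.self_of_nhds]
  · rw [(hα.reebField_spec x).2, differential_congr hh, differential_const, zero_mul, zero_sub]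
    exact neg_zero.symm

/-- The vector field tangent to the contact structure that corresponds to the function `g` under
the symplectic duality on the contact planes. -/
def legendrianField (α : OneForm (𝓡 3) M) (g : M → ℝ) (x : M) : TangentSpace (𝓡 3) x :=
  g x • contactField α (fun _ => 1) x - contactField α g x

theorem OneForm.IsContact.apply_legendrianField (hα : α.IsContact) (g : M → ℝ) (x : M) :
    α x (legendrianField α g x) = 0 := by
  rw [legendrianField, map_sub, map_smul, (hα.contactField_spec _ x).1, (hα.contactField_spec g x).1,
    smul_eq_mul, mul_one, sub_self]

theorem OneForm.IsContact.d_legendrianField (hα : α.IsContact) (g : M → ℝ) (x : M)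
    (w : TangentSpace (𝓡 3) x) : α.d x (legendrianField α g x) w =
      differential g x w - differential g x (reebField α x) * α x w := by
  obtain ⟨B, hB⟩ := α.exists_d_eq_bilin x
  have h1 := (hα.reebField_spec x).2 w
  have h2 := (hα.contactField_spec g x).2 w
  rw [hB] at h1 h2 ⊢
  rw [legendrianField, hα.contactField_eq_reebField (Filter.Eventually.of_forall fun _ => rfl),
    map_sub, map_smul, sub_apply, smul_apply, h1, h2, smul_zero]
  ring

/-- Duality only has to be tested on ξ: the difference of two candidates lies in ξ and pairs to zero
with ξ and with the Reeb direction. Linearity of the field in g follows from this uniqueness. -/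
theorem OneForm.IsContact.eq_legendrianField (hα : α.IsContact) {g : M → ℝ} {x : M}
    {v : TangentSpace (𝓡 3) x} (hv : α x v = 0)
    (hd : ∀ w, α x w = 0 → α.d x v w = differential g x w) : v = legendrianField α g x := by
  obtain ⟨B, hB⟩ := α.exists_d_eq_bilin x
  rw [← sub_eq_zero]
  have h0 : α x (v - legendrianField α g x) = 0 := by
    rw [map_sub, hv, hα.apply_legendrianField, sub_zero]
  refine hα.eq_zero_of_forall_d_eq_zero h0 fun w => ?_
  have h1 : ∀ w, α x w = 0 → α.d x (v - legendrianField α g x) w = 0 := by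
    intro w hw
    have h2 := hd w hw
    have h3 := hα.d_legendrianField g x w
    rw [hB] at h2 h3 ⊢
    rw [map_sub, sub_apply, h2, h3, hw, mul_zero, sub_zero, sub_self]
  have h4 : α.d x (v - legendrianField α g x) (reebField α x) = 0 := by
    rw [α.d_swap, (hα.reebField_spec x).2, neg_zero]
  have h5 := h1 (w - α x w • reebField α x) (by
    rw [map_sub, map_smul, (hα.reebField_spec x).1, smul_eq_mul, mul_one, sub_self])
  rw [hB] at h4 h5 ⊢
  rw [map_sub, map_smul, h4, smul_zero, sub_zero] at h5
  exact h5

theorem OneForm.IsContact.legendrianField_sum (hα : α.IsContact) {ι : Type} [Fintype ι] (b : ι → ℝ)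
    {f : ι → M → ℝ} {x : M} (hf : ∀ i, MDifferentiableAt (𝓡 3) 𝓘(ℝ, ℝ) (f i) x) :
    legendrianField α (fun y => ∑ i, b i * f i y) x = ∑ i, b i • legendrianField α (f i) x := by
  obtain ⟨B, hB⟩ := α.exists_d_eq_bilin x
  refine (hα.eq_legendrianField ?_ fun w hw => ?_).symm
  · rw [map_sum]
    refine Finset.sum_eq_zero fun i _ => ?_
    rw [map_smul, hα.apply_legendrianField, smul_zero]
  · have h0 := differential_sum (s := Finset.univ) (f := fun i y => b i * f i y)
      (fun i _ => mdifferentiableAt_const.mul (hf i)) w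
    rw [h0, hB, map_sum, sum_apply]
    refine Finset.sum_congr rfl fun i _ => ?_
    have h1 := hα.d_legendrianField (f i) x w
    rw [hB] at h1
    rw [map_smul, smul_apply, h1, hw, differential_mul mdifferentiableAt_const (hf i),
      differential_const, smul_eq_mul]
    change b i * (_ - _ * 0) = b i * _ + _ * 0
    ring

theorem OneForm.IsContact.contMDiff_contactField_add_legendrianField (hα : α.IsContact)
    {h g : P × M → ℝ} (hh : ContMDiff (𝓘(ℝ, P).prod (𝓡 3)) 𝓘(ℝ, ℝ) ∞ h)
    (hg : ContMDiff (𝓘(ℝ, P).prod (𝓡 3)) 𝓘(ℝ, ℝ) ∞ g) :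
    ContMDiff (𝓘(ℝ, P).prod (𝓡 3)) (𝓡 3).tangent ∞ (fun q : P × M =>
      (⟨q.2, contactField α (fun x => h (q.1, x)) q.2 +
        legendrianField α (fun x => g (q.1, x)) q.2⟩ : TangentBundle (𝓡 3) M)) := by
  rintro ⟨p₀, x₀⟩
  have hx₀ : x₀ ∈ (chartAt (EuclideanSpace ℝ (Fin 3)) x₀).source := mem_chart_source _ x₀
  have h1 := (contMDiffAt_tangentBundle_iff (x₀ := x₀) hx₀).1 (hα.contMDiff_contactField hh (p₀, x₀))
  have h2 := (contMDiffAt_tangentBundle_iff (x₀ := x₀) hx₀).1 (hα.contMDiff_contactField hg (p₀, x₀))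
  have h3 := (contMDiffAt_tangentBundle_iff (x₀ := x₀) hx₀).1
    (hα.contMDiff_contactField (h := fun _ : P × M => 1) contMDiff_const (p₀, x₀))
  rw [contMDiffAt_tangentBundle_iff (x₀ := x₀) hx₀]
  refine ⟨contMDiffAt_snd, (h1.2.add (((hg (p₀, x₀)).smul h3.2).sub h2.2)).congr_of_eventuallyEq
    (Filter.Eventually.of_forall fun q => ?_)⟩
  change chartDeriv (𝓡 3) x₀ q.2 _ = chartDeriv (𝓡 3) x₀ q.2 _ + (g q • chartDeriv (𝓡 3) x₀ q.2 _ -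
    chartDeriv (𝓡 3) x₀ q.2 _)
  rw [legendrianField, map_add, map_sub, map_smul]

theorem OneForm.IsContact.contMDiff_differential_legendrianField (hα : α.IsContact)
    {f g : M → ℝ} (hf : ContMDiff (𝓡 3) 𝓘(ℝ, ℝ) ∞ f) (hg : ContMDiff (𝓡 3) 𝓘(ℝ, ℝ) ∞ g) :
    ContMDiff (𝓡 3) 𝓘(ℝ, ℝ) ∞ (fun x => differential f x (legendrianField α g x)) := by
  intro x
  have h1 := hα.contMDiff_contactField_add_legendrianField (P := ℝ) (h := fun _ => 0)
    (g := fun q => g q.2) contMDiff_const (hg.comp contMDiff_snd)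
  have h2 : ContMDiff (𝓡 3) (𝓡 3).tangent ∞ (fun x : M =>
      (⟨x, contactField α (fun _ => 0) x + legendrianField α g x⟩ : TangentBundle (𝓡 3) M)) :=
    h1.comp ((contMDiff_const (c := (0 : ℝ))).prodMk contMDiff_id)
  have h3 := contMDiffAt_differential (P := ℝ) (h := fun q => f q.2) (hf.comp contMDiff_snd)
    (p := fun _ => 0) contMDiffAt_const (h2 x)
  refine h3.congr_of_eventuallyEq (Filter.Eventually.of_forall fun y => ?_)
  change _ = differential f y (contactField α (fun _ => 0) y + legendrianField α g y)
  have h4 : contactField α (fun _ => 0) y = 0 :=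
    hα.contactField_of_eventuallyEq_zero (Filter.Eventually.of_forall fun _ => rfl)
  rw [h4, zero_add]

theorem OneForm.IsContact.contMDiff_differential_reebField (hα : α.IsContact)
    {f : M → ℝ} (hf : ContMDiff (𝓡 3) 𝓘(ℝ, ℝ) ∞ f) :
    ContMDiff (𝓡 3) 𝓘(ℝ, ℝ) ∞ (fun x => differential f x (reebField α x)) := by
  intro x
  have h1 := hα.contMDiff_contactField (P := ℝ) (h := fun _ => 1) contMDiff_const
  have h2 : ContMDiff (𝓡 3) (𝓡 3).tangent ∞ (fun x : M =>
      (⟨x, contactField α (fun _ => 1) x⟩ : TangentBundle (𝓡 3) M)) :=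
    h1.comp ((contMDiff_const (c := (0 : ℝ))).prodMk contMDiff_id)
  have h3 := contMDiffAt_differential (P := ℝ) (h := fun q => f q.2) (hf.comp contMDiff_snd)
    (p := fun _ => 0) contMDiffAt_const (h2 x)
  refine h3.congr_of_eventuallyEq (Filter.Eventually.of_forall fun y => ?_)
  change _ = differential f y (contactField α (fun _ => 1) y)
  rw [hα.contactField_eq_reebField (Filter.Eventually.of_forall fun _ => rfl)]

end LegendrianField

/-! ### Finitely many functions spanning the cotangent spaces along a compact set -/

section SpanningFunctions

variable {M : Type*} [TopologicalSpace M] [ChartedSpace (EuclideanSpace ℝ (Fin 3)) M]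
  [IsManifold (𝓡 3) ∞ M] [T2Space M] {α : OneForm (𝓡 3) M}

/-- Finitely many smooth functions with compact support whose differentials span the cotangent
spaces at the points of a compact set. -/
theorem exists_spanning_functions {K : Set M} (hK : IsCompact K) :
    ∃ (n : ℕ) (f : Fin n × Fin 3 → M → ℝ) (C : Set M), IsCompact C ∧
      (∀ i, ContMDiff (𝓡 3) 𝓘(ℝ, ℝ) ∞ (f i)) ∧ (∀ i x, x ∉ C → f i x = 0) ∧
      ∀ x ∈ K, ∀ w, (∀ i, differential (f i) x w = 0) → w = 0 := by
  let g : ∀ x : M, SmoothBumpFunction (𝓡 3) x := fun x => Classical.choice inferInstance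
  let f : M → Fin 3 → M → ℝ := fun x k y => g x y • (extChartAt (𝓡 3) x y) k
  have hf : ∀ x k, ContMDiff (𝓡 3) 𝓘(ℝ, ℝ) ∞ (f x k) := fun x k => by
    refine (g x).contMDiff_smul ?_
    have h1 : ContMDiff 𝓘(ℝ, EuclideanSpace ℝ (Fin 3)) 𝓘(ℝ, ℝ) ∞
        (fun y : EuclideanSpace ℝ (Fin 3) => y k) :=
      (EuclideanSpace.proj k : EuclideanSpace ℝ (Fin 3) →L[ℝ] ℝ).contDiff.contMDiff
    exact h1.comp_contMDiffOn contMDiffOn_extChartAt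
  have hspan : ∀ x y, g x =ᶠ[𝓝 y] 1 → ∀ w, (∀ k, differential (f x k) y w = 0) → w = 0 := by
    intro x y hy w hw
    have hys : y ∈ (chartAt (EuclideanSpace ℝ (Fin 3)) x).source := by
      refine (g x).support_subset_source ?_
      have h1 : g x y = 1 := hy.self_of_nhds
      rw [Function.mem_support, h1]
      exact one_ne_zero
    refine chartDeriv_injective hys ?_
    rw [map_zero]
    ext k
    have h1 : f x k =ᶠ[𝓝 y] fun y => (extChartAt (𝓡 3) x y) k := by
      filter_upwards [hy] with z hz
      have h2 : g x z = 1 := hz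
      simp only [f, h2, one_smul]
    refine Eq.trans ?_ ((differential_congr h1 w).symm.trans (hw k))
    have h3 := ((EuclideanSpace.proj k : EuclideanSpace ℝ (Fin 3) →L[ℝ] ℝ).hasFDerivAt
      (x := extChartAt (𝓡 3) x y)).hasMFDerivAt.comp y
      (mdifferentiableAt_extChartAt (I := 𝓡 3) hys).hasMFDerivAt
    exact (congrArg (fun L : EuclideanSpace ℝ (Fin 3) →L[ℝ] ℝ => L w) h3.mfderiv).symm
  obtain ⟨s, -, hs⟩ := hK.elim_nhds_subcover (fun x => {y | g x =ᶠ[𝓝 y] 1}) fun x _ =>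
    (g x).eventuallyEq_one.eventually_nhds
  refine ⟨s.card, fun i => f (s.equivFin.symm i.1) i.2, ⋃ x ∈ s, tsupport (g x),
    s.isCompact_biUnion fun x _ => (g x).hasCompactSupport.isCompact, fun i => hf _ _, ?_, ?_⟩
  · intro i x hx
    have h1 : g (s.equivFin.symm i.1) x = 0 := by
      by_contra h
      exact hx (mem_iUnion₂.2 ⟨_, (s.equivFin.symm i.1).2, subset_tsupport _ h⟩)
    simp only [f, h1, zero_smul]
  · intro x hx w hw
    obtain ⟨y, hy, hxy⟩ := mem_iUnion₂.1 (hs hx)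
    refine hspan y x hxy w fun k => ?_
    have := hw (s.equivFin ⟨y, hy⟩, k)
    simpa using this

/-- Where differentials span, the matrix of symplectic products of the dual Legendrian fields does
not vanish. -/
theorem OneForm.IsContact.exists_differential_legendrianField_ne_zero (hα : α.IsContact) {ι : Type*}
    {f : ι → M → ℝ} {x : M} (hf : ∀ w, (∀ i, differential (f i) x w = 0) → w = 0) :
    ∃ i j, differential (f i) x (legendrianField α (f j) x) ≠ 0 := by
  by_contra! hall
  have h1 : ∀ j, legendrianField α (f j) x = 0 := fun j => hf _ fun i => hall i j
  obtain ⟨w, hw, hw0⟩ : ∃ w : TangentSpace (𝓡 3) x, α x w = 0 ∧ w ≠ 0 := by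
    let a : EuclideanSpace ℝ (Fin 3) →L[ℝ] ℝ := α x
    have h2 : (a : EuclideanSpace ℝ (Fin 3) →ₗ[ℝ] ℝ).ker ≠ ⊥ :=
      LinearMap.ker_ne_bot_of_finrank_lt (by simp)
    obtain ⟨w, hw, hw0⟩ := Submodule.exists_mem_ne_zero_of_ne_bot h2
    exact ⟨w, hw, hw0⟩
  refine hw0 (hf w fun j => ?_)
  have h3 := hα.d_legendrianField (f j) x w
  rw [h1, α.d_zero_left, hw, mul_zero, sub_zero] at h3
  exact h3.symm

/-- Both sides are values of dα on the two Legendrian fields, in opposite order; this is the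
antisymmetry of the linear systems. -/
theorem OneForm.IsContact.differential_legendrianField_swap (hα : α.IsContact) (f g : M → ℝ) (x : M) :
    differential f x (legendrianField α g x) = -differential g x (legendrianField α f x) := by
  have h1 := hα.d_legendrianField f x (legendrianField α g x)
  have h2 := hα.d_legendrianField g x (legendrianField α f x)
  rw [hα.apply_legendrianField, mul_zero, sub_zero] at h1 h2
  rw [← h1, ← h2, α.d_swap]

end SpanningFunctions

/-! ### Parametrizations obtained from two successive flows -/

section TwoFlows

variable {E : Type*} [NormedAddCommGroup E] [NormedSpace ℝ E] [FiniteDimensional ℝ E]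
  {H : Type*} [TopologicalSpace H]
  {I : ModelWithCorners ℝ E H} [I.Boundaryless] {M : Type*} [TopologicalSpace M] [ChartedSpace H M]
  [IsManifold I ∞ M] [T2Space M]
  {E' : Type*} [NormedAddCommGroup E'] [NormedSpace ℝ E']
  {P : Type*} [NormedAddCommGroup P] [NormedSpace ℝ P] [FiniteDimensional ℝ P]

theorem hasMFDerivAt_comp_curve {Ψ : E' → M} {c : ℝ → E'} {v : E'} {t : ℝ}
    (hΨ : MDifferentiableAt 𝓘(ℝ, E') I Ψ (c t)) (hc : HasDerivAt c v t) :
    HasMFDerivAt 𝓘(ℝ, ℝ) I (fun r => Ψ (c r)) t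
      ((1 : ℝ →L[ℝ] ℝ).smulRight (mfderiv 𝓘(ℝ, E') I Ψ (c t) v)) := by
  refine (hΨ.hasMFDerivAt.comp t hc.hasFDerivAt.hasMFDerivAt).congr_mfderiv ?_
  refine ContinuousLinearMap.ext fun (r : ℝ) => ?_
  exact map_smul (mfderiv 𝓘(ℝ, E') I Ψ (c t)) r v

theorem mfderiv_apply_eq_of_curve {Ψ : E' → M} {c : ℝ → E'} {v : E'} {t : ℝ}
    {V : ∀ x : M, TangentSpace I x} {y : ℝ → M}
    (hΨ : MDifferentiableAt 𝓘(ℝ, E') I Ψ (c t)) (hc : HasDerivAt c v t) (hy : y = fun r => Ψ (c r))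
    (h : HasMFDerivAt 𝓘(ℝ, ℝ) I y t ((1 : ℝ →L[ℝ] ℝ).smulRight (V (y t)))) :
    mfderiv 𝓘(ℝ, E') I Ψ (c t) v = V (Ψ (c t)) := by
  subst hy
  have h1 := hasMFDerivAt_unique (hasMFDerivAt_comp_curve hΨ hc) h
  have h2 := congrArg (fun L : ℝ →L[ℝ] E => L 1) h1
  exact (one_smul ℝ (mfderiv 𝓘(ℝ, E') I Ψ (c t) v : E)).symm.trans
    (h2.trans (one_smul ℝ (V (Ψ (c t)) : E)))

/-- Moves a curve `Γ` by the flow of the field `V p₀` and then by the flows of the fields `V (p₁ θ)`. -/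
theorem exists_flow_parametrization {V : P → ∀ x : M, TangentSpace I x}
    (hV : ContMDiff (𝓘(ℝ, P).prod I) I.tangent ∞
      (fun q : P × M => (⟨q.2, V q.1 q.2⟩ : TangentBundle I M)))
    {J : Set P} (hJ : IsCompact J) {C : Set M} (hC : IsCompact C)
    (hVJ : ∀ p x, p ∉ J → V p x = 0) (hVC : ∀ p x, x ∉ C → V p x = 0)
    {Γ : ℝ → M} (hΓ : ContMDiff 𝓘(ℝ, ℝ) I ∞ Γ) (p₀ : P) {p₁ : ℝ → P} (hp₁ : ContDiff ℝ ∞ p₁) {T : ℝ}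
    (hΓT : Function.Periodic Γ T) (hp₁T : Function.Periodic p₁ T) :
    ∃ Ψ : ℝ × ℝ × ℝ → M, ContMDiff 𝓘(ℝ, ℝ × ℝ × ℝ) I ∞ Ψ ∧
      (∀ θ y, Ψ (θ + T, y) = Ψ (θ, y)) ∧ (Γ = fun θ => Ψ (θ, 0, 0)) ∧
      (∀ q, mfderiv 𝓘(ℝ, ℝ × ℝ × ℝ) I Ψ q ((0, 0, 1) : ℝ × ℝ × ℝ) = V (p₁ q.1) (Ψ q)) ∧
      ∀ θ, mfderiv 𝓘(ℝ, ℝ × ℝ × ℝ) I Ψ (θ, 0, 0) ((0, 1, 0) : ℝ × ℝ × ℝ) = V p₀ (Ψ (θ, 0, 0)) := by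
  obtain ⟨Φ, hΦ, hΦ0, hΦ', -⟩ := exists_parametrizedFlow (0 : P) hV hJ hC hVJ hVC
  have hΦ'' : ∀ p x s, HasMFDerivAt 𝓘(ℝ, ℝ) I (fun r => Φ r p x) s
      ((1 : ℝ →L[ℝ] ℝ).smulRight (V p (Φ s p x))) := by
    intro p x s
    have := hΦ' p x s
    rwa [smul_zero, add_zero] at this
  let Ψ : ℝ × ℝ × ℝ → M := fun q => Φ q.2.2 (p₁ q.1) (Φ q.2.1 p₀ (Γ q.1))
  have hΨ : ContMDiff 𝓘(ℝ, ℝ × ℝ × ℝ) I ∞ Ψ := by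
    have h1 : ContMDiff 𝓘(ℝ, ℝ × ℝ × ℝ) 𝓘(ℝ, ℝ) ∞ (fun q : ℝ × ℝ × ℝ => q.1) := contDiff_fst.contMDiff
    have h2 : ContMDiff 𝓘(ℝ, ℝ × ℝ × ℝ) 𝓘(ℝ, ℝ) ∞ (fun q : ℝ × ℝ × ℝ => q.2.1) :=
      contDiff_snd.fst.contMDiff
    have h3 : ContMDiff 𝓘(ℝ, ℝ × ℝ × ℝ) 𝓘(ℝ, ℝ) ∞ (fun q : ℝ × ℝ × ℝ => q.2.2) :=
      contDiff_snd.snd.contMDiff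
    have h4 : ContMDiff 𝓘(ℝ, ℝ × ℝ × ℝ) I ∞ (fun q : ℝ × ℝ × ℝ => Φ q.2.1 p₀ (Γ q.1)) :=
      hΦ.comp (h2.prodMk (contMDiff_const.prodMk (hΓ.comp h1)))
    exact hΦ.comp (h3.prodMk ((hp₁.contMDiff.comp h1).prodMk h4))
  have hΨd : ∀ q, MDifferentiableAt 𝓘(ℝ, ℝ × ℝ × ℝ) I Ψ q := hΨ.mdifferentiable (by simp)
  refine ⟨Ψ, hΨ, fun θ y => ?_, ?_, fun q => ?_, fun θ => ?_⟩
  · simp only [Ψ, hΓT θ, hp₁T θ]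
  · funext θ
    simp only [Ψ, hΦ0]
  · obtain ⟨θ, z, s⟩ := q
    refine mfderiv_apply_eq_of_curve (c := fun r => (θ, z, r)) (t := s) (hΨd _) ?_ rfl (hΦ'' _ _ _)
    exact (hasDerivAt_const s θ).prodMk ((hasDerivAt_const s z).prodMk (hasDerivAt_id s))
  · refine mfderiv_apply_eq_of_curve (c := fun r => (θ, r, 0)) (t := 0)
      (y := fun r => Φ r p₀ (Γ θ)) (hΨd _) ?_ ?_ (hΦ'' _ _ _)
    · exact (hasDerivAt_const 0 θ).prodMk ((hasDerivAt_id 0).prodMk (hasDerivAt_const 0 0))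
    · funext r
      simp only [Ψ, hΦ0]

end TwoFlows

/-! ### A twisting parametrization around a knot -/

section KnotParametrization

variable {M : Type*} [TopologicalSpace M] [ChartedSpace (EuclideanSpace ℝ (Fin 3)) M]
  [IsManifold (𝓡 3) ∞ M] [T2Space M] {α : OneForm (𝓡 3) M}

theorem OneForm.pullback_add {E' : Type*} [NormedAddCommGroup E'] [NormedSpace ℝ E']
    (α : OneForm (𝓡 3) M) {Ψ : E' → M} {c : E'} (hΨ : MDifferentiable 𝓘(ℝ, E') (𝓡 3) Ψ)
    (hc : ∀ q, Ψ (q + c) = Ψ q) (q : E') : α.pullback Ψ (q + c) = α.pullback Ψ q := by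
  have h1 : (fun r => Ψ (r + c)) = Ψ := funext hc
  have h2 := ((hΨ (q + c)).hasMFDerivAt.comp (f := fun r => r + c) q
    ((hasFDerivAt_id q).add_const c).hasMFDerivAt).mfderiv
  have h3 : α.pullback (fun r => Ψ (r + c)) q = α.pullback Ψ (q + c) :=
    ContinuousLinearMap.ext fun u =>
      congrArg (fun L : E' →L[ℝ] EuclideanSpace ℝ (Fin 3) =>
        (α (Ψ (q + c)) : EuclideanSpace ℝ (Fin 3) →L[ℝ] ℝ) (L u)) h2
  rw [← h3, h1]

theorem mfderiv_comp_fst_line {Ψ : ℝ × ℝ × ℝ → M} (hΨ : MDifferentiable 𝓘(ℝ, ℝ × ℝ × ℝ) (𝓡 3) Ψ)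
    {Γ : ℝ → M} (hΓ : Γ = fun θ => Ψ (θ, 0, 0)) (θ : ℝ) :
    (mfderiv 𝓘(ℝ, ℝ) (𝓡 3) Γ θ (1 : ℝ) : EuclideanSpace ℝ (Fin 3)) =
      mfderiv 𝓘(ℝ, ℝ × ℝ × ℝ) (𝓡 3) Ψ (θ, 0, 0) ((1, 0, 0) : ℝ × ℝ × ℝ) := by
  subst hΓ
  have hc : HasDerivAt (fun r : ℝ => (r, (0 : ℝ), (0 : ℝ))) (1, 0, 0) θ :=
    (hasDerivAt_id θ).prodMk ((hasDerivAt_const θ 0).prodMk (hasDerivAt_const θ 0))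
  have h1 := (hasMFDerivAt_comp_curve (c := fun r : ℝ => (r, (0 : ℝ), (0 : ℝ))) (hΨ _) hc).mfderiv
  refine (congrArg (fun L : ℝ →L[ℝ] EuclideanSpace ℝ (Fin 3) => L 1) h1).trans ?_
  exact one_smul ℝ (mfderiv 𝓘(ℝ, ℝ × ℝ × ℝ) (𝓡 3) Ψ (θ, 0, 0) ((1, 0, 0) : ℝ × ℝ × ℝ) :
    EuclideanSpace ℝ (Fin 3))

theorem deriv_comp_curve {f : M → ℝ} {Γ : ℝ → M} {θ : ℝ} (hf : MDifferentiableAt (𝓡 3) 𝓘(ℝ, ℝ) f (Γ θ))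
    (hΓ : MDifferentiableAt 𝓘(ℝ, ℝ) (𝓡 3) Γ θ) :
    deriv (fun r => f (Γ r)) θ = differential f (Γ θ) (mfderiv 𝓘(ℝ, ℝ) (𝓡 3) Γ θ (1 : ℝ)) := by
  have h1 := hf.hasMFDerivAt.comp θ hΓ.hasMFDerivAt
  have h2 : HasFDerivAt (fun r => f (Γ r)) (show ℝ →L[ℝ] ℝ from
    (differential f (Γ θ)).comp (mfderiv 𝓘(ℝ, ℝ) (𝓡 3) Γ θ)) θ := hasMFDerivAt_iff_hasFDerivAt.1 h1
  exact h2.hasDerivAt.deriv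

/-- The z-direction on the axis is R + Σ b_l X_l, where X_l is the Legendrian field dual to f_l, and
the s-direction is Σ a_k X_k. With η = γ' - α(γ') ∂_z in ξ, the choice a_k = -df_k(η) gives dα(∂_s,
η) = Σ a_k df_k(η) = -Σ a_k². This is negative once η ≠ 0, which the generic choice of b guarantees.
-/
theorem OneForm.IsContact.exists_knot_parametrization [SecondCountableTopology M] (hα : α.IsContact)
    {Γ : ℝ → M} (hΓ : ContMDiff 𝓘(ℝ, ℝ) (𝓡 3) ∞ Γ) {T : ℝ} (hT : 0 < T) (hΓT : Function.Periodic Γ T)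
    (himm : ∀ θ, mfderiv 𝓘(ℝ, ℝ) (𝓡 3) Γ θ (1 : ℝ) ≠ 0) :
    ∃ Ψ : ℝ × ℝ × ℝ → M, ContMDiff 𝓘(ℝ, ℝ × ℝ × ℝ) (𝓡 3) ∞ Ψ ∧
      (∀ θ y, Ψ (θ + T, y) = Ψ (θ, y)) ∧ (Γ = fun θ => Ψ (θ, 0, 0)) ∧
      (∀ q, α.pullback Ψ q (0, 0, 1) = 0) ∧ (∀ θ, α.pullback Ψ (θ, 0, 0) (0, 1, 0) = 1) ∧
      ∀ θ, fderiv ℝ (α.pullback Ψ) (θ, 0, 0) (0, 0, 1) (1, -α.pullback Ψ (θ, 0, 0) (1, 0, 0), 0) -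
        fderiv ℝ (α.pullback Ψ) (θ, 0, 0) (1, -α.pullback Ψ (θ, 0, 0) (1, 0, 0), 0) (0, 0, 1) < 0 := by
  have : LocallyCompactSpace M := ChartedSpace.locallyCompactSpace (EuclideanSpace ℝ (Fin 3)) M
  have hK : IsCompact (range Γ) := by
    rw [← hΓT.image_Icc hT 0]
    exact isCompact_Icc.image hΓ.continuous
  obtain ⟨n, f, C, hC, hf, hfC, hspan⟩ := exists_spanning_functions hK
  have hfd : ∀ k x, MDifferentiableAt (𝓡 3) 𝓘(ℝ, ℝ) (f k) x := fun k => (hf k).mdifferentiable (by simp)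
  obtain ⟨L, hL, hKL⟩ := exists_compact_superset hK
  obtain ⟨χ, hχ0, hχ1, -⟩ := exists_contMDiffMap_zero_one_nhds_of_isClosed (𝓡 3) (n := ⊤)
    isOpen_interior.isClosed_compl hK.isClosed (disjoint_compl_left_iff_subset.2 hKL)
  have hχL : ∀ x, x ∉ L → χ x = 0 := fun x hx =>
    hχ0.self_of_nhdsSet x fun h => hx (interior_subset h)
  have hχK : ∀ θ, ∀ᶠ x in 𝓝 (Γ θ), χ x = 1 := fun θ =>
    Filter.eventually_iff.2 (mem_nhdsSet_iff_forall.1 hχ1 _ (mem_range_self θ))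
  -- the matrix and the right-hand side of the linear systems to be avoided
  let h : ℝ → ℝ := fun θ => α.pullback Γ θ 1
  let R : Fin n × Fin 3 → M → ℝ := fun k x => differential (f k) x (reebField α x)
  let S : Fin n × Fin 3 → Fin n × Fin 3 → M → ℝ := fun k l x =>
    differential (f k) x (legendrianField α (f l) x)
  let D : Fin n × Fin 3 → ℝ → ℝ := fun k θ => deriv (fun r => f k (Γ r)) θ - h θ * R k (Γ θ)
  have hh : ContDiff ℝ ∞ h := contDiff_iff_contDiffAt.2 fun θ =>
    (hα.1.contDiffAt_pullback (hΓ θ)).clm_apply contDiffAt_const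
  have hfΓ : ∀ k, ContDiff ℝ ∞ (fun r => f k (Γ r)) := fun k => ((hf k).comp hΓ).contDiff
  have hRΓ : ∀ k, ContDiff ℝ ∞ (fun θ => R k (Γ θ)) := fun k =>
    ((hα.contMDiff_differential_reebField (hf k)).comp hΓ).contDiff
  have hSΓ : ∀ k l, ContDiff ℝ ∞ (fun θ => S k l (Γ θ)) := fun k l =>
    ((hα.contMDiff_differential_legendrianField (hf k) (hf l)).comp hΓ).contDiff
  have hD : ∀ k, ContDiff ℝ ∞ (D k) := fun k =>
    ((contDiff_infty_iff_deriv.1 (hfΓ k)).2).sub (hh.mul (hRΓ k))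
  -- The k-th equation of the system says df_k(γ') = α(γ') df_k(R + Σ b_l X_l). As the differentials
  -- span, the whole system expresses η = 0.
  obtain ⟨b, hb⟩ := exists_forall_ne_antisymm_system (h := h) (D := D)
    (S := fun k l θ => S k l (Γ θ)) (hh.differentiable (by simp))
    (fun k => (hD k).differentiable (by simp)) (fun k l => (hSΓ k l).differentiable (by simp))
    (fun k l θ => hα.differential_legendrianField_swap (f k) (f l) (Γ θ))
    (fun θ => hα.exists_differential_legendrianField_ne_zero (hspan _ (mem_range_self θ)))
  -- This is -df_k(η), written without reference to η because the fields have to exist before Ψ and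
  -- η do.
  let a : ℝ → Fin n × Fin 3 → ℝ := fun θ k => -(D k θ - h θ * ∑ l, S k l (Γ θ) * b l)
  have ha : ContDiff ℝ ∞ a := contDiff_pi.2 fun k =>
    ((hD k).sub (hh.mul (ContDiff.sum fun l _ => (hSΓ k l).mul contDiff_const))).neg
  have haT : Function.Periodic a T := by
    intro θ
    have h1 : h (θ + T) = h θ :=
      congrArg (fun L : ℝ →L[ℝ] ℝ => L 1) (α.pullback_add (hΓ.mdifferentiable (by simp)) hΓT θ)
    have h2 : ∀ k, deriv (fun r => f k (Γ r)) (θ + T) = deriv (fun r => f k (Γ r)) θ := fun k => by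
      rw [← deriv_comp_add_const]
      simp only [hΓT _]
    funext k
    simp only [a, D, h1, h2, hΓT θ]
  -- the family of vector fields
  obtain ⟨r, hr0, hrb, hra⟩ : ∃ r : ℝ, 0 < r ∧ ‖(b, (1 : ℝ))‖ ≤ r ∧ ∀ θ, ‖(a θ, (0 : ℝ))‖ ≤ r := by
    have h1 : IsCompact (range a) := by
      rw [← haT.image_Icc hT 0]
      exact isCompact_Icc.image ha.continuous
    obtain ⟨r, hr⟩ := h1.isBounded.exists_norm_le
    refine ⟨max 1 (max ‖(b, (1 : ℝ))‖ r), lt_max_of_lt_left one_pos,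
      (le_max_left _ _).trans (le_max_right _ _), fun θ => ?_⟩
    rw [Prod.norm_mk, norm_zero]
    exact max_le ((hr _ (mem_range_self θ)).trans ((le_max_right _ _).trans (le_max_right _ _)))
      (zero_le_one.trans (le_max_left _ _))
  -- The flow theorem asks for compact support in the parameters as well. All parameters in use, (b,
  -- 1) and (a θ, 0), have norm at most r, where β = 1.
  let β : ContDiffBump (0 : (Fin n × Fin 3 → ℝ) × ℝ) := ⟨r, r + 1, hr0, by linarith⟩
  have hβ1 : ∀ p, ‖p‖ ≤ r → β p = 1 := fun p hp =>
    β.one_of_mem_closedBall (mem_closedBall_zero_iff.2 hp)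
  let u : ((Fin n × Fin 3 → ℝ) × ℝ) × M → ℝ := fun q => β q.1 * (q.1.2 * χ q.2)
  let v : ((Fin n × Fin 3 → ℝ) × ℝ) × M → ℝ := fun q => β q.1 * ∑ k, q.1.1 k * f k q.2
  have hβ : ContMDiff (𝓘(ℝ, (Fin n × Fin 3 → ℝ) × ℝ).prod (𝓡 3)) 𝓘(ℝ, ℝ) ∞
      (fun q : ((Fin n × Fin 3 → ℝ) × ℝ) × M => β q.1) := β.contDiff.contMDiff.comp contMDiff_fst
  have hu : ContMDiff (𝓘(ℝ, (Fin n × Fin 3 → ℝ) × ℝ).prod (𝓡 3)) 𝓘(ℝ, ℝ) ∞ u :=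
    hβ.mul ((contDiff_snd.contMDiff.comp contMDiff_fst).mul (χ.contMDiff.comp contMDiff_snd))
  have hv : ContMDiff (𝓘(ℝ, (Fin n × Fin 3 → ℝ) × ℝ).prod (𝓡 3)) 𝓘(ℝ, ℝ) ∞ v := by
    refine hβ.mul (ContMDiff.sum fun k _ => ContMDiff.mul ?_ ((hf k).comp contMDiff_snd))
    have h1 : ContDiff ℝ ∞ (fun p : (Fin n × Fin 3 → ℝ) × ℝ => p.1 k) :=
      (contDiff_apply ℝ ℝ k).comp contDiff_fst
    exact h1.contMDiff.comp contMDiff_fst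
  let V : (Fin n × Fin 3 → ℝ) × ℝ → ∀ x : M, TangentSpace (𝓡 3) x := fun p x =>
    contactField α (fun y => u (p, y)) x + legendrianField α (fun y => v (p, y)) x
  have hV0 : ∀ p x, (∀ᶠ y in 𝓝 x, u (p, y) = 0) → (∀ᶠ y in 𝓝 x, v (p, y) = 0) → V p x = 0 := by
    intro p x h1 h2
    have h3 : v (p, x) = 0 := h2.self_of_nhds
    simp only [V, legendrianField]
    rw [hα.contactField_of_eventuallyEq_zero h1, hα.contactField_of_eventuallyEq_zero h2, h3,
      zero_smul, sub_zero, add_zero]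
  have hVJ : ∀ p x, p ∉ Metric.closedBall (0 : (Fin n × Fin 3 → ℝ) × ℝ) (r + 1) → V p x = 0 := by
    intro p x hp
    have h1 : β p = 0 := β.zero_of_le_dist (le_of_lt (not_le.1 hp))
    refine hV0 p x (Filter.Eventually.of_forall fun y => ?_) (Filter.Eventually.of_forall fun y => ?_)
    · simp only [u, h1, zero_mul]
    · simp only [v, h1, zero_mul]
  have hVC : ∀ p x, x ∉ L ∪ C → V p x = 0 := by
    intro p x hx
    have h1 := (hL.union hC).isClosed.isOpen_compl.mem_nhds hx
    refine hV0 p x (Filter.mem_of_superset h1 fun y hy => ?_)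
      (Filter.mem_of_superset h1 fun y hy => ?_)
    · change u (p, y) = 0
      simp only [u, hχL y fun h => hy (Or.inl h), mul_zero]
    · change v (p, y) = 0
      simp only [v, hfC _ y fun h => hy (Or.inr h), mul_zero, Finset.sum_const_zero]
  have hVα : ∀ p x, α x (V p x) = u (p, x) := fun p x => by
    simp only [V]
    rw [map_add, hα.apply_legendrianField, (hα.contactField_spec _ x).1, add_zero]
  have hVa : ∀ θ x w, α x w = 0 →
      α.d x (V (a θ, 0) x) w = ∑ k, a θ k * differential (f k) x w := by
    intro θ x w hw
    have h1 : contactField α (fun y => u ((a θ, 0), y)) x = 0 :=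
      hα.contactField_of_eventuallyEq_zero (Filter.Eventually.of_forall fun y => by simp [u])
    have h2 : (fun y => v ((a θ, 0), y)) = fun y => ∑ k, a θ k * f k y := by
      funext y
      simp only [v, hβ1 _ (hra θ), one_mul]
    obtain ⟨B, hB⟩ := α.exists_d_eq_bilin x
    have h3 : ∀ k, B (legendrianField α (f k) x) w = differential (f k) x w := fun k => by
      rw [← hB, hα.d_legendrianField, hw, mul_zero, sub_zero]
    simp only [V]
    rw [h1, h2, zero_add, hα.legendrianField_sum (a θ) fun k => hfd k x, hB, map_sum, sum_apply]
    refine Finset.sum_congr rfl fun k _ => ?_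
    rw [map_smul, smul_apply, h3, smul_eq_mul]
  have hVb : ∀ θ k, differential (f k) (Γ θ) (V (b, 1) (Γ θ)) =
      R k (Γ θ) + ∑ l, S k l (Γ θ) * b l := by
    intro θ k
    have h1 : contactField α (fun y => u ((b, 1), y)) (Γ θ) = reebField α (Γ θ) := by
      refine hα.contactField_eq_reebField ?_
      filter_upwards [hχK θ] with y hy
      simp only [u, hβ1 _ hrb, hy, one_mul]
    have h2 : (fun y => v ((b, 1), y)) = fun y => ∑ k, b k * f k y := by
      funext y
      simp only [v, hβ1 _ hrb, one_mul]
    simp only [V]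
    rw [h1, h2, hα.legendrianField_sum b fun k => hfd k (Γ θ), map_add, map_sum]
    refine congrArg₂ (· + ·) rfl (Finset.sum_congr rfl fun l _ => ?_)
    rw [map_smul, smul_eq_mul, mul_comm]
  obtain ⟨Ψ, hΨ, hΨT, hΨΓ, hΨs, hΨz⟩ := exists_flow_parametrization
    (hα.contMDiff_contactField_add_legendrianField hu hv)
    (isCompact_closedBall (0 : (Fin n × Fin 3 → ℝ) × ℝ) (r + 1)) (hL.union hC) hVJ hVC hΓ (b, 1)
    (p₁ := fun θ => (a θ, 0)) (ha.prodMk contDiff_const) hΓT (fun θ => by simp only [haT θ])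
  have hΨd : MDifferentiable 𝓘(ℝ, ℝ × ℝ × ℝ) (𝓡 3) Ψ := hΨ.mdifferentiable (by simp)
  have hpt : ∀ θ, Γ θ = Ψ (θ, 0, 0) := fun θ => congrFun hΨΓ θ
  have hz : ∀ θ, α.pullback Ψ (θ, 0, 0) (0, 1, 0) = 1 := fun θ => by
    refine (congrArg (α (Ψ (θ, 0, 0))) (hΨz θ)).trans ((hVα _ _).trans ?_)
    have h1 : χ (Ψ (θ, 0, 0)) = 1 := by
      rw [← hpt]
      exact (hχK θ).self_of_nhds
    simp only [u, hβ1 _ hrb, h1, mul_one]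
  refine ⟨Ψ, hΨ, hΨT, hΨΓ, fun q => ?_, hz, fun θ => ?_⟩
  · refine (congrArg (α (Ψ q)) (hΨs q)).trans ((hVα _ _).trans ?_)
    simp only [u, zero_mul, mul_zero]
  have hhθ : h θ = α.pullback Ψ (θ, 0, 0) (1, 0, 0) :=
    (congrArg (α (Γ θ) : EuclideanSpace ℝ (Fin 3) →L[ℝ] ℝ) (mfderiv_comp_fst_line hΨd hΨΓ θ)).trans
      (congrArg (fun L : EuclideanSpace ℝ (Fin 3) →L[ℝ] ℝ => L _) (α.congr_point (hpt θ)))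
  rw [hα.1.fderiv_pullback (hΨ _), ← hhθ]
  set η : TangentSpace (𝓡 3) (Ψ (θ, 0, 0)) :=
    mfderiv 𝓘(ℝ, ℝ × ℝ × ℝ) (𝓡 3) Ψ (θ, 0, 0) ((1, -h θ, 0) : ℝ × ℝ × ℝ) with hη
  have hη' : η = mfderiv 𝓘(ℝ, ℝ × ℝ × ℝ) (𝓡 3) Ψ (θ, 0, 0) ((1, 0, 0) : ℝ × ℝ × ℝ) -
      h θ • V (b, 1) (Ψ (θ, 0, 0)) := by
    let L : ℝ × ℝ × ℝ →L[ℝ] EuclideanSpace ℝ (Fin 3) := mfderiv 𝓘(ℝ, ℝ × ℝ × ℝ) (𝓡 3) Ψ (θ, 0, 0)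
    have h1 : L (1, -h θ, 0) = L (1, 0, 0) - h θ • L (0, 1, 0) := by
      rw [← map_smul, ← map_sub]
      simp
    rw [← hΨz θ]
    exact h1
  have hαη : α (Ψ (θ, 0, 0)) η = 0 := by
    rw [hη', map_sub, map_smul, ← hΨz θ]
    have h1 : h θ - h θ * α.pullback Ψ (θ, 0, 0) (0, 1, 0) = 0 := by rw [hz, mul_one, sub_self]
    exact (congrArg (· - h θ * α.pullback Ψ (θ, 0, 0) (0, 1, 0)) hhθ.symm).trans h1
  have hdη : ∀ k, differential (f k) (Ψ (θ, 0, 0)) η = -a θ k := fun k => by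
    have h1 : differential (f k) (Ψ (θ, 0, 0))
        (mfderiv 𝓘(ℝ, ℝ × ℝ × ℝ) (𝓡 3) Ψ (θ, 0, 0) ((1, 0, 0) : ℝ × ℝ × ℝ)) =
        deriv (fun r => f k (Γ r)) θ := by
      rw [deriv_comp_curve (hfd k _) (hΓ.mdifferentiable (by simp) θ)]
      have h2 : ∀ x y : M, x = y → (differential (f k) x : EuclideanSpace ℝ (Fin 3) →L[ℝ] ℝ) =
        differential (f k) y := by rintro x _ rfl; rfl
      exact (congrArg (differential (f k) (Ψ (θ, 0, 0)) : EuclideanSpace ℝ (Fin 3) →L[ℝ] ℝ)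
        (mfderiv_comp_fst_line hΨd hΨΓ θ).symm).trans
        (congrArg (fun L : EuclideanSpace ℝ (Fin 3) →L[ℝ] ℝ => L _) (h2 _ _ (hpt θ)).symm)
    have h3 := hVb θ k
    rw [hpt] at h3
    rw [hη', map_sub, map_smul, h1, h3, smul_eq_mul]
    simp only [a, D, hpt]
    ring
  -- Where α(γ') = 0, η is γ' itself and immersivity suffices; elsewhere the genericity of b is
  -- used.
  have hne : ∃ k, a θ k ≠ 0 := by
    by_cases h0 : h θ = 0
    · by_contra! hall
      have h1 : η = 0 := hspan _ ⟨θ, hpt θ⟩ η fun k => by rw [hdη, hall, neg_zero]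
      rw [hη', h0, zero_smul, sub_zero] at h1
      exact himm θ ((mfderiv_comp_fst_line hΨd hΨΓ θ).trans h1)
    · obtain ⟨k, hk⟩ := hb θ h0
      exact ⟨k, neg_ne_zero.2 (sub_ne_zero.2 hk)⟩
  rw [hΨs, hVa _ _ _ hαη]
  obtain ⟨k, hk⟩ := hne
  have h1 : ∑ k, a θ k * differential (f k) (Ψ (θ, 0, 0)) η = -∑ k, a θ k ^ 2 := by
    rw [← Finset.sum_neg_distrib]
    refine Finset.sum_congr rfl fun k _ => ?_
    rw [hdη]
    ring
  rw [h1, neg_lt_zero]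
  exact Finset.sum_pos' (fun k _ => sq_nonneg _) ⟨k, Finset.mem_univ k, by positivity⟩

end KnotParametrization

/-! ### Local inverses of the parametrization -/

section LocalSections

variable {M : Type*} [TopologicalSpace M] [ChartedSpace (EuclideanSpace ℝ (Fin 3)) M]
  [IsManifold (𝓡 3) ∞ M]

theorem exists_contMDiffAt_local_section {Ψ : ℝ × ℝ × ℝ → M}
    (hΨ : ContMDiff 𝓘(ℝ, ℝ × ℝ × ℝ) (𝓡 3) ∞ Ψ) {q : ℝ × ℝ × ℝ}
    (hinj : ∀ u : ℝ × ℝ × ℝ, mfderiv 𝓘(ℝ, ℝ × ℝ × ℝ) (𝓡 3) Ψ q u = 0 → u = 0) :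
    ∃ σ : M → ℝ × ℝ × ℝ, ContMDiffAt (𝓡 3) 𝓘(ℝ, ℝ × ℝ × ℝ) ∞ σ (Ψ q) ∧ σ (Ψ q) = q ∧
      (∀ᶠ x in 𝓝 (Ψ q), Ψ (σ x) = x) ∧ ∃ V ∈ 𝓝 q, InjOn Ψ V := by
  let κ := extChartAt (𝓡 3) (Ψ q)
  let S : Set M := (chartAt (EuclideanSpace ℝ (Fin 3)) (Ψ q)).source
  have hS : IsOpen S := (chartAt (EuclideanSpace ℝ (Fin 3)) (Ψ q)).open_source
  have hqS : Ψ q ∈ S := mem_chart_source _ _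
  have hκS : κ.source = S := extChartAt_source (I := 𝓡 3) (Ψ q)
  let f : ℝ × ℝ × ℝ → EuclideanSpace ℝ (Fin 3) := fun q' => κ (Ψ q')
  have hf : ∀ q' ∈ Ψ ⁻¹' S, ContDiffAt ℝ ∞ f q' := fun q' hq' =>
    contDiffAt_extChartAt_comp (Ψ q) hq' (hΨ q')
  have hfd : ∀ u, fderiv ℝ f q u = 0 → u = 0 := fun u hu => by
    refine hinj u (chartDeriv_injective hqS ?_)
    rw [chartDeriv_mfderiv hqS (hΨ.mdifferentiable (by simp) q), map_zero]
    exact hu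
  let L := ((fderiv ℝ f q : ℝ × ℝ × ℝ →ₗ[ℝ] EuclideanSpace ℝ (Fin 3)).linearEquivOfInjective
    ((injective_iff_map_eq_zero _).2 hfd) (by simp)).toContinuousLinearEquiv
  have hL : HasFDerivAt f (L : ℝ × ℝ × ℝ →L[ℝ] EuclideanSpace ℝ (Fin 3)) q := by
    have h1 : (L : ℝ × ℝ × ℝ →L[ℝ] EuclideanSpace ℝ (Fin 3)) = fderiv ℝ f q := by
      exact ContinuousLinearMap.ext fun u => rfl
    rw [h1]
    exact ((hf q hqS).differentiableAt (by simp)).hasFDerivAt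
  obtain ⟨e, hqe, heS, hef, hes⟩ := exists_contDiffOn_localInverse (hS.preimage hΨ.continuous)
    (fun q' hq' => (hf q' hq').contDiffWithinAt) hqS L hL
  have hκq : κ (Ψ q) = e q := (hef q).symm
  have hT : κ (Ψ q) ∈ e.target := by rw [hκq]; exact e.map_source hqe
  refine ⟨fun x => e.symm (κ x), ?_, ?_, ?_, e.source, e.open_source.mem_nhds hqe, ?_⟩
  · exact ContMDiffAt.comp (Ψ q) (hes.contDiffAt (e.open_target.mem_nhds hT)).contMDiffAt
      (contMDiffAt_extChartAt' hqS)
  · change e.symm (κ (Ψ q)) = q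
    rw [hκq, e.left_inv hqe]
  · filter_upwards [hS.mem_nhds hqS,
      (continuousAt_extChartAt (I := 𝓡 3) (Ψ q)).preimage_mem_nhds (e.open_target.mem_nhds hT)] with x hx hxT
    refine κ.injOn ?_ (by rwa [hκS]) ?_
    · rw [hκS]
      exact heS (e.map_target hxT)
    · exact (hef _).symm.trans (e.right_inv hxT)
  · intro q₁ h₁ q₂ h₂ h
    refine e.injOn h₁ h₂ ?_
    rw [hef, hef]
    exact congrArg κ h

end LocalSections

/-! ### Injectivity near the axis up to the period -/

section CircleTube

theorem eq_of_circle_exp_eq {X : Type*} {F : ℝ × ℝ × ℝ → X} {q q' : ℝ × ℝ × ℝ}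
    (hF : ∀ θ y, F (θ + 2 * Real.pi, y) = F (θ, y)) (h₁ : Circle.exp q.1 = Circle.exp q'.1)
    (h₂ : q.2 = q'.2) : F q = F q' := by
  obtain ⟨m, hm⟩ := Circle.exp_eq_exp.1 h₁
  have h3 : Function.Periodic (fun θ => F (θ, q'.2)) (2 * Real.pi) := fun θ => hF θ q'.2
  have h4 := h3.int_mul m q'.1
  rw [← hm, ← h₂] at h4
  rw [h₂] at h4
  have h5 : q = (q.1, q'.2) := Prod.ext rfl h₂
  rw [h5]
  exact h4

theorem isOpenMap_circle_exp_prodMap : IsOpenMap (Prod.map Circle.exp id : ℝ × ℝ × ℝ → Circle × ℝ × ℝ) :=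
  isLocalHomeomorph_circleExp.isOpenMap.prodMap IsOpenMap.id

/-- A map that is periodic in the first variable and injective, up to the period, on the first axis
is injective up to the period on a neighborhood of the axis if it is locally injective. -/
theorem exists_open_injective_mod_period {X : Type*} [TopologicalSpace X] [T2Space X]
    {F : ℝ × ℝ × ℝ → X} (hF : ∀ θ y, F (θ + 2 * Real.pi, y) = F (θ, y))
    (hcont : ∀ θ, ContinuousAt F (θ, 0, 0)) (hloc : ∀ θ, ∃ V ∈ 𝓝 (θ, 0, 0), InjOn F V)
    (hinj : ∀ θ θ', F (θ, 0, 0) = F (θ', 0, 0) → Circle.exp θ = Circle.exp θ') :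
    ∃ O : Set (ℝ × ℝ × ℝ), IsOpen O ∧ (∀ θ, (θ, 0, 0) ∈ O) ∧ ∀ q ∈ O, ∀ q' ∈ O, F q = F q' →
      Circle.exp q.1 = Circle.exp q'.1 ∧ q.2 = q'.2 := by
  let π : ℝ × ℝ × ℝ → Circle × ℝ × ℝ := Prod.map Circle.exp id
  have hπ : Continuous π := Circle.exp.continuous.prodMap continuous_id
  -- On the quotient the axis becomes a compact circle, so injectivity on it and local injectivity
  -- give injectivity on a neighbourhood. The representative chosen by the argument is immaterial by
  -- periodicity.
  let F' : Circle × ℝ × ℝ → X := fun q => F (Complex.arg q.1, q.2)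
  have hF' : ∀ q, F' (π q) = F q := fun q =>
    eq_of_circle_exp_eq hF (Circle.exp_arg _) rfl
  have hs : ∀ c : Circle × ℝ × ℝ, c ∈ (univ : Set Circle) ×ˢ {((0 : ℝ), (0 : ℝ))} →
      ∃ θ : ℝ, c = π (θ, 0, 0) := by
    rintro ⟨c, y⟩ ⟨-, hy⟩
    obtain ⟨θ, rfl⟩ := Circle.exp_surjective c
    rw [mem_singleton_iff] at hy
    exact ⟨θ, Prod.ext rfl hy⟩
  obtain ⟨t, ht, htinj⟩ := InjOn.exists_mem_nhdsSet (f := F')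
    (s := (univ : Set Circle) ×ˢ {((0 : ℝ), (0 : ℝ))}) (by
      intro c hc c' hc' h
      obtain ⟨θ, rfl⟩ := hs c hc
      obtain ⟨θ', rfl⟩ := hs c' hc'
      rw [hF', hF'] at h
      exact Prod.ext (hinj θ θ' h) rfl) (isCompact_univ.prod isCompact_singleton) (by
      intro c hc
      obtain ⟨θ, rfl⟩ := hs c hc
      have h1 : Filter.map F (𝓝 (θ, 0, 0)) ≤ 𝓝 (F' (π (θ, 0, 0))) := by
        rw [hF']; exact hcont θ
      have h2 : F = F' ∘ π := funext fun q => (hF' q).symm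
      rw [h2, ← Filter.map_map] at h1
      exact (Filter.map_mono (isOpenMap_circle_exp_prodMap.nhds_le _)).trans h1) (by
      intro c hc
      obtain ⟨θ, rfl⟩ := hs c hc
      obtain ⟨V, hV, hVinj⟩ := hloc θ
      refine ⟨π '' V, isOpenMap_circle_exp_prodMap.image_mem_nhds hV, ?_⟩
      rintro _ ⟨q, hq, rfl⟩ _ ⟨q', hq', rfl⟩ h
      rw [hF', hF'] at h
      rw [hVinj hq hq' h])
  refine ⟨π ⁻¹' interior t, isOpen_interior.preimage hπ, fun θ => ?_, fun q hq q' hq' h => ?_⟩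
  · exact subset_interior_iff_mem_nhdsSet.2 ht ⟨mem_univ _, rfl⟩
  · have h1 : π q = π q' := htinj (interior_subset hq) (interior_subset hq') (by rwa [hF', hF'])
    exact ⟨congrArg (fun c : Circle × ℝ × ℝ => c.1) h1, congrArg (fun c : Circle × ℝ × ℝ => c.2) h1⟩

end CircleTube

/-! ### The map to the jet space and the standard contact form -/

section JetMaps

theorem dTheta_mfderiv_circle_exp (θ r : ℝ) :
    dTheta (Circle.exp θ) (mfderiv 𝓘(ℝ, ℝ) (𝓡 1) Circle.exp θ r) = r := by
  have : Fact (Module.finrank ℝ ℂ = 1 + 1) := ⟨Complex.finrank_real_complex⟩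
  have h1 : MDifferentiableAt (𝓡 1) 𝓘(ℝ, ℂ) (fun w : Circle => (w : ℂ)) (Circle.exp θ) :=
    (contMDiff_coe_sphere (E := ℂ) (n := 1) (m := 1)).mdifferentiable (by simp) _
  have h2 : MDifferentiableAt 𝓘(ℝ, ℝ) (𝓡 1) Circle.exp θ :=
    (contMDiff_circleExp (m := 1)).mdifferentiable (by simp) _
  have h3 := h1.hasMFDerivAt.comp θ h2.hasMFDerivAt
  have h4 : HasDerivAt (fun θ : ℝ => Complex.exp (θ * Complex.I)) (Complex.exp (θ * Complex.I) * Complex.I) θ := by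
    have := ((hasDerivAt_id (θ : ℂ)).mul_const Complex.I).cexp.comp_ofReal
    simpa using this
  have h5 : HasFDerivAt (fun θ : ℝ => Complex.exp (θ * Complex.I)) (show ℝ →L[ℝ] ℂ from
    (mfderiv (𝓡 1) 𝓘(ℝ, ℂ) (fun w : Circle => (w : ℂ)) (Circle.exp θ)).comp
      (mfderiv 𝓘(ℝ, ℝ) (𝓡 1) Circle.exp θ)) θ := hasMFDerivAt_iff_hasFDerivAt.1 h3
  have h6 := congrArg (fun L : ℝ →L[ℝ] ℂ => L r) (h5.unique h4.hasFDerivAt)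
  change Complex.im (starRingEnd ℂ (Circle.exp θ : ℂ) * (show ℂ from mfderiv (𝓡 1) 𝓘(ℝ, ℂ)
    (fun w : Circle => (w : ℂ)) (Circle.exp θ) (mfderiv 𝓘(ℝ, ℝ) (𝓡 1) Circle.exp θ r))) = r
  refine (congrArg (fun z : ℂ => Complex.im (starRingEnd ℂ (Circle.exp θ : ℂ) * z)) h6).trans ?_
  have h7 : starRingEnd ℂ (Circle.exp θ : ℂ) * Complex.exp (θ * Complex.I) = 1 := by
    rw [← Circle.coe_exp, mul_comm, Complex.mul_conj, Circle.normSq_coe]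
    simp
  simp only [ContinuousLinearMap.toSpanSingleton_apply, Complex.real_smul]
  rw [show starRingEnd ℂ (Circle.exp θ : ℂ) * (r * (Complex.exp (θ * Complex.I) * Complex.I)) =
    (starRingEnd ℂ (Circle.exp θ : ℂ) * Complex.exp (θ * Complex.I)) * (r * Complex.I) by ring, h7]
  simp

variable {p : ℝ × ℝ × ℝ → ℝ} {q : ℝ × ℝ × ℝ}

/-- The map to the jet space with angle and height the first two variables and slope `p`. -/
def jetMap (p : ℝ × ℝ × ℝ → ℝ) (q : ℝ × ℝ × ℝ) : JetCircle := (Circle.exp q.1, p q, q.2.1)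

theorem contMDiffAt_jetMap (hp : ContDiffAt ℝ ∞ p q) :
    ContMDiffAt 𝓘(ℝ, ℝ × ℝ × ℝ) jetModel ∞ (jetMap p) q := by
  have h1 : ContMDiff 𝓘(ℝ, ℝ × ℝ × ℝ) (𝓡 1) ∞ (fun q : ℝ × ℝ × ℝ => Circle.exp q.1) :=
    contMDiff_circleExp.comp contDiff_fst.contMDiff
  have h2 : ContMDiff 𝓘(ℝ, ℝ × ℝ × ℝ) 𝓘(ℝ, ℝ) ∞ (fun q : ℝ × ℝ × ℝ => q.2.1) :=
    contDiff_snd.fst.contMDiff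
  exact (h1 q).prodMk (hp.contMDiffAt.prodMk (h2 q))

theorem dTheta_mfderiv_jetMap (hp : ContDiffAt ℝ ∞ p q) (u : ℝ × ℝ × ℝ) :
    dTheta (jetMap p q).1 (mfderiv jetModel (𝓡 1) (fun r : JetCircle => r.1) (jetMap p q)
      (mfderiv 𝓘(ℝ, ℝ × ℝ × ℝ) jetModel (jetMap p) q u)) = u.1 := by
  have h1 : MDifferentiableAt jetModel (𝓡 1) (fun r : JetCircle => r.1) (jetMap p q) :=
    mdifferentiableAt_fst
  have h2 := h1.hasMFDerivAt.comp q ((contMDiffAt_jetMap hp).mdifferentiableAt (by simp)).hasMFDerivAt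
  have h3 : MDifferentiableAt 𝓘(ℝ, ℝ) (𝓡 1) Circle.exp q.1 :=
    (contMDiff_circleExp (m := 1)).mdifferentiable (by simp) _
  have h4 := h3.hasMFDerivAt.comp (f := fun q : ℝ × ℝ × ℝ => q.1) q
    (hasFDerivAt_fst (𝕜 := ℝ) (E := ℝ) (F := ℝ × ℝ) (p := q)).hasMFDerivAt
  have h5 := congrArg (fun L : ℝ × ℝ × ℝ →L[ℝ] EuclideanSpace ℝ (Fin 1) => L u)
    (hasMFDerivAt_unique h2 h4)
  exact (congrArg (dTheta (Circle.exp q.1) : EuclideanSpace ℝ (Fin 1) →L[ℝ] ℝ) h5).trans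
    (dTheta_mfderiv_circle_exp q.1 u.1)

theorem mfderiv_slope_jetMap (hp : ContDiffAt ℝ ∞ p q) (u : ℝ × ℝ × ℝ) :
    mfderiv jetModel 𝓘(ℝ, ℝ) (fun r : JetCircle => r.2.1) (jetMap p q)
      (mfderiv 𝓘(ℝ, ℝ × ℝ × ℝ) jetModel (jetMap p) q u) = fderiv ℝ p q u := by
  have h1 : MDifferentiableAt jetModel 𝓘(ℝ, ℝ) (fun r : JetCircle => r.2.1) (jetMap p q) :=
    mdifferentiableAt_fst.comp (jetMap p q) mdifferentiableAt_snd
  have h2 := h1.hasMFDerivAt.comp q ((contMDiffAt_jetMap hp).mdifferentiableAt (by simp)).hasMFDerivAt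
  have h3 := (hp.differentiableAt (by simp)).hasFDerivAt.hasMFDerivAt
  exact congrArg (fun L : ℝ × ℝ × ℝ →L[ℝ] ℝ => L u) (hasMFDerivAt_unique h2 h3)

theorem mfderiv_height_jetMap (hp : ContDiffAt ℝ ∞ p q) (u : ℝ × ℝ × ℝ) :
    mfderiv jetModel 𝓘(ℝ, ℝ) (fun r : JetCircle => r.2.2) (jetMap p q)
      (mfderiv 𝓘(ℝ, ℝ × ℝ × ℝ) jetModel (jetMap p) q u) = u.2.1 := by
  have h1 : MDifferentiableAt jetModel 𝓘(ℝ, ℝ) (fun r : JetCircle => r.2.2) (jetMap p q) :=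
    mdifferentiableAt_snd.comp (jetMap p q) mdifferentiableAt_snd
  have h2 := h1.hasMFDerivAt.comp q ((contMDiffAt_jetMap hp).mdifferentiableAt (by simp)).hasMFDerivAt
  have h3 := (hasFDerivAt_snd (𝕜 := ℝ) (E := ℝ) (F := ℝ × ℝ) (p := q)).fst.hasMFDerivAt
  exact congrArg (fun L : ℝ × ℝ × ℝ →L[ℝ] ℝ => L u) (hasMFDerivAt_unique h2 h3)

theorem jetForm_mfderiv_jetMap (hp : ContDiffAt ℝ ∞ p q) (u : ℝ × ℝ × ℝ) :
    jetForm (jetMap p q) (mfderiv 𝓘(ℝ, ℝ × ℝ × ℝ) jetModel (jetMap p) q u) = u.2.1 - p q * u.1 := by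
  have h1 := dTheta_mfderiv_jetMap hp u
  have h2 := mfderiv_height_jetMap hp u
  exact congrArg₂ (fun a b : ℝ => a - p q * b) h2 h1

end JetMaps

/-! ### Local invertibility of the map to the jet space -/

section JetMapLocal

variable {p : ℝ × ℝ × ℝ → ℝ} {q : ℝ × ℝ × ℝ} {N : Set (ℝ × ℝ × ℝ)}

theorem map_triple_eq_sum {F : Type*} [NormedAddCommGroup F] [NormedSpace ℝ F]
    (L : ℝ × ℝ × ℝ →L[ℝ] F) (u : ℝ × ℝ × ℝ) :
    L u = u.1 • L (1, 0, 0) + u.2.1 • L (0, 1, 0) + u.2.2 • L (0, 0, 1) := by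
  rw [← map_smul, ← map_smul, ← map_smul, ← map_add, ← map_add]
  simp

theorem eq_zero_of_fderiv_slope_ne_zero (h3 : fderiv ℝ p q (0, 0, 1) ≠ 0) {u : ℝ × ℝ × ℝ}
    (h₁ : u.1 = 0) (h₂ : u.2.1 = 0) (hu : fderiv ℝ p q u = 0) : u = 0 := by
  rw [map_triple_eq_sum, h₁, h₂, zero_smul, zero_smul, zero_add, zero_add, smul_eq_mul] at hu
  exact Prod.ext h₁ (Prod.ext h₂ ((mul_eq_zero.1 hu).resolve_right h3))

theorem mfderiv_jetMap_eq_zero (hp : ContDiffAt ℝ ∞ p q) (h3 : fderiv ℝ p q (0, 0, 1) ≠ 0)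
    {u : ℝ × ℝ × ℝ} (hu : mfderiv 𝓘(ℝ, ℝ × ℝ × ℝ) jetModel (jetMap p) q u = 0) : u = 0 := by
  have h1 := dTheta_mfderiv_jetMap hp u
  have h2 := mfderiv_height_jetMap hp u
  have h4 := mfderiv_slope_jetMap hp u
  rw [hu, map_zero, map_zero] at h1
  rw [hu, map_zero] at h2 h4
  exact eq_zero_of_fderiv_slope_ne_zero h3 h1.symm h2.symm h4.symm

theorem jetMap_local (hN : IsOpen N) (hp : ContDiffOn ℝ ∞ p N) (hq : q ∈ N)
    (h3 : fderiv ℝ p q (0, 0, 1) ≠ 0) :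
    (∃ V ∈ 𝓝 q, InjOn (jetMap p) V) ∧ 𝓝 (jetMap p q) ≤ Filter.map (jetMap p) (𝓝 q) := by
  let f : ℝ × ℝ × ℝ → ℝ × ℝ × ℝ := fun q => (q.1, p q, q.2.1)
  have hpq := hp.contDiffAt (hN.mem_nhds hq)
  let f' : ℝ × ℝ × ℝ →L[ℝ] ℝ × ℝ × ℝ := (ContinuousLinearMap.fst ℝ ℝ (ℝ × ℝ)).prod
    ((fderiv ℝ p q).prod ((ContinuousLinearMap.fst ℝ ℝ ℝ).comp (ContinuousLinearMap.snd ℝ ℝ (ℝ × ℝ))))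
  have hf' : HasFDerivAt f f' q :=
    hasFDerivAt_fst.prodMk ((hpq.differentiableAt (by simp)).hasFDerivAt.prodMk hasFDerivAt_snd.fst)
  have hf : ContDiffOn ℝ ∞ f N :=
    contDiff_fst.contDiffOn.prodMk (hp.prodMk contDiff_snd.fst.contDiffOn)
  have hinj : ∀ u, f' u = 0 → u = 0 := fun u hu =>
    eq_zero_of_fderiv_slope_ne_zero h3 (congrArg (fun y : ℝ × ℝ × ℝ => y.1) hu)
      (congrArg (fun y : ℝ × ℝ × ℝ => y.2.2) hu) (congrArg (fun y : ℝ × ℝ × ℝ => y.2.1) hu)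
  let L := ((f' : ℝ × ℝ × ℝ →ₗ[ℝ] ℝ × ℝ × ℝ).linearEquivOfInjective
    ((injective_iff_map_eq_zero _).2 hinj) rfl).toContinuousLinearEquiv
  have hL : HasFDerivAt f (L : ℝ × ℝ × ℝ →L[ℝ] ℝ × ℝ × ℝ) q := by
    have h1 : (L : ℝ × ℝ × ℝ →L[ℝ] ℝ × ℝ × ℝ) = f' := ContinuousLinearMap.ext fun u => rfl
    rwa [h1]
  obtain ⟨e, hqe, -, hef, -⟩ := exists_contDiffOn_localInverse hN hf hq L hL
  have hef' : (e : ℝ × ℝ × ℝ → ℝ × ℝ × ℝ) = f := funext hef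
  constructor
  · refine ⟨e.source ∩ (fun q' => q'.1) ⁻¹' Metric.ball q.1 1, Filter.inter_mem
      (e.open_source.mem_nhds hqe) (continuousAt_fst.preimage_mem_nhds
        (Metric.ball_mem_nhds q.1 one_pos)), ?_⟩
    rintro q₁ ⟨h₁, h₁'⟩ q₂ ⟨h₂, h₂'⟩ h
    refine e.injOn h₁ h₂ ?_
    rw [hef, hef]
    have h4 : Circle.exp q₁.1 = Circle.exp q₂.1 := congrArg (fun r : JetCircle => r.1) h
    obtain ⟨m, hm⟩ := Circle.exp_eq_exp.1 h4
    -- Angles in a ball of radius 1 differ by less than 2, hence by less than 2π, so equal points on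
    -- the circle come from equal angles.
    have h5 : |q₁.1 - q₂.1| < 2 := by
      have h6 : |q₁.1 - q.1| < 1 := h₁'
      have h7 : |q₂.1 - q.1| < 1 := h₂'
      rw [abs_lt] at h6 h7 ⊢
      constructor <;> linarith [h6.1, h6.2, h7.1, h7.2]
    have h6 : m = 0 := by
      by_contra hm0
      have h7 : (1 : ℝ) ≤ |(m : ℝ)| := by exact_mod_cast Int.one_le_abs hm0
      rw [hm, add_sub_cancel_left, abs_mul, abs_of_pos Real.two_pi_pos] at h5
      nlinarith [Real.pi_gt_three]
    have h7 : q₁.1 = q₂.1 := by rw [hm, h6]; simp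
    exact Prod.ext h7 (congrArg (fun r : JetCircle => r.2) h)
  · have h4 : jetMap p = Prod.map Circle.exp id ∘ f := rfl
    rw [h4, ← Filter.map_map, ← hef', e.map_nhds_eq hqe]
    exact isOpenMap_circle_exp_prodMap.nhds_le _

end JetMapLocal

/-! ### The contact embedding into the jet space -/

section JetEmbedding

variable {M : Type*} [TopologicalSpace M] [ChartedSpace (EuclideanSpace ℝ (Fin 3)) M]
  [IsManifold (𝓡 3) ∞ M] [T2Space M] {α : OneForm (𝓡 3) M}

/-- A parametrization of a neighborhood of a knot by the angle, a transverse and a Legendrian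
variable, whose Legendrian lines twist, is a contact embedding into the jet space up to the choice
of the slope as the third coordinate. -/
theorem OneForm.IsContact.exists_jet_embedding (hα : α.IsContact) {Ψ : ℝ × ℝ × ℝ → M}
    (hΨ : ContMDiff 𝓘(ℝ, ℝ × ℝ × ℝ) (𝓡 3) ∞ Ψ)
    (hΨT : ∀ θ y, Ψ (θ + 2 * Real.pi, y) = Ψ (θ, y))
    (hs : ∀ q, α.pullback Ψ q (0, 0, 1) = 0) (hz : ∀ θ, α.pullback Ψ (θ, 0, 0) (0, 1, 0) = 1)
    (hneg : ∀ θ, fderiv ℝ (α.pullback Ψ) (θ, 0, 0) (0, 0, 1)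
        (1, -α.pullback Ψ (θ, 0, 0) (1, 0, 0), 0) -
      fderiv ℝ (α.pullback Ψ) (θ, 0, 0) (1, -α.pullback Ψ (θ, 0, 0) (1, 0, 0), 0) (0, 0, 1) < 0)
    (hinj : ∀ θ θ', Ψ (θ, 0, 0) = Ψ (θ', 0, 0) → Circle.exp θ = Circle.exp θ') :
    ∃ (U : Set M) (φ : M → JetCircle), IsContactEmbOn α jetForm U φ ∧ ∀ θ, Ψ (θ, 0, 0) ∈ U ∧
      φ (Ψ (θ, 0, 0)) = (Circle.exp θ, -α.pullback Ψ (θ, 0, 0) (1, 0, 0), 0) := by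
  have hΨd : MDifferentiable 𝓘(ℝ, ℝ × ℝ × ℝ) (𝓡 3) Ψ := hΨ.mdifferentiable (by simp)
  set a := α.pullback Ψ with ha_def
  have ha : ContDiff ℝ ∞ a := contDiff_iff_contDiffAt.2 fun q => hα.1.contDiffAt_pullback (hΨ q)
  have hda : ContDiff ℝ ∞ (fderiv ℝ a) := ha.fderiv_right (by simp)
  have happ : ∀ u : ℝ × ℝ × ℝ, ContDiff ℝ ∞ (fun q => a q u) := fun u => ha.clm_apply contDiff_const
  have hdapp : ∀ u v : ℝ × ℝ × ℝ, ContDiff ℝ ∞ (fun q => fderiv ℝ a q u v) := fun u v =>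
    (hda.clm_apply contDiff_const).clm_apply contDiff_const
  have hfd : ∀ q u, HasFDerivAt (fun q => a q u) ((fderiv ℝ a q).flip u) q := fun q u => by
    have h1 := (ha.differentiable (by simp) q).hasFDerivAt.clm_apply (hasFDerivAt_const u q)
    refine h1.congr_fderiv (ContinuousLinearMap.ext fun v => ?_)
    simp
  have hs' : ∀ q v, fderiv ℝ a q v (0, 0, 1) = 0 := fun q v => by
    have h1 := hfd q (0, 0, 1)
    have h2 : (fun q => a q (0, 0, 1)) = fun _ => (0 : ℝ) := funext hs
    rw [h2] at h1
    exact congrArg (fun L : ℝ × ℝ × ℝ →L[ℝ] ℝ => L v) (h1.unique (hasFDerivAt_const 0 q))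
  have hd : ∀ q u, fderiv ℝ a q (0, 0, 1) u = α.d (Ψ q)
      (mfderiv 𝓘(ℝ, ℝ × ℝ × ℝ) (𝓡 3) Ψ q ((0, 0, 1) : ℝ × ℝ × ℝ))
      (mfderiv 𝓘(ℝ, ℝ × ℝ × ℝ) (𝓡 3) Ψ q u) := fun q u => by
    have h1 := hα.1.fderiv_pullback (hΨ q) (0, 0, 1) u
    rw [← ha_def, hs', sub_zero] at h1
    exact h1
  -- With A, B the coefficients of dθ and dz, W = A_s B - A B_s = dα(∂_s, B ∂_θ - A ∂_z). On the
  -- axis B = 1 and W is the quantity assumed negative.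
  let W : ℝ × ℝ × ℝ → ℝ := fun q => fderiv ℝ a q (0, 0, 1) (1, 0, 0) * a q (0, 1, 0) -
    a q (1, 0, 0) * fderiv ℝ a q (0, 0, 1) (0, 1, 0)
  have hW : Continuous W :=
    (((hdapp _ _).mul (happ _)).sub ((happ _).mul (hdapp _ _))).continuous
  let N : Set (ℝ × ℝ × ℝ) := {q | 0 < a q (0, 1, 0) ∧ W q < 0}
  have hN : IsOpen N := (isOpen_lt continuous_const (happ _).continuous).inter
    (isOpen_lt hW continuous_const)
  have hNaxis : ∀ θ, (θ, 0, 0) ∈ N := fun θ => by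
    refine ⟨by rw [hz]; exact one_pos, ?_⟩
    have h1 := hneg θ
    rw [hs', sub_zero, map_triple_eq_sum] at h1
    simp only [smul_eq_mul, one_mul, zero_mul, add_zero] at h1
    simp only [W, hz, mul_one]
    linarith
  have hΨinj : ∀ q ∈ N, ∀ u : ℝ × ℝ × ℝ, mfderiv 𝓘(ℝ, ℝ × ℝ × ℝ) (𝓡 3) Ψ q u = 0 → u = 0 := by
    rintro q ⟨hA, hWq⟩ u hu
    have h1 : a q u = 0 := (congrArg (α (Ψ q)) hu).trans (map_zero _)
    have h2 : fderiv ℝ a q (0, 0, 1) u = 0 := by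
      rw [hd, hu, α.d_swap, α.d_zero_left, neg_zero]
    rw [map_triple_eq_sum, hs] at h1
    rw [map_triple_eq_sum, hs'] at h2
    simp only [smul_eq_mul, mul_zero, add_zero] at h1 h2
    -- A vector u killed by dΨ satisfies α(u) = 0 and dα(∂_s, u) = 0, a 2 × 2 system for the θ- and
    -- z-components of u with determinant -W.
    have h3 : u.1 * W q = 0 := by
      simp only [W]
      linear_combination a q (0, 1, 0) * h2 - fderiv ℝ a q (0, 0, 1) (0, 1, 0) * h1
    have h4 : u.1 = 0 := (mul_eq_zero.1 h3).resolve_right hWq.ne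
    have h5 : u.2.1 = 0 := by
      rw [h4, zero_mul, zero_add] at h1
      exact (mul_eq_zero.1 h1).resolve_right hA.ne'
    have h6 : u.2.2 = 0 := by
      by_contra h0
      have h7 : (show ℝ × ℝ × ℝ →L[ℝ] EuclideanSpace ℝ (Fin 3) from
          mfderiv 𝓘(ℝ, ℝ × ℝ × ℝ) (𝓡 3) Ψ q) u = 0 := hu
      rw [map_triple_eq_sum, h4, h5, zero_smul, zero_smul, zero_add, zero_add] at h7
      have h8 : mfderiv 𝓘(ℝ, ℝ × ℝ × ℝ) (𝓡 3) Ψ q ((0, 0, 1) : ℝ × ℝ × ℝ) = 0 :=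
        (smul_eq_zero.1 h7).resolve_left h0
      -- If ∂_s Ψ vanished, pairing it under dα with B ∂_θ - A ∂_z would give W = 0.
      have h9 := hd q (a q (0, 1, 0), -a q (1, 0, 0), 0)
      rw [h8, α.d_zero_left, map_triple_eq_sum] at h9
      simp only [smul_eq_mul, zero_mul, add_zero] at h9
      refine hWq.ne ?_
      simp only [W]
      linear_combination h9
    exact Prod.ext h4 (Prod.ext h5 h6)
  -- the slope
  let p : ℝ × ℝ × ℝ → ℝ := fun q => -(a q (1, 0, 0) / a q (0, 1, 0))
  have hp : ContDiffOn ℝ ∞ p N :=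
    ((happ _).contDiffOn.div (happ _).contDiffOn fun q hq => hq.1.ne').neg
  have hpa : ∀ q ∈ N, ContDiffAt ℝ ∞ p q := fun q hq => hp.contDiffAt (hN.mem_nhds hq)
  -- Differentiating p B = -A in s gives B² p_s = -W.
  have hp3 : ∀ q ∈ N, fderiv ℝ p q (0, 0, 1) ≠ 0 := by
    intro q hq h0
    have h1 : (fun q => p q * a q (0, 1, 0)) =ᶠ[𝓝 q] fun q => -a q (1, 0, 0) := by
      filter_upwards [hN.mem_nhds hq] with q' hq'
      simp only [p, neg_mul, div_mul_cancel₀ _ hq'.1.ne']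
    have h2 := ((hpa q hq).differentiableAt (by simp)).hasFDerivAt.mul (hfd q (0, 1, 0))
    have h3 := h2.unique ((hfd q (1, 0, 0)).neg.congr_of_eventuallyEq h1)
    have h4 := congrArg (fun L : ℝ × ℝ × ℝ →L[ℝ] ℝ => L (0, 0, 1)) h3
    simp only [add_apply, smul_apply, neg_apply, ContinuousLinearMap.flip_apply,
      h0, smul_eq_mul] at h4
    have h5 : p q * a q (0, 1, 0) = -a q (1, 0, 0) := h1.self_of_nhds
    refine hq.2.ne ?_
    simp only [W]
    linear_combination a q (0, 1, 0) * h4 - fderiv ℝ a q (0, 0, 1) (0, 1, 0) * h5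
  have hpT : ∀ θ y, p (θ + 2 * Real.pi, y) = p (θ, y) := fun θ y => by
    have h1 : a (θ + 2 * Real.pi, y) = a (θ, y) := by
      have h2 := α.pullback_add hΨd (c := (2 * Real.pi, 0)) (fun q => by
        have h3 := hΨT q.1 q.2
        have h4 : q + (2 * Real.pi, 0) = (q.1 + 2 * Real.pi, q.2) := Prod.ext rfl (add_zero _)
        rw [h4, h3]) (θ, y)
      rwa [Prod.mk_add_mk, add_zero] at h2
    simp only [p, h1]
  have hJT : ∀ θ y, jetMap p (θ + 2 * Real.pi, y) = jetMap p (θ, y) := fun θ y => by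
    simp only [jetMap, hpT, Circle.periodic_exp θ]
  -- the neighborhood of the axis
  obtain ⟨O₁, hO₁, hO₁axis, hO₁inj⟩ := exists_open_injective_mod_period hΨT
    (fun θ => hΨ.continuous.continuousAt)
    (fun θ => (exists_contMDiffAt_local_section hΨ (hΨinj _ (hNaxis θ))).elim fun _ h => h.2.2.2) hinj
  obtain ⟨O₂, hO₂, hO₂axis, hO₂inj⟩ := exists_open_injective_mod_period hJT
    (fun θ => (contMDiffAt_jetMap (hpa _ (hNaxis θ))).continuousAt)
    (fun θ => (jetMap_local hN hp (hNaxis θ) (hp3 _ (hNaxis θ))).1)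
    (fun θ θ' h => congrArg (fun r : JetCircle => r.1) h)
  let N' : Set (ℝ × ℝ × ℝ) := N ∩ (O₁ ∩ O₂)
  have hN' : IsOpen N' := hN.inter (hO₁.inter hO₂)
  -- An arbitrary preimage may be used: two preimages in N' differ by a multiple of the period,
  -- under which `jetMap p` is invariant.
  let φ : M → JetCircle := fun x => jetMap p (Function.invFunOn Ψ N' x)
  have hφ : ∀ q ∈ N', φ (Ψ q) = jetMap p q := fun q hq => by
    have h1 : ∃ q' ∈ N', Ψ q' = Ψ q := ⟨q, hq, rfl⟩
    obtain ⟨h2, h3⟩ := hO₁inj _ (Function.invFunOn_mem h1).2.1 q hq.2.1 (Function.invFunOn_eq h1)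
    exact eq_of_circle_exp_eq hJT h2 h3
  have hsec : ∀ q ∈ N', ∃ σ : M → ℝ × ℝ × ℝ, ContMDiffAt (𝓡 3) 𝓘(ℝ, ℝ × ℝ × ℝ) ∞ σ (Ψ q) ∧
      σ (Ψ q) = q ∧ ∀ᶠ x in 𝓝 (Ψ q), Ψ (σ x) = x ∧ σ x ∈ N' := fun q hq => by
    obtain ⟨σ, h1, h2, h3, -⟩ := exists_contMDiffAt_local_section hΨ (hΨinj q hq.1)
    refine ⟨σ, h1, h2, h3.and (h1.continuousAt.eventually ?_)⟩
    rw [h2]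
    exact hN'.mem_nhds hq
  have hU : IsOpen (Ψ '' N') := by
    rw [isOpen_iff_mem_nhds]
    rintro _ ⟨q, hq, rfl⟩
    obtain ⟨σ, -, -, h⟩ := hsec q hq
    exact h.mono fun x hx => ⟨σ x, hx.2, hx.1⟩
  have hφs : ∀ q ∈ N', ContMDiffAt (𝓡 3) jetModel ∞ φ (Ψ q) := fun q hq => by
    obtain ⟨σ, h1, h2, h3⟩ := hsec q hq
    have h4 : ContMDiffAt 𝓘(ℝ, ℝ × ℝ × ℝ) jetModel ∞ (jetMap p) (σ (Ψ q)) := by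
      rw [h2]
      exact contMDiffAt_jetMap (hpa q hq.1)
    refine (h4.comp (Ψ q) h1).congr_of_eventuallyEq (h3.mono fun x hx => ?_)
    have h5 := hφ _ hx.2
    rw [hx.1] at h5
    exact h5
  have hchain : ∀ q ∈ N', ∀ u : ℝ × ℝ × ℝ, (mfderiv (𝓡 3) jetModel φ (Ψ q)
      (mfderiv 𝓘(ℝ, ℝ × ℝ × ℝ) (𝓡 3) Ψ q u) : EuclideanSpace ℝ (Fin 1) × ℝ × ℝ) =
      mfderiv 𝓘(ℝ, ℝ × ℝ × ℝ) jetModel (jetMap p) q u := fun q hq u => by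
    have h1 := ((hφs q hq).mdifferentiableAt (by simp)).hasMFDerivAt.comp q (hΨd q).hasMFDerivAt
    have h2 : jetMap p =ᶠ[𝓝 q] φ ∘ Ψ := by
      filter_upwards [hN'.mem_nhds hq] with q' hq'
      exact (hφ q' hq').symm
    exact congrArg (fun L : ℝ × ℝ × ℝ →L[ℝ] EuclideanSpace ℝ (Fin 1) × ℝ × ℝ => L u)
      (h1.congr_of_eventuallyEq h2).mfderiv.symm
  have hsurj : ∀ q ∈ N', ∀ v : TangentSpace (𝓡 3) (Ψ q), ∃ u : ℝ × ℝ × ℝ,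
      mfderiv 𝓘(ℝ, ℝ × ℝ × ℝ) (𝓡 3) Ψ q u = v := fun q hq v => by
    let L : ℝ × ℝ × ℝ →L[ℝ] EuclideanSpace ℝ (Fin 3) := mfderiv 𝓘(ℝ, ℝ × ℝ × ℝ) (𝓡 3) Ψ q
    have h1 : Function.Injective (L : ℝ × ℝ × ℝ →ₗ[ℝ] EuclideanSpace ℝ (Fin 3)) :=
      (injective_iff_map_eq_zero _).2 (hΨinj q hq.1)
    exact (LinearMap.injective_iff_surjective_of_finrank_eq_finrank (by simp)).1 h1 v
  refine ⟨Ψ '' N', φ, ⟨hU, ?_, ?_, ?_, ?_⟩, fun θ => ?_⟩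
  · rintro _ ⟨q, hq, rfl⟩
    exact (hφs q hq).contMDiffWithinAt
  · rintro _ ⟨q, hq, rfl⟩
    refine (injective_iff_map_eq_zero _).2 fun v hv => ?_
    obtain ⟨u, rfl⟩ := hsurj q hq v
    have h1 : u = 0 := mfderiv_jetMap_eq_zero (hpa q hq.1) (hp3 q hq.1) ((hchain q hq u).symm.trans hv)
    rw [h1]
    exact map_zero _
  · refine (IsOpenEmbedding.of_continuous_injective_isOpenMap ?_ ?_ ?_).isEmbedding
    · rw [← continuousOn_iff_continuous_domRestrict]
      rintro _ ⟨q, hq, rfl⟩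
      exact (hφs q hq).continuousAt.continuousWithinAt
    · rintro ⟨_, q, hq, rfl⟩ ⟨_, q', hq', rfl⟩ h
      have h1 : jetMap p q = jetMap p q' := (hφ q hq).symm.trans (h.trans (hφ q' hq'))
      obtain ⟨h2, h3⟩ := hO₂inj q hq.2.2 q' hq'.2.2 h1
      exact Subtype.ext (eq_of_circle_exp_eq hΨT h2 h3)
    · rw [isOpenMap_iff_nhds_le]
      rintro ⟨_, q, hq, rfl⟩
      have h1 : Filter.map ((Ψ '' N').domRestrict φ) (𝓝 ⟨Ψ q, q, hq, rfl⟩) =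
          Filter.map φ (𝓝 (Ψ q)) := by
        rw [← map_nhds_subtype_coe_eq_nhds (p := (· ∈ Ψ '' N')) ⟨q, hq, rfl⟩
          (hU.mem_nhds ⟨q, hq, rfl⟩), Filter.map_map]
        rfl
      rw [h1]
      have h2 : Filter.map φ (Filter.map Ψ (𝓝 q)) ≤ Filter.map φ (𝓝 (Ψ q)) :=
        Filter.map_mono hΨ.continuous.continuousAt
      refine le_trans ?_ h2
      rw [Filter.map_map]
      have h3 : φ ∘ Ψ =ᶠ[𝓝 q] jetMap p := by
        filter_upwards [hN'.mem_nhds hq] with q' hq'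
        exact hφ q' hq'
      rw [Filter.map_congr h3]
      change 𝓝 (φ (Ψ q)) ≤ _
      rw [hφ q hq]
      exact (jetMap_local hN hp hq.1 (hp3 q hq.1)).2
  · rintro _ ⟨q, hq, rfl⟩
    -- Since α pulls back to A dθ + B dz = B (dz - p dθ), the conformal factor is 1 / B.
    refine ⟨(a q (0, 1, 0))⁻¹, inv_pos.2 hq.1.1, fun v => ?_⟩
    obtain ⟨u, rfl⟩ := hsurj q hq v
    have h1 : ∀ y y' : JetCircle, y = y' →
        (jetForm y : EuclideanSpace ℝ (Fin 1) × ℝ × ℝ →L[ℝ] ℝ) = jetForm y' := by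
      rintro y _ rfl; rfl
    have h2 := jetForm_mfderiv_jetMap (hpa q hq.1) u
    refine (congrArg (jetForm (φ (Ψ q)) : EuclideanSpace ℝ (Fin 1) × ℝ × ℝ →L[ℝ] ℝ)
      (hchain q hq u)).trans ((congrArg (fun L : EuclideanSpace ℝ (Fin 1) × ℝ × ℝ →L[ℝ] ℝ => L _)
        (h1 _ _ (hφ q hq))).trans (h2.trans ?_))
    change _ = (a q (0, 1, 0))⁻¹ * a q u
    rw [map_triple_eq_sum (a q) u, hs]
    have h3 : a q (0, 1, 0) ≠ 0 := hq.1.1.ne'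
    simp only [p, smul_eq_mul]
    field_simp
    ring
  · have h1 : ((θ, 0, 0) : ℝ × ℝ × ℝ) ∈ N' := ⟨hNaxis θ, hO₁axis θ, hO₂axis θ⟩
    refine ⟨⟨_, h1, rfl⟩, ?_⟩
    rw [hφ _ h1]
    simp only [jetMap, p, hz, div_one]

/-- Every knot has a neighborhood that embeds into the jet space of the circle as a contact
manifold, with the height zero along the knot. -/
theorem exists_normalForm_knot [SecondCountableTopology M] (hα : α.IsContact) {γ : Circle → M}
    (hγ : IsSmoothEmb (𝓡 1) (𝓡 3) γ) :
    ∃ (U : Set M) (φ : M → JetCircle), range γ ⊆ U ∧ IsContactEmbOn α jetForm U φ ∧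
      ∀ θ : ℝ, φ (γ (Circle.exp θ)) =
        (Circle.exp θ, -α (γ (Circle.exp θ)) (angularVelocity γ θ), 0) := by
  let Γ : ℝ → M := fun θ => γ (Circle.exp θ)
  have hΓ : ContMDiff 𝓘(ℝ, ℝ) (𝓡 3) ∞ Γ := hγ.smooth.comp contMDiff_circleExp
  have hΓT : Function.Periodic Γ (2 * Real.pi) := fun θ => congrArg γ (Circle.periodic_exp θ)
  have himm : ∀ θ, mfderiv 𝓘(ℝ, ℝ) (𝓡 3) Γ θ (1 : ℝ) ≠ 0 := fun θ h0 => by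
    have h1 := ((hγ.smooth.mdifferentiable (by simp) (Circle.exp θ)).hasMFDerivAt.comp θ
      ((contMDiff_circleExp (m := 1)).mdifferentiable (by simp) θ).hasMFDerivAt).mfderiv
    have h2 : mfderiv (𝓡 1) (𝓡 3) γ (Circle.exp θ)
        (mfderiv 𝓘(ℝ, ℝ) (𝓡 1) Circle.exp θ (1 : ℝ)) = 0 :=
      (congrArg (fun L : ℝ →L[ℝ] EuclideanSpace ℝ (Fin 3) => L 1) h1).symm.trans h0
    have h3 := (injective_iff_map_eq_zero _).1 (hγ.immersive (Circle.exp θ)) _ h2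
    have h4 := dTheta_mfderiv_circle_exp θ 1
    rw [h3, map_zero] at h4
    exact zero_ne_one h4
  obtain ⟨Ψ, hΨ, hΨT, hΨΓ, hs, hz, hneg⟩ :=
    hα.exists_knot_parametrization hΓ Real.two_pi_pos hΓT himm
  have hpt : ∀ θ, Γ θ = Ψ (θ, 0, 0) := fun θ => congrFun hΨΓ θ
  obtain ⟨U, φ, hU, hφ⟩ := hα.exists_jet_embedding hΨ hΨT hs hz hneg fun θ θ' h => by
    rw [← hpt, ← hpt] at h
    exact hγ.embedding.injective h
  refine ⟨U, φ, ?_, hU, fun θ => ?_⟩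
  · rintro _ ⟨c, rfl⟩
    obtain ⟨θ, rfl⟩ := Circle.exp_surjective c
    have h1 := (hφ θ).1
    rwa [← hpt] at h1
  · have h1 := (hφ θ).2
    rw [← hpt] at h1
    refine h1.trans ?_
    have h2 : α.pullback Ψ (θ, 0, 0) (1, 0, 0) = α (Γ θ) (angularVelocity γ θ) :=
      ((congrArg (α (Γ θ) : EuclideanSpace ℝ (Fin 3) →L[ℝ] ℝ)
        (mfderiv_comp_fst_line (hΨ.mdifferentiable (by simp)) hΨΓ θ)).trans
        (congrArg (fun L : EuclideanSpace ℝ (Fin 3) →L[ℝ] ℝ => L _) (α.congr_point (hpt θ)))).symm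
    rw [h2]

end JetEmbedding

end

theorem mainTheorem5 {M : Type*} [TopologicalSpace M] [T2Space M] [SecondCountableTopology M]
    [ChartedSpace (EuclideanSpace ℝ (Fin 3)) M] [IsManifold (𝓡 3) ∞ M]
    (α : OneForm (𝓡 3) M) (hα : α.IsContact) :
    -- the normal form of a neighborhood of an arbitrary knot
    (∀ γ : Circle → M, IsSmoothEmb (𝓡 1) (𝓡 3) γ →
      ∃ (U : Set M) (φ : M → JetCircle), range γ ⊆ U ∧ IsContactEmbOn α jetForm U φ ∧
        ∀ θ : ℝ, φ (γ (Circle.exp θ)) =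
          (Circle.exp θ, -α (γ (Circle.exp θ)) (angularVelocity γ θ), 0)) ∧
    -- the extension of isotopies of unions of knots and arcs
    (∀ (A : Type*) [TopologicalSpace A] [T2Space A] [CompactSpace A]
      [ChartedSpace (EuclideanHalfSpace 1) A] [IsManifold (𝓡∂ 1) ∞ A]
      (γ : ℝ → A → M) (η : ℝ → (A ≃ₘ⟮𝓡∂ 1, 𝓡∂ 1⟯ A)),
      ContMDiffOn (𝓘(ℝ, ℝ).prod (𝓡∂ 1)) (𝓡 3) ∞ (fun q : ℝ × A => γ q.1 q.2)
        (Icc (0 : ℝ) 1 ×ˢ (univ : Set A)) →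
      (∀ t ∈ Icc (0 : ℝ) 1, IsSmoothEmb (𝓡∂ 1) (𝓡 3) (γ t)) →
      ContMDiffOn (𝓘(ℝ, ℝ).prod (𝓡∂ 1)) (𝓡∂ 1) ∞ (fun q : ℝ × A => η q.1 q.2)
        (Icc (0 : ℝ) 1 ×ˢ (univ : Set A)) →
      (∀ a : A, η 0 a = a) →
      (∃ N ∈ 𝓝ˢ ((𝓡∂ 1).boundary A), ∀ t ∈ Icc (0 : ℝ) 1, ∀ a ∈ N,
        γ t a = γ 0 a ∧ η t a = a) →
      (∀ t ∈ Icc (0 : ℝ) 1, ∀ (a : A) (v : TangentSpace (𝓡∂ 1) a),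
        α (γ t a) (mfderiv (𝓡∂ 1) (𝓡 3) (γ t) a v) =
          α (γ 0 (η t a)) (mfderiv (𝓡∂ 1) (𝓡 3) (γ 0) (η t a)
            (mfderiv (𝓡∂ 1) (𝓡∂ 1) (η t) a v))) →
      ∃ φ : ℝ → (M ≃ₘ⟮𝓡 3, 𝓡 3⟯ M), IsContactIsotopy α φ ∧
        (∀ t ∈ Icc (0 : ℝ) 1, ∀ a : A, φ t (γ 0 a) = γ t ((η t).symm a)) ∧
        ∃ W ∈ 𝓝ˢ (γ 0 '' (𝓡∂ 1).boundary A), ∀ t ∈ Icc (0 : ℝ) 1, ∀ x ∈ W, φ t x = x) := by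
  refine ⟨fun γ hγ => exists_normalForm_knot hα hγ, fun A _ _ _ _ _ γ η hγ hγe hη hη0 hS hform =>
    exists_contactIsotopy_extension hα hγ hγe hη hη0 hS hform⟩
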